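/- Let $\mu_\sigma,\mu_\varepsilon$ be non-zero positive Radon measures on $[0,1]$, and let $\Phi_\sigma(s)=\int_0^1 s^\alpha\,d\mu_\sigma(\alpha)$, $\Phi_\varepsilon(s)=\int_0^1 s^\alpha\,d\mu_\varepsilon(\alpha)$ (principal branch, $\arg s\in(-\pi,\pi]$) and $\Psi(s)=\sqrt{\Phi_\sigma(s)/\Phi_\varepsilon(s)}$ (principal square root). Assume: (T) the signed measure $\mu_\varepsilon(\alpha)\times\mu_\sigma(\beta)-\mu_\sigma(\alpha)\times\mu_\varepsilon(\beta)$ is non-negative on the triangle $\Delta=\{(\alpha,\beta)\in[0,1]^2:\alpha>\beta\}$; (proper fractional model) the support of $\mu_\sigma$ or of $\mu_\varepsilon$ meets the open interval $(0,1)$; (non-exceptional) the pair is not of the form $\mu_\sigma=a\delta_0+\tau_0\lambda$, $\mu_\varepsilon=b\delta_0+\lambda$ with $\tau_0>0$, $a>0$, $b\ge0$, $a/b\ge\tau_0$ (where $a/0=\infty$) and $\lambda$ a positive Radon measure on $[0,1]$ with $\lambda(\{0\})=0$ and $\max\operatorname{supp}\lambda=1$; nor is $\mu_\sigma$ a constant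 multiple of $\mu_\varepsilon$. Then the limits $\tau=\lim_{s\to\infty}\Phi_\sigma(s)/\Phi_\varepsilon(s)\in[0,\infty)$ and $\rho=\lim_{s\to0}\Phi_\sigma(s)/\Phi_\varepsilon(s)\in(0,\infty]$ exist, uniformly in $\arg s$ (where $\rho=\infty$ means $|\Phi_\sigma/\Phi_\varepsilon|\to\infty$). For $x\neq0$ and $t>0$, put $$S(x,t)=\lim_{Y\to\infty}\frac1{2\pi i}\int_{a-iY}^{a+iY}\frac{\Psi(s)}{2s}\,e^{-|x|s\Psi(s)}\,e^{st}\,ds .$$ This limit, the inverse Laplace transform of $\frac{\Psi(s)}{2s}e^{-|x|s\Psi(s)}$, exists for every $a>0$ and does not depend on $a$, and $K=\partial_tS$ exists on $\{x\ne0,\ t>0\}$. Let $H$ be the Heaviside function and $F(x,t)=H(x)K(x,t)$. For $t>0$ put $\mathfrak F_t(\lambda)=tF(\lambda t,t)$. If $\tau>0$ or $\rho<\infty$, then $\mathfrak F_t$ is locally integrable on $\mathbb R$ for each $t>0$. Moreover: - if $\tau>0$, then $F$ has weak initial velocity $1/\sqrt\tau$: there is a constant $c\ne0$ such that $\mathfrak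 F_t\to c\,\delta(\lambda-1/\sqrt\tau)$ in $\mathcal D'(\mathbb R)$ as $t\to0^+$, i.e. $\int_{\mathbb R}\mathfrak F_t(\lambda)\varphi(\lambda)\,d\lambda\to c\,\varphi(1/\sqrt\tau)$ for every $\varphi\in C_c^\infty(\mathbb R)$; - if $\rho<\infty$, then $F$ has weak equilibrium velocity $1/\sqrt\rho$: there is a constant $c\ne0$ such that $\mathfrak F_t\to c\,\delta(\lambda-1/\sqrt\rho)$ in $\mathcal D'(\mathbb R)$ as $t\to\infty$. -/

import Mathlib

open MeasureTheory Filter Topology Set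
open scoped ENNReal NNReal ContDiff

noncomputable section

/-- `Φ(s) = ∫ s^α dμ(α)` for a measure `μ` carried by `[0,1]`, with the principal branch
`s^α = exp (α (log |s| + i arg s))`, `arg s ∈ (-π, π]`. The boundary value at `arg s = -π` is the
complex conjugate of the one at `arg s = π`. -/
def symbolPhi (μ : Measure ℝ) (s : ℂ) : ℂ := ∫ α : ℝ, s ^ (α : ℂ) ∂μ

/-- The triangle `{(α, β) ∈ [0,1]² : α > β}`. -/
def triangleDelta : Set (ℝ × ℝ) := {p | p.1 ∈ Icc (0 : ℝ) 1 ∧ p.2 ∈ Icc (0 : ℝ) 1 ∧ p.2 < p.1}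

/-- The thermodynamical restriction (T): `με(α) × μσ(β) - μσ(α) × με(β)` is a non-negative measure
on the triangle `α > β`. -/
def ThermoRestriction (μσ με : Measure ℝ) : Prop :=
  (μσ.prod με).restrict triangleDelta ≤ (με.prod μσ).restrict triangleDelta

/-- Proper fractional model: the support of `μσ` or of `με` meets the open interval `(0,1)`. -/
def IsProperFractional (μσ με : Measure ℝ) : Prop :=
  (μσ.support ∩ Ioo 0 1).Nonempty ∨ (με.support ∩ Ioo 0 1).Nonempty

/-- Exceptional pairs: `μσ = a δ₀ + τ l`, `με = b δ₀ + l` with `τ, a > 0`, `b ≥ 0`, `a / b ≥ τ`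
(where `a / 0 = ∞`) and `l` a Radon measure on `[0,1]` with `l {0} = 0` and `max supp l = 1`. -/
def IsExceptional (μσ με : Measure ℝ) : Prop :=
  ∃ (τ a b : ℝ≥0) (l : Measure ℝ), 0 < τ ∧ 0 < a ∧ τ * b ≤ a ∧
    IsFiniteMeasure l ∧ l (Icc 0 1)ᶜ = 0 ∧ l {0} = 0 ∧ IsGreatest l.support 1 ∧
    μσ = a • Measure.dirac 0 + τ • l ∧ με = b • Measure.dirac 0 + l

/-- `Φ_σ(s) / Φ_ε(s)`. -/
def symbolRatio (μσ με : Measure ℝ) (s : ℂ) : ℂ := symbolPhi μσ s / symbolPhi με s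

/-- `Ψ(s) = √(Φ_σ(s) / Φ_ε(s))`, principal square root. -/
def symbolPsi (μσ με : Measure ℝ) (s : ℂ) : ℂ := symbolRatio μσ με s ^ (1 / 2 : ℂ)

/-- `S̃(x,s) = Ψ(s) / (2s) * exp (-|x| s Ψ(s))`. -/
def laplaceS (μσ με : Measure ℝ) (x : ℝ) (s : ℂ) : ℂ :=
  symbolPsi μσ με s / (2 * s) * Complex.exp (-((|x| : ℝ) : ℂ) * s * symbolPsi μσ με s)

/-- `f = 𝓛⁻¹ F` on `t > 0`: for every `t > 0` and every abscissa `a > 0`,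
`(2πi)⁻¹ ∫_{a-iY}^{a+iY} F(s) e^{st} ds → f t` as `Y → ∞` (with `s = a + iy`, `ds = i dy`). -/
def IsInverseLaplace (F : ℂ → ℂ) (f : ℝ → ℂ) : Prop :=
  ∀ t : ℝ, 0 < t → ∀ a : ℝ, 0 < a →
    Tendsto (fun Y : ℝ => (1 / (2 * (Real.pi : ℂ) * Complex.I)) *
        ∫ y in (-Y)..Y, F (a + y * Complex.I) *
          Complex.exp ((a + y * Complex.I) * (t : ℂ)) * Complex.I)
      atTop (𝓝 (f t))

/-- `S` is the fundamental solution of the distributed-order fractional wave equation: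
`S(x, ·) = 𝓛⁻¹ (S̃(x, ·))`, as a function off the null set `x = 0`. -/
def IsFundamentalSolution (μσ με : Measure ℝ) (S : ℝ → ℝ → ℂ) : Prop :=
  ∀ x : ℝ, x ≠ 0 → IsInverseLaplace (laplaceS μσ με x) (S x)

/-- `K = ∂ₜ S` on `x ≠ 0`, `t > 0` (the derivative exists there). -/
def IsTimeDerivative (S K : ℝ → ℝ → ℂ) : Prop :=
  ∀ x : ℝ, x ≠ 0 → ∀ t : ℝ, 0 < t → HasDerivAt (S x) (K x t) t

/-- `H(x) K(x,t)` with `H` the Heaviside function. -/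
def heavisideMul (K : ℝ → ℝ → ℂ) (x t : ℝ) : ℂ := if 0 < x then K x t else 0

/-- For every `t > 0` the function `𝔉ₜ(r) = t F(r t, t)` is locally integrable, hence a
distribution, and for some constant `c ≠ 0` one has `𝔉ₜ → c δ(· - v)` in `𝓓'` along `L`. -/
def HasWeakVelocityAlong (L : Filter ℝ) (F : ℝ → ℝ → ℂ) (v : ℝ) : Prop :=
  (∀ t : ℝ, 0 < t → LocallyIntegrable (fun r : ℝ => (t : ℂ) * F (r * t) t)) ∧
  ∃ c : ℂ, c ≠ 0 ∧ ∀ φ : ℝ → ℂ, ContDiff ℝ ∞ φ → HasCompactSupport φ →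
    Tendsto (fun t : ℝ => ∫ r : ℝ, ((t : ℂ) * F (r * t) t) * φ r) L (𝓝 (c * φ v))

/-- Weak initial velocity `v > 0`: the limit `t → 0⁺`. -/
def HasWeakInitialVelocity (F : ℝ → ℝ → ℂ) (v : ℝ) : Prop :=
  0 < v ∧ HasWeakVelocityAlong (𝓝[>] 0) F v

/-- Weak equilibrium velocity `v`: the limit `t → ∞`. -/
def HasWeakEquilibriumVelocity (F : ℝ → ℝ → ℂ) (v : ℝ) : Prop :=
  HasWeakVelocityAlong atTop F v

/-- Convergence of a complex function to an extended non-negative real: usual convergence if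
`r < ∞`, and `|f| → ∞` if `r = ∞`. -/
def TendstoExtended (f : ℂ → ℂ) (L : Filter ℂ) (r : ℝ≥0∞) : Prop :=
  (r ≠ ⊤ → Tendsto f L (𝓝 (r.toReal : ℂ))) ∧
  (r = ⊤ → Tendsto f L (Bornology.cobounded ℂ))

end

/-!
The ratio `R = Φσ / Φε` is monotone on the half-axis by the thermodynamical restriction, so it has
limits at `0` and `∞`. Seen from `|s|`, the measures `|s|^α dμ` concentrate at the extreme exponent
of `μ`, which turns `Φ(s) / Φ(|s|)` into a pure phase, uniformly in `arg s`. A finite non-zero limit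
forces equal extreme exponents of the two measures, the phases cancel, and `R(s)` has the limit of
`R(|s|)` (`Admissible.exists_limit_atTop`, `Admissible.exists_limit_zero`).

The imaginary part of `Φσ conj Φε` is an antisymmetric integral against `μσ × με`; it reduces to the
non-negative gap measure `με × μσ - μσ × με` on the triangle. Hence `Ψ` exchanges the upper and lower
half-planes, and `re (s Ψ(s))` is bounded below by the mass of the gap measure near the top exponent.
Unless the pair is proportional or exceptional this is a power of `|s|`
(`Admissible.exists_le_re_mul_symbolPsi`). So for `x > 0` the function `exp (-x s Ψ(s))` decays faster
than any power, all inverse Laplace integrals converge absolutely, and differentiation in `t` and `x`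
under the integral is legitimate.

Cauchy's formula for `Ψ` along parabolas that shrink to the cut, together with the sign of `im Ψ`,
shows that on the half-axis `Ψ` and the derivative of `s Ψ(s)` are completely monotone. Then so are
`exp (-x s Ψ)`, `Ψ exp (-x s Ψ)` and `exp (-x s Ψ) / s`, and by the Post–Widder formula their inverse
transforms, the density `p`, twice the flux `K = ∂ₜ S`, and the distribution function `g` of `p`, are
non-negative (`HDecay.invL_nonneg`).

With `x = λ t` and `s = j / t`, the Laplace transform of `p` is `exp (-λ j √(R(j / t)))`, which tends to
`q ^ j` with `q = exp (-λ √m)`, `m` the limit of `R`. Chernoff's and Chebyshev's inequalities give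
`g(λ t, t) → 1` for `λ √m < 1` and `→ 0` for `λ √m > 1`. Since `∂ₓ g = -2 K`, integration by parts turns
`∫ t K(λ t, t) φ(λ) dλ` into `(φ(0) + ∫ g(λ t, t) φ'(λ) dλ) / 2`, and dominated convergence gives the limit
`φ(1 / √m) / 2` (`Dissipative.tendsto_integral_waveFlux`).
-/

/-! ### Inverse Laplace transforms along vertical lines -/

/-- Holomorphic functions on the right half-plane with `F s = O(|s|⁻²)`, uniformly on every closed
half-plane `a ≤ re s` with `a > 0`. -/
structure HDecay (F : ℂ → ℂ) : Prop where
  diff : DifferentiableOn ℂ F {s | 0 < s.re}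
  bound : ∀ a : ℝ, 0 < a → ∃ C : ℝ, ∀ s : ℂ, a ≤ s.re → ‖F s‖ ≤ C / ‖s‖ ^ 2

lemma norm_sq_line (a y : ℝ) : ‖(a : ℂ) + y * Complex.I‖ ^ 2 = a ^ 2 + y ^ 2 := by
  rw [Complex.sq_norm, Complex.normSq_add_mul_I]

lemma integrable_inv_sq_add_sq {a : ℝ} (ha : 0 < a) :
    Integrable (fun y : ℝ => (a ^ 2 + y ^ 2)⁻¹) := by
  have h := (integrable_inv_one_add_sq.comp_mul_left' (inv_ne_zero ha.ne')).const_mul (a ^ 2)⁻¹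
  refine h.congr (Eventually.of_forall fun y => ?_)
  have : a ^ 2 + y ^ 2 ≠ 0 := by positivity
  simp only
  field_simp

lemma integral_inv_sq_add_sq_line {a : ℝ} (ha : 0 < a) :
    ∫ y : ℝ, (a ^ 2 + y ^ 2)⁻¹ = Real.pi / a := by
  have e : ∀ y : ℝ, (a ^ 2 + y ^ 2)⁻¹ = (a ^ 2)⁻¹ * (1 + (a⁻¹ * y) ^ 2)⁻¹ := fun y => by
    have : a ^ 2 + y ^ 2 ≠ 0 := by positivity
    field_simp
  simp_rw [e]
  rw [integral_const_mul, Measure.integral_comp_mul_left (fun y => (1 + y ^ 2)⁻¹),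
    integral_univ_inv_one_add_sq, inv_inv, abs_of_pos ha, smul_eq_mul]
  field_simp

lemma line_re_pos {a : ℝ} (ha : 0 < a) (y : ℝ) :
    (a : ℂ) + y * Complex.I ∈ {s : ℂ | 0 < s.re} := by simpa using ha

namespace HDecay

variable {F : ℂ → ℂ}

lemma nonneg_const (a : ℝ) (ha : 0 < a) {C : ℝ}
    (h : ∀ s : ℂ, a ≤ s.re → ‖F s‖ ≤ C / ‖s‖ ^ 2) : 0 ≤ C := by
  have h1 := (norm_nonneg _).trans (h a (by simp))
  by_contra hC
  have : C / ‖(a : ℂ)‖ ^ 2 < 0 := div_neg_of_neg_of_pos (not_le.1 hC) (by simp; positivity)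
  linarith

lemma continuous_line (hF : HDecay F) {a : ℝ} (ha : 0 < a) :
    Continuous fun y : ℝ => F (a + y * Complex.I) :=
  hF.diff.continuousOn.comp_continuous (by fun_prop) (line_re_pos ha)

lemma integrable_line (hF : HDecay F) {a : ℝ} (ha : 0 < a) :
    Integrable fun y : ℝ => F (a + y * Complex.I) := by
  obtain ⟨C, hC⟩ := hF.bound a ha
  refine ((integrable_inv_sq_add_sq ha).const_mul C).mono'
    (hF.continuous_line ha).aestronglyMeasurable (Eventually.of_forall fun y => ?_)
  have := hC (a + y * Complex.I) (by simp)
  rwa [norm_sq_line, div_eq_mul_inv] at this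

end HDecay

/-- Cauchy's theorem on an infinite vertical strip. -/
lemma integral_line_eq_of_decay {G : ℂ → ℂ} {a b C : ℝ} (ha : 0 < a) (hab : a ≤ b)
    (hd : DifferentiableOn ℂ G {s | 0 < s.re})
    (hC : ∀ s : ℂ, a ≤ s.re → s.re ≤ b → ‖G s‖ ≤ C / ‖s‖ ^ 2) :
    ∫ y : ℝ, G (a + y * Complex.I) = ∫ y : ℝ, G (b + y * Complex.I) := by
  have hb : 0 < b := ha.trans_le hab
  have hcont : ∀ c : ℝ, 0 < c → Continuous fun y : ℝ => G (c + y * Complex.I) := fun c hc =>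
    hd.continuousOn.comp_continuous (by fun_prop) (line_re_pos hc)
  have hint : ∀ c : ℝ, a ≤ c → c ≤ b → Integrable fun y : ℝ => G (c + y * Complex.I) := by
    intro c h1 h2
    have hc : 0 < c := ha.trans_le h1
    refine ((integrable_inv_sq_add_sq hc).const_mul C).mono'
      (hcont c hc).aestronglyMeasurable (Eventually.of_forall fun y => ?_)
    have := hC (c + y * Complex.I) (by simpa using h1) (by simpa using h2)
    rwa [norm_sq_line, div_eq_mul_inv] at this
  have hC0 : 0 ≤ C := by
    have h1 := (norm_nonneg _).trans (hC a (by simp) (by simpa using hab))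
    by_contra hC
    have : C / ‖(a : ℂ)‖ ^ 2 < 0 := div_neg_of_neg_of_pos (not_le.1 hC) (by simp; positivity)
    linarith
  have T : ∀ c : ℝ, a ≤ c → c ≤ b → Tendsto (fun Y : ℝ => ∫ y in (-Y)..Y, G (c + y * Complex.I))
      atTop (𝓝 (∫ y : ℝ, G (c + y * Complex.I))) := fun c h1 h2 =>
    intervalIntegral_tendsto_integral (hint c h1 h2) tendsto_neg_atTop_atBot tendsto_id
  have H : ∀ σ : ℝ, |σ| = 1 → Tendsto (fun Y : ℝ => ∫ x in a..b, G (x + (σ * Y : ℝ) * Complex.I))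
      atTop (𝓝 0) := by
    intro σ hσ
    have h0 : Tendsto (fun Y : ℝ => C * (Y ^ 2)⁻¹ * |b - a|) atTop (𝓝 0) := by
      have h1 : Tendsto (fun Y : ℝ => (Y ^ 2)⁻¹) atTop (𝓝 0) :=
        tendsto_inv_atTop_zero.comp (tendsto_pow_atTop two_ne_zero)
      simpa using (h1.const_mul C).mul_const |b - a|
    refine squeeze_zero_norm' ?_ h0
    filter_upwards [eventually_gt_atTop 0] with Y hY
    refine intervalIntegral.norm_integral_le_of_norm_le_const fun x hx => ?_
    rw [uIoc_of_le hab] at hx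
    refine (hC _ (by simpa using hx.1.le) (by simpa using hx.2)).trans ?_
    rw [norm_sq_line, div_eq_mul_inv]
    have h2 : (σ * Y) ^ 2 = Y ^ 2 := by rw [mul_pow, ← sq_abs σ, hσ]; ring
    rw [h2]
    gcongr
    nlinarith [sq_nonneg x]
  have key : ∀ Y : ℝ, (∫ y in (-Y)..Y, G (b + y * Complex.I)) -
      (∫ y in (-Y)..Y, G (a + y * Complex.I)) =
      Complex.I * ((∫ x in a..b, G (x + ((-1) * Y : ℝ) * Complex.I)) -
        ∫ x in a..b, G (x + (1 * Y : ℝ) * Complex.I)) := by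
    intro Y
    have h := Complex.integral_boundary_rect_eq_zero_of_differentiableOn G
      (⟨a, -Y⟩ : ℂ) (⟨b, Y⟩ : ℂ) (hd.mono ?_)
    · simp only [smul_eq_mul] at h
      rw [neg_one_mul, one_mul]
      linear_combination (-Complex.I) * h + ((∫ y in (-Y)..Y, G (b + y * Complex.I)) -
        (∫ y in (-Y)..Y, G (a + y * Complex.I))) * Complex.I_mul_I
    · intro s hs
      have := hs.1
      simp only [mem_preimage, uIcc_of_le hab, mem_Icc] at this
      exact ha.trans_le this.1
  have L := (T b hab le_rfl).sub (T a le_rfl hab)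
  have L2 := ((H (-1) (by simp)).sub (H 1 (by simp))).const_mul Complex.I
  simp_rw [key] at L
  have := tendsto_nhds_unique L L2
  simp only [sub_zero, mul_zero] at this
  exact (sub_eq_zero.1 this).symm

/-- The inverse Laplace transform, as an absolutely convergent integral along `re s = 1`. -/
noncomputable def invL (F : ℂ → ℂ) (t : ℝ) : ℂ :=
  (2 * (Real.pi : ℂ))⁻¹ * ∫ y : ℝ, F (1 + y * Complex.I) * Complex.exp ((1 + y * Complex.I) * t)

lemma norm_exp_line (a y t : ℝ) :
    ‖Complex.exp (((a : ℂ) + y * Complex.I) * t)‖ = Real.exp (a * t) := by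
  rw [Complex.norm_exp]; simp

namespace HDecay

variable {F : ℂ → ℂ}

lemma integrable_line_exp (hF : HDecay F) {a : ℝ} (ha : 0 < a) (t : ℝ) :
    Integrable fun y : ℝ => F (a + y * Complex.I) * Complex.exp ((a + y * Complex.I) * t) := by
  refine (hF.integrable_line ha).mul_bdd (c := Real.exp (a * t)) ?_
    (Eventually.of_forall fun y => (norm_exp_line a y t).le)
  exact Continuous.aestronglyMeasurable (by fun_prop)

lemma integral_line_eq (hF : HDecay F) {a b : ℝ} (ha : 0 < a) (hab : a ≤ b) (t : ℝ) :
    ∫ y : ℝ, F (a + y * Complex.I) * Complex.exp ((a + y * Complex.I) * t) =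
    ∫ y : ℝ, F (b + y * Complex.I) * Complex.exp ((b + y * Complex.I) * t) := by
  obtain ⟨C, hC⟩ := hF.bound a ha
  have hC0 := nonneg_const a ha hC
  refine integral_line_eq_of_decay (G := fun s => F s * Complex.exp (s * t))
    (C := C * Real.exp (b * |t|)) ha hab ?_ ?_
  · exact hF.diff.mul (by fun_prop)
  · intro s h1 h2
    rw [norm_mul, Complex.norm_exp, mul_div_right_comm]
    gcongr
    · exact hC s h1
    · simp only [Complex.mul_re, Complex.ofReal_re, Complex.ofReal_im, mul_zero, sub_zero]
      have h3 : 0 ≤ s.re := ha.le.trans h1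
      calc s.re * t ≤ s.re * |t| := by gcongr; exact le_abs_self t
        _ ≤ b * |t| := by gcongr

lemma invL_eq (hF : HDecay F) {a : ℝ} (ha : 0 < a) (t : ℝ) :
    invL F t = (2 * (Real.pi : ℂ))⁻¹ *
      ∫ y : ℝ, F (a + y * Complex.I) * Complex.exp ((a + y * Complex.I) * t) := by
  unfold invL
  congr 1
  rcases le_total a 1 with h | h
  · simpa using (hF.integral_line_eq ha h t).symm
  · simpa using hF.integral_line_eq one_pos h t

lemma norm_invL_le (hF : HDecay F) {a C : ℝ} (ha : 0 < a)
    (hC : ∀ s : ℂ, a ≤ s.re → ‖F s‖ ≤ C / ‖s‖ ^ 2) {b : ℝ} (hb : a ≤ b) (t : ℝ) :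
    ‖invL F t‖ ≤ C / (2 * b) * Real.exp (b * t) := by
  have hb0 : 0 < b := ha.trans_le hb
  rw [hF.invL_eq hb0, norm_mul]
  have h1 : ‖∫ y : ℝ, F (b + y * Complex.I) * Complex.exp ((b + y * Complex.I) * t)‖ ≤
      ∫ y : ℝ, C * Real.exp (b * t) * (b ^ 2 + y ^ 2)⁻¹ := by
    refine norm_integral_le_of_norm_le ((integrable_inv_sq_add_sq hb0).const_mul _)
      (Eventually.of_forall fun y => ?_)
    rw [norm_mul, norm_exp_line]
    have := hC (b + y * Complex.I) (by simpa using hb)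
    rw [norm_sq_line, div_eq_mul_inv] at this
    nlinarith [Real.exp_pos (b * t)]
  rw [integral_const_mul, integral_inv_sq_add_sq_line hb0] at h1
  have h2 : ‖(2 * (Real.pi : ℂ))⁻¹‖ = (2 * Real.pi)⁻¹ := by
    simp [abs_of_pos Real.pi_pos]
  rw [h2]
  calc _ ≤ (2 * Real.pi)⁻¹ * (C * Real.exp (b * t) * (Real.pi / b)) := by gcongr
    _ = _ := by field_simp

lemma invL_eq_zero (hF : HDecay F) {t : ℝ} (ht : t ≤ 0) : invL F t = 0 := by
  obtain ⟨C, hC⟩ := hF.bound 1 one_pos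
  have hC0 := nonneg_const 1 one_pos hC
  have h0 : Tendsto (fun b : ℝ => C / (2 * b)) atTop (𝓝 0) :=
    tendsto_const_nhds.div_atTop (tendsto_id.const_mul_atTop two_pos)
  have : ‖invL F t‖ ≤ 0 := by
    refine ge_of_tendsto h0 ?_
    filter_upwards [eventually_ge_atTop 1] with b hb
    refine (hF.norm_invL_le one_pos hC hb t).trans ?_
    have hb0 : 0 < b := by linarith
    refine mul_le_of_le_one_right (by positivity) (Real.exp_le_one_iff.2 ?_)
    exact mul_nonpos_of_nonneg_of_nonpos hb0.le ht
  exact norm_le_zero_iff.1 this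

lemma continuous_invL (hF : HDecay F) : Continuous (invL F) := by
  refine continuous_const.mul ?_
  rw [continuous_iff_continuousAt]
  intro t₀
  refine continuousAt_of_dominated (bound := fun y => ‖F ((1 : ℝ) + y * Complex.I)‖ *
    Real.exp (|t₀| + 1)) ?_ ?_ ?_ ?_
  · exact Eventually.of_forall fun t => by
      simpa using (hF.integrable_line_exp one_pos t).aestronglyMeasurable
  · filter_upwards [Metric.ball_mem_nhds t₀ one_pos] with t ht
    refine Eventually.of_forall fun y => ?_
    have := norm_exp_line 1 y t
    simp only [Complex.ofReal_one, one_mul] at this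
    rw [norm_mul, this]
    simp only [Complex.ofReal_one]
    gcongr
    rw [Metric.mem_ball, Real.dist_eq] at ht
    have h1 := abs_sub_abs_le_abs_sub t t₀
    have h2 := le_abs_self t
    linarith
  · exact (hF.integrable_line one_pos).norm.mul_const _
  · exact Eventually.of_forall fun y => by fun_prop

/-- If `s F(s)` decays as well, differentiation of the inverse transform is multiplication
by `s`. -/
lemma hasDerivAt_invL {F G : ℂ → ℂ} (hF : HDecay F) (hG : HDecay G)
    (h : ∀ s : ℂ, 0 < s.re → G s = s * F s) (t₀ : ℝ) :
    HasDerivAt (invL F) (invL G t₀) t₀ := by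
  refine HasDerivAt.const_mul _ ?_
  refine (hasDerivAt_integral_of_dominated_loc_of_deriv_le 
    (F := fun (t : ℝ) (y : ℝ) => F (1 + y * Complex.I) * Complex.exp ((1 + y * Complex.I) * t))
    (F' := fun (t : ℝ) (y : ℝ) => G (1 + y * Complex.I) * Complex.exp ((1 + y * Complex.I) * t))
    (bound := fun y : ℝ => ‖G ((1 : ℝ) + y * Complex.I)‖ * Real.exp (|t₀| + 1))
    (Metric.ball_mem_nhds t₀ one_pos) ?_ ?_ ?_ ?_ ?_ ?_).2
  · exact Eventually.of_forall fun t => by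
      simpa using (hF.integrable_line_exp one_pos t).aestronglyMeasurable
  · simpa using hF.integrable_line_exp one_pos t₀
  · simpa using (hG.integrable_line_exp one_pos t₀).aestronglyMeasurable
  · refine Eventually.of_forall fun y t ht => ?_
    have := norm_exp_line 1 y t
    simp only [Complex.ofReal_one, one_mul] at this
    rw [norm_mul, this]
    simp only [Complex.ofReal_one]
    gcongr
    rw [Metric.mem_ball, Real.dist_eq] at ht
    have h1 := abs_sub_abs_le_abs_sub t t₀
    have h2 := le_abs_self t
    linarith
  · exact (hG.integrable_line one_pos).norm.mul_const _
  · refine Eventually.of_forall fun y t _ => ?_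
    rw [h _ (by simp)]
    have h1 : HasDerivAt (fun t : ℝ => (1 + y * Complex.I) * (t : ℂ)) (1 + y * Complex.I) t := by
      simpa using (Complex.ofRealCLM.hasDerivAt (x := t)).const_mul (1 + y * Complex.I)
    have h2 := (h1.cexp).const_mul (F (1 + y * Complex.I))
    refine h2.congr_deriv ?_
    ring

lemma isInverseLaplace (hF : HDecay F) : IsInverseLaplace F (invL F) := by
  intro t _ a ha
  rw [hF.invL_eq ha]
  have h := intervalIntegral_tendsto_integral (hF.integrable_line_exp ha t)
    tendsto_neg_atTop_atBot tendsto_id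
  refine ((h.const_mul (2 * (Real.pi : ℂ))⁻¹)).congr fun Y => ?_
  rw [intervalIntegral.integral_mul_const]
  have hI : Complex.I ≠ 0 := Complex.I_ne_zero
  have hpi : (Real.pi : ℂ) ≠ 0 := by exact_mod_cast Real.pi_ne_zero
  simp only [id]
  generalize (∫ y in (-Y)..Y, F (a + y * Complex.I) * Complex.exp ((a + y * Complex.I) * t)) = J
  field_simp

end HDecay

/-! ### Laplace transform of the inverse transform and Cauchy's formula in a half-plane -/

namespace HDecay

variable {F : ℂ → ℂ}

lemma integrable_exp_mul_invL (hF : HDecay F) {a : ℝ} (ha : 0 < a) :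
    Integrable fun t : ℝ => Complex.exp (-((a * t : ℝ) : ℂ)) * invL F t := by
  obtain ⟨C, hC⟩ := hF.bound (a / 2) (by positivity)
  have h0 : IntegrableOn (fun t : ℝ => Complex.exp (-((a * t : ℝ) : ℂ)) * invL F t) (Ioi 0) := by
    refine (((integrableOn_exp_mul_Ioi (a := -(a / 2)) (by linarith) 0)).const_mul
      (C / (2 * (a / 2)))).mono' ?_ (Eventually.of_forall fun t => ?_)
    · exact ((by fun_prop : Continuous fun t : ℝ => Complex.exp (-((a * t : ℝ) : ℂ))).mul
        hF.continuous_invL).aestronglyMeasurable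
    · rw [norm_mul, ← Complex.ofReal_neg, Complex.norm_exp, Complex.ofReal_re]
      have h1 := hF.norm_invL_le (by positivity) hC le_rfl t
      calc _ ≤ Real.exp (-(a * t)) * (C / (2 * (a / 2)) * Real.exp (a / 2 * t)) := by gcongr
        _ = C / (2 * (a / 2)) * (Real.exp (-(a * t)) * Real.exp (a / 2 * t)) := by ring
        _ = _ := by rw [← Real.exp_add]; ring_nf
  refine (integrableOn_iff_integrable_of_support_subset ?_).1 h0
  intro t ht
  by_contra h
  exact ht (by simp [hF.invL_eq_zero (not_lt.1 h)])

/-- Fourier inversion along a vertical line: the inverse transform has Laplace transform `F`. -/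
lemma laplace_invL (hF : HDecay F) {z : ℂ} (hz : 0 < z.re) :
    ∫ t in Ioi (0 : ℝ), Complex.exp (-z * t) * invL F t = F z := by
  set a := z.re with ha
  set φ : ℝ → ℂ := fun v => F (a + (2 * Real.pi * v : ℝ) * Complex.I) with hφ
  have hpi : (0 : ℝ) < 2 * Real.pi := by positivity
  have hφc : Continuous φ := (hF.continuous_line hz).comp (continuous_const.mul continuous_id)
  have hφi : Integrable φ := (hF.integrable_line hz).comp_mul_left' hpi.ne'
  have hinv : ∀ t : ℝ, FourierTransformInv.fourierInv φ t =
      Complex.exp (-((a * t : ℝ) : ℂ)) * invL F t := by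
    intro t
    rw [Real.fourierInv_eq', hF.invL_eq hz]
    have h1 := Measure.integral_comp_mul_left (fun y : ℝ => F (a + y * Complex.I) *
      Complex.exp ((a + y * Complex.I) * t)) (2 * Real.pi)
    rw [abs_of_pos (inv_pos.2 hpi), Complex.real_smul] at h1
    have h2 : (((2 * Real.pi)⁻¹ : ℝ) : ℂ) = (2 * (Real.pi : ℂ))⁻¹ := by push_cast; rfl
    rw [← h2, ← h1, ← integral_const_mul]
    congr 1
    funext v
    simp only [smul_eq_mul, hφ]
    rw [mul_left_comm, ← Complex.exp_add, mul_comm]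
    congr 2
    simp
    ring
  have hi2 : Integrable (FourierTransformInv.fourierInv φ) := by
    rw [show FourierTransformInv.fourierInv φ = _ from funext hinv]
    exact hF.integrable_exp_mul_invL hz
  have hi3 : Integrable (FourierTransform.fourier φ) := by
    have : FourierTransform.fourier φ = fun t => FourierTransformInv.fourierInv φ (-t) := by
      funext t
      rw [Real.fourierInv_eq_fourier_neg, neg_neg]
    rw [this]
    exact hi2.comp_neg
  have key := congrFun (hφc.fourier_fourierInv_eq hφi hi3) (z.im / (2 * Real.pi))
  rw [Real.fourier_eq'] at key
  have hv : φ (z.im / (2 * Real.pi)) = F z := by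
    simp only [hφ]
    rw [mul_div_cancel₀ _ hpi.ne', ha, Complex.re_add_im]
  rw [hv] at key
  rw [← key, ← integral_indicator measurableSet_Ioi]
  congr 1
  funext t
  by_cases ht : 0 < t
  · rw [indicator_of_mem (mem_Ioi.2 ht), hinv, smul_eq_mul, ← mul_assoc, ← Complex.exp_add]
    congr 2
    have hpi' : (Real.pi : ℂ) ≠ 0 := by exact_mod_cast Real.pi_ne_zero
    have e : -2 * Real.pi * inner ℝ t (z.im / (2 * Real.pi)) = -(t * z.im) := by
      rw [RCLike.inner_apply, conj_trivial]
      field_simp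
    rw [e]
    conv_lhs => rw [← Complex.re_add_im z]
    push_cast
    ring
  · rw [indicator_of_notMem (by simpa using ht), hinv, hF.invL_eq_zero (not_lt.1 ht)]
    simp

lemma integral_line_div (hF : HDecay F) {a σ : ℝ} (ha : 0 < a) {z : ℂ} (hz : σ * a < z.re) :
    (2 * (Real.pi : ℂ))⁻¹ * ∫ y : ℝ, F (a + y * Complex.I) / (z - σ * (a + y * Complex.I)) =
      ∫ t in Ioi (0 : ℝ), Complex.exp (-z * t) * invL F (σ * t) := by
  have hint : Integrable (Function.uncurry fun (t y : ℝ) => Complex.exp (-z * t) *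
      (F (a + y * Complex.I) * Complex.exp ((a + y * Complex.I) * (σ * t : ℝ))))
      ((volume.restrict (Ioi 0)).prod volume) := by
    have h1 : Integrable (fun p : ℝ × ℝ => Complex.exp ((σ * a - z) * p.1) *
        F (a + p.2 * Complex.I)) ((volume.restrict (Ioi (0 : ℝ))).prod volume) :=
      Integrable.mul_prod (f := fun t : ℝ => Complex.exp ((σ * a - z) * t))
        (integrableOn_exp_mul_complex_Ioi (by simpa using hz) 0) (hF.integrable_line ha)
    have h2 := h1.mul_bdd (c := 1)
      (g := fun p : ℝ × ℝ => Complex.exp ((p.2 * (σ * p.1) : ℝ) * Complex.I))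
      (Continuous.aestronglyMeasurable (by fun_prop))
      (Eventually.of_forall fun p => (Complex.norm_exp_ofReal_mul_I _).le)
    refine h2.congr (Eventually.of_forall fun p => ?_)
    simp only [Function.uncurry]
    rw [mul_right_comm, ← Complex.exp_add, mul_left_comm (Complex.exp (-z * p.1)),
      ← Complex.exp_add, mul_comm]
    congr 2
    push_cast
    ring
  have h3 := integral_integral_swap hint
  have h4 : ∀ t : ℝ, Complex.exp (-z * t) * invL F (σ * t) = (2 * (Real.pi : ℂ))⁻¹ *
      ∫ y : ℝ, Complex.exp (-z * t) *
      (F (a + y * Complex.I) * Complex.exp ((a + y * Complex.I) * (σ * t : ℝ))) := by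
    intro t
    rw [hF.invL_eq ha, integral_const_mul]
    ring
  simp_rw [h4]
  rw [integral_const_mul, h3]
  congr 2
  funext y
  have h5 : ((σ : ℂ) * (a + y * Complex.I) - z).re < 0 := by simpa using hz
  have h6 : ∀ t : ℝ, Complex.exp (-z * t) *
      (F (a + y * Complex.I) * Complex.exp ((a + y * Complex.I) * (σ * t : ℝ))) =
      F (a + y * Complex.I) * Complex.exp (((σ : ℂ) * (a + y * Complex.I) - z) * t) := by
    intro t
    rw [mul_left_comm, ← Complex.exp_add]
    congr 2
    push_cast
    ring
  simp_rw [h6]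
  rw [integral_const_mul, integral_exp_mul_complex_Ioi h5]
  rw [← neg_sub z, Complex.ofReal_zero, mul_zero, Complex.exp_zero, neg_div_neg_eq, mul_one_div]

/-- Cauchy's integral formula in the half-plane `a < re z`. -/
lemma cauchy_halfplane (hF : HDecay F) {a : ℝ} (ha : 0 < a) {z : ℂ} (hz : a < z.re) :
    (2 * (Real.pi : ℂ))⁻¹ * ∫ y : ℝ, F (a + y * Complex.I) / (z - (a + y * Complex.I)) = F z := by
  have := hF.integral_line_div (σ := 1) ha (z := z) (by simpa using hz)
  simp only [Complex.ofReal_one, one_mul] at this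
  rw [this, hF.laplace_invL (ha.trans hz)]

lemma cauchy_halfplane_reflected (hF : HDecay F) {a : ℝ} (ha : 0 < a) {z : ℂ} (hz : -a < z.re) :
    (2 * (Real.pi : ℂ))⁻¹ * ∫ y : ℝ, F (a + y * Complex.I) / (z + (a + y * Complex.I)) = 0 := by
  have := hF.integral_line_div (σ := -1) ha (z := z) (by simpa using hz)
  simp only [Complex.ofReal_neg, Complex.ofReal_one, neg_mul, one_mul, sub_neg_eq_add] at this
  rw [this]
  refine setIntegral_eq_zero_of_forall_eq_zero fun t ht => ?_
  rw [hF.invL_eq_zero (by simpa using le_of_lt ht), mul_zero]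

end HDecay

/-! ### Complete monotonicity -/

/-- Complete monotonicity of order `n` on `(1, ∞)`: `g` and its first `n` derivatives have
alternating signs, starting with `0 ≤ g`. -/
def CMon : ℕ → (ℝ → ℝ) → Prop
  | 0, g => ∀ x, 1 < x → 0 ≤ g x
  | n + 1, g => (∀ x, 1 < x → 0 ≤ g x) ∧
      ∃ g' : ℝ → ℝ, (∀ x, 1 < x → HasDerivAt g (-g' x) x) ∧ CMon n g'

namespace CMon

lemma pred : ∀ {n : ℕ} {g : ℝ → ℝ}, CMon (n + 1) g → CMon n g
  | 0, _, h => h.1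
  | _ + 1, _, ⟨h1, g', h2, h3⟩ => ⟨h1, g', h2, pred h3⟩

lemma add : ∀ {n : ℕ} {g h : ℝ → ℝ}, CMon n g → CMon n h → CMon n (fun x => g x + h x)
  | 0, _, _, hg, hh => fun x hx => add_nonneg (hg x hx) (hh x hx)
  | _ + 1, _, _, ⟨h1, g', h2, h3⟩, ⟨k1, k', k2, k3⟩ =>
    ⟨fun x hx => add_nonneg (h1 x hx) (k1 x hx), fun x => g' x + k' x,
      fun x hx => ((h2 x hx).add (k2 x hx)).congr_deriv (by ring), h3.add k3⟩

lemma mul : ∀ {n : ℕ} {g h : ℝ → ℝ}, CMon n g → CMon n h → CMon n (fun x => g x * h x)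
  | 0, _, _, hg, hh => fun x hx => mul_nonneg (hg x hx) (hh x hx)
  | _ + 1, _, _, hg@⟨h1, g', h2, h3⟩, hh@⟨k1, k', k2, k3⟩ =>
    ⟨fun x hx => mul_nonneg (h1 x hx) (k1 x hx), fun x => g' x * _ + _ * k' x,
      fun x hx => ((h2 x hx).mul (k2 x hx)).congr_deriv (by ring),
      (h3.mul (pred hh)).add ((pred hg).mul k3)⟩

lemma const {c : ℝ} (hc : 0 ≤ c) : ∀ n : ℕ, CMon n (fun _ => c)
  | 0 => fun _ _ => hc
  | n + 1 => ⟨fun _ _ => hc, fun _ => 0, fun x _ => by simpa using hasDerivAt_const x c,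
      const le_rfl n⟩

/-- `exp (-f)` is completely monotone if `f'` is. -/
lemma exp_neg {f f' : ℝ → ℝ} (hf : ∀ x, 1 < x → HasDerivAt f (f' x) x)
    (h : ∀ n, CMon n f') : ∀ n : ℕ, CMon n (fun x => Real.exp (-f x))
  | 0 => fun _ _ => (Real.exp_pos _).le
  | n + 1 => ⟨fun _ _ => (Real.exp_pos _).le, fun x => Real.exp (-f x) * f' x,
      fun x hx => ((hf x hx).neg.exp).congr_deriv (by simp), (exp_neg hf h n).mul (h n)⟩

/-- A non-negative chain of functions, each a negative multiple of the derivative of the previous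
one, is completely monotone. -/
lemma of_seq {G : ℕ → ℝ → ℝ} {c : ℕ → ℝ} (hc : ∀ k, 0 ≤ c k)
    (hG : ∀ k x, 1 < x → 0 ≤ G k x)
    (hd : ∀ k x, 1 < x → HasDerivAt (G k) (-(c k * G (k + 1) x)) x) :
    ∀ (n k : ℕ), CMon n (G k)
  | 0, k => hG k
  | n + 1, k => ⟨hG k, _, hd k, (const (hc k) n).mul (of_seq hc hG hd n (k + 1))⟩

lemma seq_nonneg : ∀ {n : ℕ} {g : ℝ → ℝ} {G : ℕ → ℝ → ℝ} {c : ℕ → ℝ}, CMon n g →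
    (∀ k, 0 < c k) → (∀ k x, 1 < x → HasDerivAt (G k) (-(c k * G (k + 1) x)) x) →
    (∀ x, 1 < x → G 0 x = g x) → ∀ x, 1 < x → 0 ≤ G n x
  | 0, _, _, _, hg, _, _, e, x, hx => (e x hx).symm ▸ hg x hx
  | n + 1, g, G, c, ⟨_, g', h2, h3⟩, hc, hd, e, x, hx => by
    have e' : ∀ x, 1 < x → G 1 x = (c 0)⁻¹ * g' x := by
      intro x hx
      have h4 : HasDerivAt g (-(c 0 * G 1 x)) x := (hd 0 x hx).congr_of_eventuallyEq (by
        filter_upwards [Ioi_mem_nhds hx] with y hy using (e y hy).symm)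
      have h5 := h4.unique (h2 x hx)
      have := (hc 0).ne'
      field_simp
      linarith
    exact seq_nonneg (G := fun k => G (k + 1)) (c := fun k => c (k + 1))
      ((const (inv_nonneg.2 (hc 0).le) n).mul h3) (fun k => hc _) (fun k => hd _) e' x hx

end CMon

/-- Differentiation of a Cauchy-type integral in its pole parameter. -/
lemma hasDerivAt_cauchy_integral {φ s : ℝ → ℂ} {B : ℝ → ℝ} {x₀ δ d : ℝ} (n : ℕ) (hδ : 0 < δ)
    (hd : 0 < d) (hφ : Continuous φ) (hs : Continuous s) (hB : Integrable B)
    (hsd : ∀ x : ℝ, |x - x₀| < δ → ∀ y, d ≤ ‖(x : ℂ) - s y‖)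
    (hb : ∀ x : ℝ, |x - x₀| < δ → ∀ y, ‖φ y‖ / ‖(x : ℂ) - s y‖ ^ (n + 1) ≤ B y) :
    HasDerivAt (fun x : ℝ => ∫ y, φ y / ((x : ℂ) - s y) ^ (n + 1))
      (-((n + 1 : ℝ) * ∫ y, φ y / ((x₀ : ℂ) - s y) ^ (n + 2))) x₀ := by
  have hne : ∀ x : ℝ, |x - x₀| < δ → ∀ y, (x : ℂ) - s y ≠ 0 := fun x hx y h => by
    have := hsd x hx y
    rw [h, norm_zero] at this
    linarith
  have hcont : ∀ x : ℝ, |x - x₀| < δ → ∀ m : ℕ, Continuous fun y => φ y / ((x : ℂ) - s y) ^ m :=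
    fun x hx m => hφ.div ((continuous_const.sub hs).pow m) fun y => pow_ne_zero _ (hne x hx y)
  have h0 : |x₀ - x₀| < δ := by simpa using hδ
  have key := (hasDerivAt_integral_of_dominated_loc_of_deriv_le
    (F := fun (x : ℝ) (y : ℝ) => φ y / ((x : ℂ) - s y) ^ (n + 1))
    (F' := fun (x : ℝ) (y : ℝ) => -((n + 1 : ℝ) * (φ y / ((x : ℂ) - s y) ^ (n + 2))))
    (bound := fun y : ℝ => (n + 1) * (B y * d⁻¹)) (μ := volume)
    (Metric.ball_mem_nhds x₀ hδ) ?_ ?_ ?_ ?_ ?_ ?_).2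
  · rwa [integral_neg, integral_const_mul] at key
  · filter_upwards [Metric.ball_mem_nhds x₀ hδ] with x hx
    exact (hcont x hx _).aestronglyMeasurable
  · refine hB.mono' (hcont x₀ h0 _).aestronglyMeasurable (Eventually.of_forall fun y => ?_)
    simpa using hb x₀ h0 y
  · exact ((hcont x₀ h0 _).const_smul ((n + 1 : ℝ) : ℂ)).neg.aestronglyMeasurable
  · refine Eventually.of_forall fun y x hx => ?_
    have h1 := hb x hx y
    have h2 := hsd x hx y
    have hpos : 0 < ‖(x : ℂ) - s y‖ := hd.trans_le h2
    have e : ‖-((n + 1 : ℝ) * (φ y / ((x : ℂ) - s y) ^ (n + 2)))‖ =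
        (n + 1) * (‖φ y‖ / ‖(x : ℂ) - s y‖ ^ (n + 1) * ‖(x : ℂ) - s y‖⁻¹) := by
      rw [norm_neg, norm_mul, norm_div, norm_pow, Complex.norm_real, Real.norm_of_nonneg
        (by positivity)]
      field_simp
      ring
    rw [e]
    have h3 : 0 ≤ ‖φ y‖ / ‖(x : ℂ) - s y‖ ^ (n + 1) := by positivity
    gcongr
    exact h3.trans h1
  · exact (hB.mul_const _).const_mul _
  · refine Eventually.of_forall fun y x hx => ?_
    have h1 : HasDerivAt (fun x : ℝ => (x : ℂ) - s y) 1 x :=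
      (Complex.ofRealCLM.hasDerivAt (x := x)).sub_const _
    have h2 := ((h1.pow (n + 1)).fun_inv (pow_ne_zero _ (hne x hx y))).const_mul (φ y)
    simp only [← div_eq_mul_inv] at h2
    refine h2.congr_deriv ?_
    have := hne x hx y
    simp only [Pi.pow_apply]
    push_cast
    field_simp
    ring_nf

/-! ### Positivity of inverse Laplace transforms -/

namespace HDecay

variable {F : ℂ → ℂ}

/-- The Post–Widder quantity `(-1)ⁿ F⁽ⁿ⁾(x) / n!`, written as a Cauchy integral along
`re s = 1`. -/
noncomputable def post (F : ℂ → ℂ) (n : ℕ) (x : ℝ) : ℂ :=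
  (2 * (Real.pi : ℂ))⁻¹ * ∫ y : ℝ, F ((1 : ℝ) + y * Complex.I) /
    ((x : ℂ) - ((1 : ℝ) + y * Complex.I)) ^ (n + 1)

lemma hasDerivAt_post (hF : HDecay F) (n : ℕ) {x₀ : ℝ} (hx : 1 < x₀) :
    HasDerivAt (post F n) (-((n + 1 : ℝ) * post F (n + 1) x₀)) x₀ := by
  have hd : 0 < (x₀ - 1) / 2 := by linarith
  have hsd : ∀ x : ℝ, |x - x₀| < (x₀ - 1) / 2 → ∀ y : ℝ,
      (x₀ - 1) / 2 ≤ ‖(x : ℂ) - ((1 : ℝ) + y * Complex.I)‖ := by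
    intro x hx y
    refine le_trans ?_ (Complex.abs_re_le_norm _)
    have := abs_lt.1 hx
    refine le_trans ?_ (le_abs_self _)
    simp
    linarith
  have h := (hasDerivAt_cauchy_integral (φ := fun y : ℝ => F ((1 : ℝ) + y * Complex.I))
    (s := fun y : ℝ => (1 : ℝ) + y * Complex.I)
    (B := fun y : ℝ => ‖F ((1 : ℝ) + y * Complex.I)‖ / ((x₀ - 1) / 2) ^ (n + 1)) n hd hd
    (hF.continuous_line one_pos) (by fun_prop) ((hF.integrable_line one_pos).norm.div_const _)
    hsd ?_).const_mul (2 * (Real.pi : ℂ))⁻¹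
  · refine h.congr_deriv ?_
    unfold post
    ring
  · intro x hx y
    have := hsd x hx y
    gcongr

/-- The Post–Widder inversion formula. It holds by dominated convergence in the Cauchy integral,
since `(1 - st/n)⁻ⁿ → exp (st)`. -/
lemma tendsto_post (hF : HDecay F) {t : ℝ} (ht : 0 < t) :
    Tendsto (fun n : ℕ => ((((n + 1 : ℕ) : ℝ) / t) ^ (n + 1) : ℝ) *
      post F n (((n + 1 : ℕ) : ℝ) / t)) atTop (𝓝 (invL F t)) := by
  have hcs : ∀ z : ℂ, Tendsto (fun n : ℕ => (1 + z / ((n + 1 : ℕ) : ℂ)) ^ (n + 1)) atTop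
      (𝓝 (Complex.exp z)) := fun z =>
    (Complex.tendsto_one_add_div_pow_exp z).comp (tendsto_add_atTop_nat 1)
  have hrs : Tendsto (fun n : ℕ => (1 + (-t) / ((n + 1 : ℕ) : ℝ)) ^ (n + 1)) atTop
      (𝓝 (Real.exp (-t))) :=
    (Real.tendsto_one_add_div_pow_exp (-t)).comp (tendsto_add_atTop_nat 1)
  have key : Tendsto (fun n : ℕ => ∫ y : ℝ, F ((1 : ℝ) + y * Complex.I) /
      (1 + (-(((1 : ℝ) + y * Complex.I) * t)) / ((n + 1 : ℕ) : ℂ)) ^ (n + 1)) atTop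
      (𝓝 (∫ y : ℝ, F ((1 : ℝ) + y * Complex.I) *
        Complex.exp (((1 : ℝ) + y * Complex.I) * t))) := by
    refine tendsto_integral_filter_of_dominated_convergence
      (fun y : ℝ => ‖F ((1 : ℝ) + y * Complex.I)‖ * (Real.exp (-t) / 2)⁻¹) ?_ ?_ ?_ ?_
    · refine Eventually.of_forall fun n => ?_
      refine AEStronglyMeasurable.div₀ ?_ ?_ 
      · exact (hF.integrable_line one_pos).aestronglyMeasurable
      · exact Continuous.aestronglyMeasurable (by fun_prop)
    · have h1 := hrs.eventually (lt_mem_nhds (show Real.exp (-t) / 2 < Real.exp (-t) by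
        linarith [Real.exp_pos (-t)]))
      filter_upwards [h1, (tendsto_natCast_atTop_atTop (R := ℝ)).eventually_ge_atTop t]
        with n hn hnt
      refine Eventually.of_forall fun y => ?_
      rw [norm_div, div_eq_mul_inv, norm_pow]
      have hn0 : (0 : ℝ) < ((n + 1 : ℕ) : ℝ) := by positivity
      have h2 : 1 + (-t) / ((n + 1 : ℕ) : ℝ) ≤
          ‖1 + (-(((1 : ℝ) + y * Complex.I) * t)) / ((n + 1 : ℕ) : ℂ)‖ := by
        refine le_trans (le_of_eq ?_) (Complex.re_le_norm _)
        rw [Complex.add_re, Complex.div_natCast_re]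
        simp
      have h3 : 0 ≤ 1 + (-t) / ((n + 1 : ℕ) : ℝ) := by
        rw [neg_div, ← sub_eq_add_neg, sub_nonneg, div_le_one hn0]
        push_cast
        linarith
      have h4 := pow_le_pow_left₀ h3 h2 (n + 1)
      have h5 : 0 < Real.exp (-t) / 2 := by positivity
      gcongr
      exact hn.le.trans h4
    · exact (hF.integrable_line one_pos).norm.mul_const _
    · refine Eventually.of_forall fun y => ?_
      have h1 := (hcs (-(((1 : ℝ) + y * Complex.I) * t))).inv₀ (Complex.exp_ne_zero _)
      rw [← Complex.exp_neg, neg_neg] at h1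
      simpa only [div_eq_mul_inv] using h1.const_mul (F ((1 : ℝ) + y * Complex.I))
  have h6 := key.const_mul (2 * (Real.pi : ℂ))⁻¹
  rw [← hF.invL_eq one_pos] at h6
  refine h6.congr fun n => ?_
  rw [post, mul_left_comm]
  congr 1
  rw [← integral_const_mul]
  congr 1
  funext y
  have hn0 : ((n + 1 : ℕ) : ℂ) ≠ 0 := by exact_mod_cast Nat.succ_ne_zero n
  have ht0 : (t : ℂ) ≠ 0 := by exact_mod_cast ht.ne'
  have e : ((((n + 1 : ℕ) : ℝ) / t : ℝ) : ℂ) - ((1 : ℝ) + y * Complex.I) =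
      ((((n + 1 : ℕ) : ℝ) / t : ℝ) : ℂ) *
      (1 + (-(((1 : ℝ) + y * Complex.I) * t)) / ((n + 1 : ℕ) : ℂ)) := by
    simp only [Complex.ofReal_div, Complex.ofReal_natCast]
    field_simp
    ring
  rw [e, mul_pow, Complex.ofReal_pow]
  have h7 : ((((n + 1 : ℕ) : ℝ) / t : ℝ) : ℂ) ^ (n + 1) ≠ 0 := by
    refine pow_ne_zero _ ?_
    simp only [Complex.ofReal_div, Complex.ofReal_natCast]
    exact div_ne_zero hn0 ht0
  rw [← mul_div_assoc, mul_div_mul_left _ _ h7]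

/-- If a real-linear functional of `F` is completely monotone on `(1, ∞)`, the same functional of
the Post–Widder quantities is non-negative. -/
lemma post_nonneg (hF : HDecay F) {L : ℂ →L[ℝ] ℝ} {g : ℝ → ℝ} (hg : ∀ n, CMon n g)
    (hFg : ∀ x : ℝ, 1 < x → L (F x) = g x) (n : ℕ) {x : ℝ} (hx : 1 < x) :
    0 ≤ L (post F n x) := by
  refine CMon.seq_nonneg (G := fun n x => L (post F n x)) (c := fun k => (k + 1 : ℝ)) (hg n)
    (fun k => by positivity) (fun k x hx => ?_) (fun x hx => ?_) x hx
  · have := L.hasFDerivAt.comp_hasDerivAt x (hF.hasDerivAt_post k hx)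
    refine this.congr_deriv ?_
    rw [map_neg, ← Complex.real_smul, map_smul, smul_eq_mul]
  · rw [← hFg x hx, ← hF.cauchy_halfplane one_pos (z := x) (by simpa using hx)]
    simp [post]

lemma invL_functional_nonneg (hF : HDecay F) {L : ℂ →L[ℝ] ℝ} {g : ℝ → ℝ} (hg : ∀ n, CMon n g)
    (hFg : ∀ x : ℝ, 1 < x → L (F x) = g x) {t : ℝ} (ht : 0 < t) : 0 ≤ L (invL F t) := by
  refine ge_of_tendsto ((L.continuous.tendsto _).comp (hF.tendsto_post ht)) ?_
  filter_upwards [(tendsto_natCast_atTop_atTop (R := ℝ)).eventually_ge_atTop t] with n hn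
  simp only [Function.comp]
  rw [← Complex.real_smul, map_smul, smul_eq_mul]
  refine mul_nonneg (by positivity) (hF.post_nonneg hg hFg n ?_)
  rw [lt_div_iff₀ ht]
  push_cast
  linarith

/-- The inverse Laplace transform of a function that is real and completely monotone on `(1, ∞)`
is real and non-negative. -/
lemma invL_nonneg (hF : HDecay F) {g : ℝ → ℝ} (hg : ∀ n, CMon n g)
    (hFg : ∀ x : ℝ, 1 < x → F x = g x) (t : ℝ) : ∃ r : ℝ, 0 ≤ r ∧ invL F t = r := by
  rcases le_or_gt t 0 with ht | ht
  · exact ⟨0, le_rfl, by simp [hF.invL_eq_zero ht]⟩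
  have h1 := hF.invL_functional_nonneg (L := Complex.reCLM) hg
    (fun x hx => by simp [hFg x hx]) ht
  have h2 := hF.invL_functional_nonneg (L := Complex.imCLM) (CMon.const le_rfl)
    (fun x hx => by simp [hFg x hx]) ht
  have h3 := hF.invL_functional_nonneg (L := -Complex.imCLM) (CMon.const le_rfl)
    (fun x hx => by simp [hFg x hx]) ht
  refine ⟨_, h1, Complex.ext (by simp) ?_⟩
  simp at h2 h3 ⊢
  linarith

end HDecay

/-! ### The symbols `Φ` -/

/-- `Φ(r) = ∫ r^α dμ(α)` for real `r > 0`. -/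
noncomputable def phiR (μ : Measure ℝ) (r : ℝ) : ℝ := ∫ α : ℝ, r ^ α ∂μ

lemma cpow_polar {s : ℂ} (hs : s ≠ 0) (α : ℝ) :
    s ^ (α : ℂ) = ((‖s‖ ^ α : ℝ) : ℂ) * Complex.exp ((α * s.arg : ℝ) * Complex.I) := by
  rw [Complex.cpow_def_of_ne_zero hs, Complex.log, Real.rpow_def_of_pos (norm_pos_iff.2 hs),
    Complex.ofReal_exp, ← Complex.exp_add]
  congr 1
  push_cast
  ring

lemma continuous_rpow_exponent {r : ℝ} (hr : 0 < r) : Continuous fun α : ℝ => r ^ α :=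
  continuous_const.rpow continuous_id fun _ => Or.inl hr.ne'

lemma continuous_cpow_exponent {s : ℂ} (hs : s ≠ 0) : Continuous fun α : ℝ => s ^ (α : ℂ) := by
  simp_rw [cpow_polar hs]
  have := continuous_rpow_exponent (norm_pos_iff.2 hs)
  fun_prop

lemma ae_mem_unit {μ : Measure ℝ} (hμ : μ (Icc 0 1)ᶜ = 0) : ∀ᵐ α ∂μ, α ∈ Icc (0 : ℝ) 1 := hμ

lemma symbolPhi_ofReal {μ : Measure ℝ} {r : ℝ} (hr : 0 < r) : symbolPhi μ r = phiR μ r := by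
  unfold symbolPhi phiR
  rw [← integral_complex_ofReal]
  congr 1
  funext α
  rw [Complex.ofReal_cpow hr.le]

lemma norm_symbolPhi_le {μ : Measure ℝ} (s : ℂ) : ‖symbolPhi μ s‖ ≤ phiR μ ‖s‖ := by
  refine (norm_integral_le_integral_norm _).trans (le_of_eq ?_)
  unfold phiR
  congr 1
  funext α
  exact Complex.norm_cpow_real _ _

lemma symbolPhi_conj {μ : Measure ℝ} {s : ℂ} (hs : s ∈ Complex.slitPlane) :
    symbolPhi μ (starRingEnd ℂ s) = starRingEnd ℂ (symbolPhi μ s) := by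
  unfold symbolPhi
  rw [← integral_conj]
  congr 1
  funext α
  rw [Complex.conj_cpow _ _ (Complex.slitPlane_arg_ne_pi hs), Complex.conj_ofReal]

section single

variable {μ : Measure ℝ} [IsFiniteMeasure μ]

lemma integrable_of_continuous (hμ : μ (Icc 0 1)ᶜ = 0) {E : Type*} [NormedAddCommGroup E]
    {f : ℝ → E} (hf : Continuous f) : Integrable f μ := by
  have : μ.restrict (Icc 0 1) = μ := Measure.restrict_eq_self_of_ae_mem (ae_mem_unit hμ)
  rw [← this]
  exact hf.continuousOn.integrableOn_compact isCompact_Icc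

lemma phiR_pos (hμ : μ (Icc 0 1)ᶜ = 0) (h0 : μ ≠ 0) {r : ℝ} (hr : 0 < r) : 0 < phiR μ r := by
  have : NeZero μ := ⟨h0⟩
  have hs : (Function.support fun α : ℝ => r ^ α) = univ :=
    eq_univ_of_forall fun α => (Real.rpow_pos_of_pos hr α).ne'
  refine (integral_pos_iff_support_of_nonneg (fun α => (Real.rpow_pos_of_pos hr α).le)
    (integrable_of_continuous hμ (continuous_rpow_exponent hr))).2 ?_
  rw [hs]
  exact (NeZero.pos (μ univ))

lemma phiR_mono (hμ : μ (Icc 0 1)ᶜ = 0) {r₁ r₂ : ℝ} (h1 : 0 < r₁) (h2 : r₁ ≤ r₂) :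
    phiR μ r₁ ≤ phiR μ r₂ := by
  refine integral_mono_ae (integrable_of_continuous hμ (continuous_rpow_exponent h1))
    (integrable_of_continuous hμ (continuous_rpow_exponent (h1.trans_le h2))) ?_
  filter_upwards [ae_mem_unit hμ] with α hα
  exact Real.rpow_le_rpow h1.le h2 hα.1

lemma phiR_le_mul (hμ : μ (Icc 0 1)ᶜ = 0) {r₁ r₂ : ℝ} (h1 : 0 < r₁) (h2 : r₁ ≤ r₂) :
    phiR μ r₂ ≤ r₂ / r₁ * phiR μ r₁ := by
  have h3 : 0 < r₂ := h1.trans_le h2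
  unfold phiR
  rw [← integral_const_mul]
  refine integral_mono_ae (integrable_of_continuous hμ (continuous_rpow_exponent h3))
    ((integrable_of_continuous hμ (continuous_rpow_exponent h1)).const_mul _) ?_
  filter_upwards [ae_mem_unit hμ] with α hα
  have h4 : (r₂ / r₁) ^ α ≤ r₂ / r₁ := by
    have : 1 ≤ r₂ / r₁ := (one_le_div h1).2 h2
    simpa using Real.rpow_le_rpow_of_exponent_le this hα.2
  rw [Real.div_rpow h3.le h1.le, div_le_iff₀ (Real.rpow_pos_of_pos h1 _)] at h4
  exact h4

/-- After rotation by half of `arg s`, the symbol lies in the right half-plane. -/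
lemma cos_mul_phiR_le_re (hμ : μ (Icc 0 1)ᶜ = 0) {s : ℂ} (hs : s ≠ 0) :
    Real.cos (s.arg / 2) * phiR μ ‖s‖ ≤ (Complex.exp (-(s.arg / 2 : ℝ) * Complex.I) * symbolPhi μ s).re := by
  have hi := integrable_of_continuous hμ (continuous_cpow_exponent hs)
  have e : (Complex.exp (-(s.arg / 2 : ℝ) * Complex.I) * symbolPhi μ s).re =
      ∫ α : ℝ, (Complex.exp (-(s.arg / 2 : ℝ) * Complex.I) * s ^ (α : ℂ)).re ∂μ := by
    unfold symbolPhi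
    rw [← integral_const_mul]
    exact (integral_re (hi.const_mul _)).symm
  rw [e]
  unfold phiR
  rw [← integral_const_mul]
  refine integral_mono_ae ((integrable_of_continuous hμ (continuous_rpow_exponent
    (norm_pos_iff.2 hs))).const_mul _) (hi.const_mul _).re ?_
  filter_upwards [ae_mem_unit hμ] with α hα
  have h1 : Complex.exp (-(s.arg / 2 : ℝ) * Complex.I) * s ^ (α : ℂ) =
      ((‖s‖ ^ α : ℝ) : ℂ) * Complex.exp (((α - 1 / 2) * s.arg : ℝ) * Complex.I) := by
    rw [cpow_polar hs, mul_left_comm, ← Complex.exp_add]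
    congr 2
    push_cast
    ring
  change _ ≤ (Complex.exp (-(s.arg / 2 : ℝ) * Complex.I) * s ^ (α : ℂ)).re
  rw [h1, Complex.re_ofReal_mul, Complex.exp_ofReal_mul_I_re, mul_comm]
  gcongr
  rw [← Real.cos_abs (s.arg / 2), ← Real.cos_abs ((α - 1 / 2) * s.arg)]
  refine Real.cos_le_cos_of_nonneg_of_le_pi (abs_nonneg _) ?_ ?_
  · rw [abs_div, abs_two]
    linarith [Complex.abs_arg_le_pi s, Real.pi_pos]
  · rw [abs_mul, abs_div, abs_two]
    have : |α - 1 / 2| ≤ 1 / 2 := abs_le.2 ⟨by linarith [hα.1], by linarith [hα.2]⟩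
    nlinarith [abs_nonneg s.arg]

lemma cos_mul_phiR_le_norm (hμ : μ (Icc 0 1)ᶜ = 0) {s : ℂ} (hs : s ≠ 0) :
    Real.cos (s.arg / 2) * phiR μ ‖s‖ ≤ ‖symbolPhi μ s‖ := by
  refine (cos_mul_phiR_le_re hμ hs).trans ((Complex.re_le_norm _).trans (le_of_eq ?_))
  rw [norm_mul, ← Complex.ofReal_neg, Complex.norm_exp_ofReal_mul_I, one_mul]

lemma differentiableAt_symbolPhi (hμ : μ (Icc 0 1)ᶜ = 0) {s₀ : ℂ} (hs : s₀ ∈ Complex.slitPlane) :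
    DifferentiableAt ℂ (symbolPhi μ) s₀ := by
  have hs0 : s₀ ≠ 0 := Complex.slitPlane_ne_zero hs
  have hn : 0 < ‖s₀‖ := norm_pos_iff.2 hs0
  have hnhds : Complex.slitPlane ∩ Metric.ball s₀ (‖s₀‖ / 2) ∈ 𝓝 s₀ :=
    inter_mem (Complex.isOpen_slitPlane.mem_nhds hs) (Metric.ball_mem_nhds _ (by positivity))
  refine ((hasDerivAt_integral_of_dominated_loc_of_deriv_le
    (F := fun (s : ℂ) (α : ℝ) => s ^ (α : ℂ))
    (F' := fun (s : ℂ) (α : ℝ) => (α : ℂ) * s ^ ((α : ℂ) - 1))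
    (bound := fun _ : ℝ => (‖s₀‖ / 2)⁻¹ * max 1 (2 * ‖s₀‖)) (μ := μ)
    hnhds ?_ ?_ ?_ ?_ ?_ ?_).2).differentiableAt
  · filter_upwards [hnhds] with s h
    exact (continuous_cpow_exponent (Complex.slitPlane_ne_zero h.1)).aestronglyMeasurable
  · exact integrable_of_continuous hμ (continuous_cpow_exponent hs0)
  · have : Continuous fun α : ℝ => (α : ℂ) * (s₀ ^ (α : ℂ) / s₀) :=
      Complex.continuous_ofReal.mul ((continuous_cpow_exponent hs0).div_const _)
    refine (this.congr fun α => ?_).aestronglyMeasurable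
    rw [Complex.cpow_sub _ _ hs0, Complex.cpow_one]
  · filter_upwards [ae_mem_unit hμ] with α hα s h
    have h1 : s ≠ 0 := Complex.slitPlane_ne_zero h.1
    have h2 : ‖s - s₀‖ < ‖s₀‖ / 2 := by simpa [dist_eq_norm] using h.2
    have h3 : ‖s₀‖ / 2 ≤ ‖s‖ := by
      have := norm_sub_norm_le s₀ s
      rw [norm_sub_rev] at this
      linarith
    have h4 : ‖s‖ ≤ 2 * ‖s₀‖ := by
      have := norm_sub_norm_le s s₀
      linarith
    rw [norm_mul, Complex.norm_real, Real.norm_of_nonneg hα.1, Complex.cpow_sub _ _ h1,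
      Complex.cpow_one, norm_div, Complex.norm_cpow_real]
    have h5 : ‖s‖ ^ α ≤ max 1 (2 * ‖s₀‖) := by
      rcases le_total ‖s‖ 1 with h6 | h6
      · exact (Real.rpow_le_one (norm_nonneg _) h6 hα.1).trans (le_max_left _ _)
      · refine (Real.rpow_le_rpow_of_exponent_le h6 hα.2).trans ?_
        rw [Real.rpow_one]
        exact h4.trans (le_max_right _ _)
    have h7 : (0 : ℝ) < ‖s₀‖ / 2 := by positivity
    have h8 : ‖s‖⁻¹ ≤ (‖s₀‖ / 2)⁻¹ := inv_anti₀ h7 h3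
    calc α * (‖s‖ ^ α / ‖s‖) ≤ 1 * (‖s‖ ^ α / ‖s‖) := by gcongr; exact hα.2
      _ = ‖s‖⁻¹ * ‖s‖ ^ α := by rw [one_mul, div_eq_inv_mul]
      _ ≤ _ := by gcongr
  · exact integrable_const _
  · refine Eventually.of_forall fun α s h => ?_
    have := (hasDerivAt_id s).cpow_const (c := (α : ℂ)) h.1
    simpa using this

end single

/-! ### The thermodynamical restriction -/

lemma measurableSet_triangleDelta : MeasurableSet triangleDelta := by
  have : triangleDelta = (Icc 0 1 ×ˢ Icc 0 1) ∩ {p : ℝ × ℝ | p.2 < p.1} := by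
    ext p; exact ⟨fun h => ⟨⟨h.1, h.2.1⟩, h.2.2⟩, fun h => ⟨h.1.1, h.1.2, h.2⟩⟩
  rw [this]
  exact (measurableSet_Icc.prod measurableSet_Icc).inter
    (measurableSet_lt measurable_snd measurable_fst)

/-- The non-negative measure `με(α) × μσ(β) - μσ(α) × με(β)` on the triangle `α > β`. -/
noncomputable def thermoGap (μσ με : Measure ℝ) : Measure (ℝ × ℝ) :=
  (με.prod μσ).restrict triangleDelta - (μσ.prod με).restrict triangleDelta

section prod

variable {μ ν : Measure ℝ} [IsFiniteMeasure μ] [IsFiniteMeasure ν]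

lemma prod_ae_mem_unit {μ ν : Measure ℝ} [SFinite ν] (hμ : μ (Icc 0 1)ᶜ = 0)
    (hν : ν (Icc 0 1)ᶜ = 0) :
    ∀ᵐ p ∂(μ.prod ν), p ∈ Icc (0 : ℝ) 1 ×ˢ Icc (0 : ℝ) 1 := by
  have h1 := Measure.quasiMeasurePreserving_fst (μ := μ) (ν := ν) |>.ae (ae_mem_unit hμ)
  have h2 := Measure.quasiMeasurePreserving_snd (μ := μ) (ν := ν) |>.ae (ae_mem_unit hν)
  filter_upwards [h1, h2] with p hp1 hp2 using ⟨hp1, hp2⟩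

lemma integrable_prod_of_continuous (hμ : μ (Icc 0 1)ᶜ = 0) (hν : ν (Icc 0 1)ᶜ = 0)
    {E : Type*} [NormedAddCommGroup E] {f : ℝ × ℝ → E} (hf : Continuous f) :
    Integrable f (μ.prod ν) := by
  have := Measure.restrict_eq_self_of_ae_mem (prod_ae_mem_unit hμ hν)
  rw [← this]
  exact hf.continuousOn.integrableOn_compact (isCompact_Icc.prod isCompact_Icc)

lemma restrict_lt_eq_triangle {μ ν : Measure ℝ} [SFinite ν] (hμ : μ (Icc 0 1)ᶜ = 0)
    (hν : ν (Icc 0 1)ᶜ = 0) :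
    (μ.prod ν).restrict {p : ℝ × ℝ | p.2 < p.1} = (μ.prod ν).restrict triangleDelta := by
  refine Measure.restrict_congr_set ?_
  filter_upwards [prod_ae_mem_unit hμ hν] with p hp
  refine propext ⟨fun h => ⟨hp.1, hp.2, h⟩, fun h => h.2.2⟩

end prod

section gap

variable {μσ με : Measure ℝ} [IsFiniteMeasure μσ] [IsFiniteMeasure με]

lemma thermoGap_add (hT : ThermoRestriction μσ με) :
    thermoGap μσ με + (μσ.prod με).restrict triangleDelta =
      (με.prod μσ).restrict triangleDelta :=
  Measure.sub_add_cancel_of_le hT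

lemma thermoGap_ae_mem {μσ με : Measure ℝ} : ∀ᵐ p ∂(thermoGap μσ με), p ∈ triangleDelta :=
  Measure.absolutelyContinuous_of_le (Measure.sub_le (μ := (με.prod μσ).restrict triangleDelta)
    (ν := (μσ.prod με).restrict triangleDelta)) (ae_restrict_mem measurableSet_triangleDelta)

lemma integrable_thermoGap (hσ : μσ (Icc 0 1)ᶜ = 0) (hε : με (Icc 0 1)ᶜ = 0)
    {E : Type*} [NormedAddCommGroup E] {f : ℝ × ℝ → E} (hf : Continuous f) :
    Integrable f (thermoGap μσ με) :=
  ((integrable_prod_of_continuous hε hσ hf).restrict).mono_measure Measure.sub_le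

/-- An antisymmetric integrand sees the product measure only through the gap measure. -/
lemma integral_antisymm_of_integrable (hσ : μσ (Icc 0 1)ᶜ = 0) (hε : με (Icc 0 1)ᶜ = 0)
    (hT : ThermoRestriction μσ με) {g : ℝ × ℝ → ℝ} (hg : StronglyMeasurable g)
    (hi : Integrable g (μσ.prod με)) (hi' : Integrable g (με.prod μσ))
    (ha : ∀ p, g p.swap = -g p) :
    ∫ p, g p ∂(μσ.prod με) = -∫ p, g p ∂(thermoGap μσ με) := by
  have hig : Integrable g (thermoGap μσ με) := hi'.restrict.mono_measure Measure.sub_le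
  have hm : MeasurableSet {p : ℝ × ℝ | p.2 < p.1} := measurableSet_lt measurable_snd measurable_fst
  have h1 := integral_add_compl hm hi
  have h2 : ∫ p in {p : ℝ × ℝ | p.2 < p.1}ᶜ, g p ∂(μσ.prod με) =
      -∫ p in {p : ℝ × ℝ | p.2 < p.1}, g p ∂(με.prod μσ) := by
    rw [← Measure.prod_swap (μ := με) (ν := μσ),
      setIntegral_map hm.compl hg.aestronglyMeasurable measurable_swap.aemeasurable]
    simp_rw [ha]
    rw [integral_neg, ← integral_indicator hm,
      ← integral_indicator (measurable_swap hm.compl)]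
    congr 2
    funext p
    by_cases hp : p.2 < p.1
    · rw [indicator_of_mem, indicator_of_mem] <;> simp [hp, hp.le]
    · rw [indicator_of_notMem (s := {p : ℝ × ℝ | p.2 < p.1}) (by simpa using hp)]
      by_cases hq : p.1 < p.2
      · rw [indicator_of_notMem]
        simpa using hq
      · have : p.1 = p.2 := le_antisymm (not_lt.1 hp) (not_lt.1 hq)
        have h0 : g p = 0 := by
          have h3 := ha p
          rw [show p.swap = p from Prod.ext this.symm this] at h3
          linarith
        rw [indicator_apply_eq_zero.2 fun _ => by rw [h0]]
  rw [restrict_lt_eq_triangle hε hσ, ← thermoGap_add hT, integral_add_measure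
    hig hi.restrict] at h2
  rw [restrict_lt_eq_triangle hσ hε, h2] at h1
  linarith

lemma integral_antisymm (hσ : μσ (Icc 0 1)ᶜ = 0) (hε : με (Icc 0 1)ᶜ = 0)
    (hT : ThermoRestriction μσ με) {g : ℝ × ℝ → ℝ} (hg : Continuous g)
    (ha : ∀ p, g p.swap = -g p) :
    ∫ p, g p ∂(μσ.prod με) = -∫ p, g p ∂(thermoGap μσ με) :=
  integral_antisymm_of_integrable hσ hε hT hg.stronglyMeasurable
    (integrable_prod_of_continuous hσ hε hg) (integrable_prod_of_continuous hε hσ hg) ha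

lemma continuous_rpow_prod {r₁ r₂ : ℝ} (h1 : 0 < r₁) (h2 : 0 < r₂) :
    Continuous fun p : ℝ × ℝ => r₁ ^ p.1 * r₂ ^ p.2 :=
  ((continuous_rpow_exponent h1).comp continuous_fst).mul
    ((continuous_rpow_exponent h2).comp continuous_snd)

/-- The ratio `Φσ / Φε` is non-increasing on `(0, ∞)`. -/
lemma phiR_ratio_anti (hσ : μσ (Icc 0 1)ᶜ = 0) (hε : με (Icc 0 1)ᶜ = 0)
    (hT : ThermoRestriction μσ με) {r₁ r₂ : ℝ} (h1 : 0 < r₁) (h2 : r₁ ≤ r₂) :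
    phiR μσ r₂ * phiR με r₁ ≤ phiR μσ r₁ * phiR με r₂ := by
  have h3 : 0 < r₂ := h1.trans_le h2
  have h := integral_antisymm hσ hε hT
    (g := fun p => r₂ ^ p.1 * r₁ ^ p.2 - r₁ ^ p.1 * r₂ ^ p.2)
    ((continuous_rpow_prod h3 h1).sub (continuous_rpow_prod h1 h3))
    (fun p => by simp only [Prod.fst_swap, Prod.snd_swap]; ring)
  rw [integral_sub (integrable_prod_of_continuous hσ hε (continuous_rpow_prod h3 h1))
    (integrable_prod_of_continuous hσ hε (continuous_rpow_prod h1 h3)),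
    integral_prod_mul (fun a : ℝ => r₂ ^ a) (fun a : ℝ => r₁ ^ a),
    integral_prod_mul (fun a : ℝ => r₁ ^ a) (fun a : ℝ => r₂ ^ a)] at h
  have h4 : 0 ≤ ∫ p, (r₂ ^ p.1 * r₁ ^ p.2 - r₁ ^ p.1 * r₂ ^ p.2) ∂(thermoGap μσ με) := by
    refine integral_nonneg_of_ae ?_
    filter_upwards [thermoGap_ae_mem (μσ := μσ) (με := με)] with p hp
    have h5 : r₁ ^ (p.1 - p.2) ≤ r₂ ^ (p.1 - p.2) :=
      Real.rpow_le_rpow h1.le h2 (sub_nonneg.2 hp.2.2.le)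
    rw [Real.rpow_sub h1, Real.rpow_sub h3, div_le_div_iff₀ (Real.rpow_pos_of_pos h1 _)
      (Real.rpow_pos_of_pos h3 _)] at h5
    simp only [Pi.zero_apply, sub_nonneg]
    exact h5
  unfold phiR
  linarith

lemma symbolPhi_mul_conj {s : ℂ} (hs : s ≠ 0) :
    symbolPhi μσ s * starRingEnd ℂ (symbolPhi με s) =
      ∫ p : ℝ × ℝ, ((‖s‖ ^ p.1 * ‖s‖ ^ p.2 : ℝ) : ℂ) *
        Complex.exp (((p.1 - p.2) * s.arg : ℝ) * Complex.I) ∂(μσ.prod με) := by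
  unfold symbolPhi
  rw [← integral_conj, ← integral_prod_mul]
  congr 1
  funext p
  rw [cpow_polar hs, cpow_polar hs, map_mul, Complex.conj_ofReal, ← Complex.exp_conj, map_mul,
    Complex.conj_ofReal, Complex.conj_I, mul_mul_mul_comm, ← Complex.exp_add]
  push_cast
  congr 2
  ring

lemma continuous_polar_prod {s : ℂ} (hs : s ≠ 0) :
    Continuous fun p : ℝ × ℝ => ((‖s‖ ^ p.1 * ‖s‖ ^ p.2 : ℝ) : ℂ) *
        Complex.exp (((p.1 - p.2) * s.arg : ℝ) * Complex.I) := by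
  have := continuous_rpow_prod (norm_pos_iff.2 hs) (norm_pos_iff.2 hs)
  fun_prop

/-- The imaginary part of `Φσ(s) conj (Φε(s))`, an antisymmetric integral, has the sign of
`-arg s` because the gap measure is non-negative. -/
lemma symbolPhi_mul_conj_im (hσ : μσ (Icc 0 1)ᶜ = 0) (hε : με (Icc 0 1)ᶜ = 0)
    (hT : ThermoRestriction μσ με) {s : ℂ} (hs : s ≠ 0) :
    (symbolPhi μσ s * starRingEnd ℂ (symbolPhi με s)).im =
      -∫ p, ‖s‖ ^ p.1 * ‖s‖ ^ p.2 * Real.sin ((p.1 - p.2) * s.arg) ∂(thermoGap μσ με) := by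
  have hr := norm_pos_iff.2 hs
  rw [← integral_antisymm hσ hε hT (g := fun p => ‖s‖ ^ p.1 * ‖s‖ ^ p.2 *
    Real.sin ((p.1 - p.2) * s.arg)), symbolPhi_mul_conj hs]
  · refine (integral_im (integrable_prod_of_continuous hσ hε (continuous_polar_prod hs))).symm.trans
      ?_
    congr 1
    funext p
    change (_ : ℂ).im = _
    rw [Complex.im_ofReal_mul, Complex.exp_ofReal_mul_I_im]
  · have := continuous_rpow_prod hr hr
    fun_prop
  · intro p
    simp only [Prod.fst_swap, Prod.snd_swap]
    rw [show (p.2 - p.1) * s.arg = -((p.1 - p.2) * s.arg) by ring, Real.sin_neg]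
    ring

lemma symbolPhi_mul_conj_re_nonneg (hσ : μσ (Icc 0 1)ᶜ = 0) (hε : με (Icc 0 1)ᶜ = 0)
    {s : ℂ} (hs : s ≠ 0) (hre : 0 ≤ s.re) :
    0 ≤ (symbolPhi μσ s * starRingEnd ℂ (symbolPhi με s)).re := by
  rw [symbolPhi_mul_conj hs]
  have hi := integrable_prod_of_continuous hσ hε (continuous_polar_prod hs)
  have e := integral_re hi
  change _ = (_ : ℂ).re at e
  rw [← e]
  refine integral_nonneg_of_ae ?_
  filter_upwards [prod_ae_mem_unit hσ hε] with p hp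
  change 0 ≤ (_ : ℂ).re
  rw [Complex.re_ofReal_mul, Complex.exp_ofReal_mul_I_re]
  have h1 : |s.arg| ≤ Real.pi / 2 := Complex.abs_arg_le_pi_div_two_iff.2 hre
  have h2 : |(p.1 - p.2) * s.arg| ≤ Real.pi / 2 := by
    rw [abs_mul]
    have : |p.1 - p.2| ≤ 1 := abs_le.2 ⟨by linarith [hp.1.1, hp.2.2], by linarith [hp.1.2, hp.2.1]⟩
    nlinarith [abs_nonneg s.arg]
  have h3 := Real.cos_nonneg_of_mem_Icc (abs_le.1 h2)
  positivity

/-- `∫ r^{α+β} (α - β)` against the gap measure; this is `-r R'(r) Φε(r)²` for `R = Φσ/Φε`. -/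
noncomputable def gapMoment (μσ με : Measure ℝ) (r : ℝ) : ℝ :=
  ∫ p, r ^ p.1 * r ^ p.2 * (p.1 - p.2) ∂(thermoGap μσ με)

lemma gapMoment_nonneg {μσ με : Measure ℝ} {r : ℝ} (hr : 0 < r) : 0 ≤ gapMoment μσ με r := by
  refine integral_nonneg_of_ae ?_
  filter_upwards [thermoGap_ae_mem (μσ := μσ) (με := με)] with p hp
  have := sub_nonneg.2 hp.2.2.le
  simp only [Pi.zero_apply]
  positivity

lemma gapMoment_eq (hσ : μσ (Icc 0 1)ᶜ = 0) (hε : με (Icc 0 1)ᶜ = 0)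
    (hT : ThermoRestriction μσ με) {r : ℝ} (hr : 0 < r) :
    gapMoment μσ με r = phiR μσ r * (∫ β, r ^ β * β ∂με) - (∫ α, r ^ α * α ∂μσ) * phiR με r := by
  have hc := continuous_rpow_exponent hr
  have h := integral_antisymm hσ hε hT (g := fun p => r ^ p.1 * r ^ p.2 * (p.1 - p.2))
    ((continuous_rpow_prod hr hr).mul (continuous_fst.sub continuous_snd))
    (fun p => by simp only [Prod.fst_swap, Prod.snd_swap]; ring)
  have e : ∀ p : ℝ × ℝ, r ^ p.1 * r ^ p.2 * (p.1 - p.2) =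
      (r ^ p.1 * p.1) * r ^ p.2 - r ^ p.1 * (r ^ p.2 * p.2) := fun p => by ring
  have h' : gapMoment μσ με r = -∫ p, r ^ p.1 * r ^ p.2 * (p.1 - p.2) ∂(μσ.prod με) := by
    rw [h, neg_neg]; rfl
  rw [h']
  simp_rw [e]
  rw [integral_sub (integrable_prod_of_continuous hσ hε (by fun_prop))
    (integrable_prod_of_continuous hσ hε (by fun_prop)),
    integral_prod_mul (fun a : ℝ => r ^ a * a) (fun a : ℝ => r ^ a),
    integral_prod_mul (fun a : ℝ => r ^ a) (fun a : ℝ => r ^ a * a)]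
  unfold phiR
  ring

end gap

/-! ### The ratio `Φσ / Φε` and its square root -/

/-- Two non-zero measures carried by `[0, 1]` that satisfy the thermodynamical restriction. -/
structure Admissible (μσ με : Measure ℝ) : Prop where
  hσ : μσ (Icc 0 1)ᶜ = 0
  hε : με (Icc 0 1)ᶜ = 0
  hσ0 : μσ ≠ 0
  hε0 : με ≠ 0
  hT : ThermoRestriction μσ με

/-- The ratio `Φσ(r) / Φε(r)` for real `r > 0`. -/
noncomputable def ratioR (μσ με : Measure ℝ) (r : ℝ) : ℝ := phiR μσ r / phiR με r

namespace Admissible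

variable {μσ με : Measure ℝ} [IsFiniteMeasure μσ] [IsFiniteMeasure με]

lemma ratioR_pos (h : Admissible μσ με) {r : ℝ} (hr : 0 < r) : 0 < ratioR μσ με r :=
  div_pos (phiR_pos h.hσ h.hσ0 hr) (phiR_pos h.hε h.hε0 hr)

lemma ratioR_anti (h : Admissible μσ με) {r₁ r₂ : ℝ} (h1 : 0 < r₁) (h2 : r₁ ≤ r₂) :
    ratioR μσ με r₂ ≤ ratioR μσ με r₁ := by
  unfold ratioR
  rw [div_le_div_iff₀ (phiR_pos h.hε h.hε0 (h1.trans_le h2)) (phiR_pos h.hε h.hε0 h1)]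
  exact phiR_ratio_anti h.hσ h.hε h.hT h1 h2

lemma mul_ratioR_mono (h : Admissible μσ με) {r₁ r₂ : ℝ} (h1 : 0 < r₁) (h2 : r₁ ≤ r₂) :
    r₁ * ratioR μσ με r₁ ≤ r₂ * ratioR μσ με r₂ := by
  have h3 := h1.trans_le h2
  have a1 := phiR_mono h.hσ h1 h2
  have a2 := phiR_le_mul h.hε h1 h2
  have p1 := phiR_pos h.hε h.hε0 h1
  have p2 := phiR_pos h.hε h.hε0 h3
  have p3 := phiR_pos h.hσ h.hσ0 h1
  unfold ratioR
  rw [← mul_div_assoc, ← mul_div_assoc, div_le_div_iff₀ p1 p2]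
  rw [div_mul_eq_mul_div, le_div_iff₀ h1] at a2
  calc r₁ * phiR μσ r₁ * phiR με r₂ = phiR μσ r₁ * (phiR με r₂ * r₁) := by ring
    _ ≤ phiR μσ r₁ * (r₂ * phiR με r₁) := by gcongr
    _ ≤ phiR μσ r₂ * (r₂ * phiR με r₁) := by gcongr
    _ = _ := by ring

lemma cos_half_arg_pos {s : ℂ} (hs : s ∈ Complex.slitPlane) : 0 < Real.cos (s.arg / 2) := by
  have h1 := Complex.slitPlane_arg_ne_pi hs
  have h2 := Complex.arg_le_pi s
  have h3 := Complex.neg_pi_lt_arg s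
  have h4 := lt_of_le_of_ne h2 h1
  exact Real.cos_pos_of_mem_Ioo ⟨by linarith, by linarith⟩

lemma symbolPhi_ne_zero {μ : Measure ℝ} [IsFiniteMeasure μ] (hμ : μ (Icc 0 1)ᶜ = 0)
    (h0 : μ ≠ 0) {s : ℂ} (hs : s ∈ Complex.slitPlane) : symbolPhi μ s ≠ 0 := by
  have hs0 := Complex.slitPlane_ne_zero hs
  have h1 := cos_mul_phiR_le_norm hμ hs0
  have h2 := mul_pos (cos_half_arg_pos hs) (phiR_pos hμ h0 (norm_pos_iff.2 hs0))
  exact norm_pos_iff.1 (h2.trans_le h1)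

/-- `Φσ` and `Φε`, rotated by half of `arg s`, lie in the right half-plane, so their quotient
avoids the negative axis. -/
lemma symbolRatio_mem_slitPlane (h : Admissible μσ με) {s : ℂ} (hs : s ∈ Complex.slitPlane) :
    symbolRatio μσ με s ∈ Complex.slitPlane := by
  have hs0 := Complex.slitPlane_ne_zero hs
  have hn := norm_pos_iff.2 hs0
  have h1 := (mul_pos (cos_half_arg_pos hs) (phiR_pos h.hσ h.hσ0 hn)).trans_le
    (cos_mul_phiR_le_re h.hσ hs0)
  have h2 := (mul_pos (cos_half_arg_pos hs) (phiR_pos h.hε h.hε0 hn)).trans_le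
    (cos_mul_phiR_le_re h.hε hs0)
  have h3 := symbolPhi_ne_zero h.hε h.hε0 hs
  rw [Complex.mem_slitPlane_iff]
  by_contra! hc
  have h4 : symbolRatio μσ με s = ((symbolRatio μσ με s).re : ℂ) := Complex.ext rfl (by simp [hc.2])
  have h5 : symbolPhi μσ s = ((symbolRatio μσ με s).re : ℂ) * symbolPhi με s := by
    rw [← h4, symbolRatio, div_mul_cancel₀ _ h3]
  rw [h5, mul_left_comm, Complex.re_ofReal_mul] at h1
  nlinarith [hc.1]

lemma symbolRatio_ofReal {μσ με : Measure ℝ} {r : ℝ} (hr : 0 < r) :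
    symbolRatio μσ με r = ratioR μσ με r := by
  rw [symbolRatio, symbolPhi_ofReal hr, symbolPhi_ofReal hr, ratioR, Complex.ofReal_div]

lemma symbolRatio_eq {μσ με : Measure ℝ} {s : ℂ} : symbolRatio μσ με s = symbolPhi μσ s *
    starRingEnd ℂ (symbolPhi με s) * ((Complex.normSq (symbolPhi με s))⁻¹ : ℝ) := by
  rw [symbolRatio, div_eq_mul_inv, Complex.inv_def, mul_assoc]

lemma differentiableAt_symbolPsi (h : Admissible μσ με) {s : ℂ} (hs : s ∈ Complex.slitPlane) :
    DifferentiableAt ℂ (symbolPsi μσ με) s :=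
  ((differentiableAt_symbolPhi h.hσ hs).div (differentiableAt_symbolPhi h.hε hs)
    (symbolPhi_ne_zero h.hε h.hε0 hs)).cpow_const (h.symbolRatio_mem_slitPlane hs)

lemma symbolPsi_sq {μσ με : Measure ℝ} (s : ℂ) : symbolPsi μσ με s ^ 2 = symbolRatio μσ με s := by
  rw [symbolPsi, one_div]
  exact Complex.cpow_nat_inv_pow _ two_ne_zero

lemma symbolPsi_re_pos (h : Admissible μσ με) {s : ℂ} (hs : s ∈ Complex.slitPlane) :
    0 < (symbolPsi μσ με s).re := by
  have h1 := h.symbolRatio_mem_slitPlane hs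
  have h2 := Complex.slitPlane_ne_zero h1
  have e : (1 / 2 : ℂ) = ((1 / 2 : ℝ) : ℂ) := by push_cast; rfl
  rw [symbolPsi, e, cpow_polar h2, Complex.re_ofReal_mul, Complex.exp_ofReal_mul_I_re]
  have h3 := cos_half_arg_pos h1
  rw [show (1 / 2 : ℝ) * (symbolRatio μσ με s).arg = (symbolRatio μσ με s).arg / 2 by ring]
  exact mul_pos (Real.rpow_pos_of_pos (norm_pos_iff.2 h2) _) h3

lemma norm_symbolPsi_sq {μσ με : Measure ℝ} (s : ℂ) :
    ‖symbolPsi μσ με s‖ ^ 2 = ‖symbolRatio μσ με s‖ := by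
  rw [← norm_pow, symbolPsi_sq]

lemma symbolRatio_im (h : Admissible μσ με) {s : ℂ} (hs : s ≠ 0) :
    (symbolRatio μσ με s).im = -(∫ p, ‖s‖ ^ p.1 * ‖s‖ ^ p.2 *
      Real.sin ((p.1 - p.2) * s.arg) ∂(thermoGap μσ με)) * ‖symbolPhi με s‖⁻¹ ^ 2 := by
  rw [symbolRatio_eq, Complex.im_mul_ofReal, symbolPhi_mul_conj_im h.hσ h.hε h.hT hs,
    Complex.normSq_eq_norm_sq, inv_pow]

lemma symbolRatio_re_nonneg (h : Admissible μσ με) {s : ℂ} (hs : s ≠ 0) (hre : 0 ≤ s.re) :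
    0 ≤ (symbolRatio μσ με s).re := by
  rw [symbolRatio_eq, Complex.re_mul_ofReal]
  exact mul_nonneg (symbolPhi_mul_conj_re_nonneg h.hσ h.hε hs hre)
    (inv_nonneg.2 (Complex.normSq_nonneg _))

lemma symbolRatio_conj {μσ με : Measure ℝ} {s : ℂ} (hs : s ∈ Complex.slitPlane) :
    symbolRatio μσ με (starRingEnd ℂ s) = starRingEnd ℂ (symbolRatio μσ με s) := by
  rw [symbolRatio, symbolRatio, symbolPhi_conj hs, symbolPhi_conj hs, map_div₀]

lemma symbolPsi_conj (h : Admissible μσ με) {s : ℂ} (hs : s ∈ Complex.slitPlane) :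
    symbolPsi μσ με (starRingEnd ℂ s) = starRingEnd ℂ (symbolPsi μσ με s) := by
  rw [symbolPsi, symbolPsi, symbolRatio_conj hs, Complex.conj_cpow _ _
    (Complex.slitPlane_arg_ne_pi (h.symbolRatio_mem_slitPlane hs))]
  simp [map_ofNat]

lemma symbolPsi_im_nonpos (h : Admissible μσ με) {s : ℂ} (hs : 0 < s.im) :
    (symbolPsi μσ με s).im ≤ 0 := by
  have hsl : s ∈ Complex.slitPlane := Complex.mem_slitPlane_iff.2 (Or.inr hs.ne')
  have hs0 := Complex.slitPlane_ne_zero hsl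
  have h1 : (symbolRatio μσ με s).im ≤ 0 := by
    rw [h.symbolRatio_im hs0]
    refine mul_nonpos_of_nonpos_of_nonneg (neg_nonpos.2 (integral_nonneg_of_ae ?_)) (by positivity)
    filter_upwards [thermoGap_ae_mem (μσ := μσ) (με := με)] with p hp
    have h2 : 0 ≤ s.arg := Complex.arg_nonneg_iff.2 hs.le
    have h3 : 0 ≤ p.1 - p.2 := sub_nonneg.2 hp.2.2.le
    have h4 : p.1 - p.2 ≤ 1 := by linarith [hp.1.2, hp.2.1.1]
    have h5 : 0 ≤ Real.sin ((p.1 - p.2) * s.arg) := by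
      refine Real.sin_nonneg_of_nonneg_of_le_pi (by positivity) ?_
      nlinarith [Complex.arg_le_pi s]
    simp only [Pi.zero_apply]
    positivity
  have h2 := h.symbolPsi_re_pos hsl
  rw [← symbolPsi_sq, sq, Complex.mul_im] at h1
  nlinarith

/-- `Ψ` exchanges the upper and lower half-planes: this is where the thermodynamical restriction
enters the sign arguments. -/
lemma im_mul_symbolPsi_im_nonpos (h : Admissible μσ με) {s : ℂ} (hs : s ∈ Complex.slitPlane) :
    s.im * (symbolPsi μσ με s).im ≤ 0 := by
  rcases lt_trichotomy s.im 0 with h1 | h1 | h1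
  · have h2 := h.symbolPsi_im_nonpos (s := starRingEnd ℂ s) (by simpa using h1)
    rw [h.symbolPsi_conj hs, Complex.conj_im] at h2
    nlinarith
  · simp [h1]
  · nlinarith [h.symbolPsi_im_nonpos h1]

lemma norm_symbolPsi_sq_le {μσ με : Measure ℝ} [IsFiniteMeasure με] (h : Admissible μσ με)
    {s : ℂ} (hs : s ∈ Complex.slitPlane) :
    ‖symbolPsi μσ με s‖ ^ 2 * Real.cos (s.arg / 2) ≤ ratioR μσ με ‖s‖ := by
  have hs0 := Complex.slitPlane_ne_zero hs
  have hn := norm_pos_iff.2 hs0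
  have hp := phiR_pos h.hε h.hε0 hn
  have hc := cos_half_arg_pos hs
  have h1 := cos_mul_phiR_le_norm h.hε hs0
  have h2 := norm_symbolPhi_le (μ := μσ) s
  have h3 := norm_pos_iff.2 (symbolPhi_ne_zero h.hε h.hε0 hs)
  rw [norm_symbolPsi_sq, symbolRatio, norm_div, ratioR, div_mul_eq_mul_div,
    div_le_div_iff₀ h3 hp, mul_assoc]
  exact mul_le_mul h2 h1 (by positivity) ((norm_nonneg _).trans h2)

lemma le_norm_symbolPsi_sq (h : Admissible μσ με) {s : ℂ} (hs : s ∈ Complex.slitPlane) :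
    Real.cos (s.arg / 2) * ratioR μσ με ‖s‖ ≤ ‖symbolPsi μσ με s‖ ^ 2 := by
  have hs0 := Complex.slitPlane_ne_zero hs
  have hn := norm_pos_iff.2 hs0
  have hp := phiR_pos h.hε h.hε0 hn
  have h1 := cos_mul_phiR_le_norm h.hσ hs0
  have h2 := norm_symbolPhi_le (μ := με) s
  have h3 := norm_pos_iff.2 (symbolPhi_ne_zero h.hε h.hε0 hs)
  rw [norm_symbolPsi_sq, symbolRatio, norm_div, ratioR, ← mul_div_assoc,
    div_le_div_iff₀ hp h3]
  exact mul_le_mul h1 h2 (by positivity) (norm_nonneg _)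

lemma symbolPsi_ofReal (h : Admissible μσ με) {r : ℝ} (hr : 0 < r) :
    symbolPsi μσ με r = (√(ratioR μσ με r) : ℝ) := by
  rw [symbolPsi, symbolRatio_ofReal hr, Real.sqrt_eq_rpow,
    Complex.ofReal_cpow (h.ratioR_pos hr).le]
  simp

/-- On the right half-plane `Ψ` stays in the sector `|arg| ≤ π / 4`. -/
lemma norm_sq_le_two_mul_re_sq (h : Admissible μσ με) {s : ℂ} (hs : s ≠ 0) (hre : 0 ≤ s.re) :
    ‖symbolPsi μσ με s‖ ^ 2 ≤ 2 * (symbolPsi μσ με s).re ^ 2 := by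
  have h1 := h.symbolRatio_re_nonneg hs hre
  rw [← symbolPsi_sq, sq, Complex.mul_re] at h1
  rw [Complex.sq_norm, Complex.normSq_apply]
  nlinarith

end Admissible

/-! ### Limits of the ratio at infinity and at the origin -/

/-- `γ` is the essential supremum of the exponent `σ α` under `μ`. With `σ = 1` it governs
`Φ(s)` as `s → ∞`, with `σ = -1` as `s → 0`. -/
structure IsTopExponent (μ : Measure ℝ) (σ γ : ℝ) : Prop where
  le : ∀ᵐ α ∂μ, σ * α ≤ γ
  pos : ∀ x < γ, 0 < μ {α | x < σ * α}

lemma exists_isTopExponent {μ : Measure ℝ} (hμ : μ (Icc 0 1)ᶜ = 0) (h0 : μ ≠ 0) {σ : ℝ}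
    (hσ : |σ| = 1) : ∃ γ, IsTopExponent μ σ γ := by
  have hne : (ae μ).NeBot := ae_neBot.2 h0
  have hb : ∀ᵐ α ∂μ, |σ * α| ≤ 1 := by
    filter_upwards [ae_mem_unit hμ] with α hα
    rw [abs_mul, hσ, one_mul, abs_of_nonneg hα.1]
    exact hα.2
  have h1 : IsBoundedUnder (· ≤ ·) (ae μ) fun α => σ * α :=
    isBoundedUnder_of_eventually_le (hb.mono fun α h => (abs_le.1 h).2)
  have h2 : IsBoundedUnder (· ≥ ·) (ae μ) fun α => σ * α :=
    isBoundedUnder_of_eventually_ge (hb.mono fun α h => (abs_le.1 h).1)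
  refine ⟨essSup (fun α => σ * α) μ, ae_le_essSup h1, fun x hx => ?_⟩
  by_contra hc
  have h3 : ∀ᵐ α ∂μ, σ * α ≤ x := by
    have : μ {α | x < σ * α} = 0 := by simpa using hc
    simpa [ae_iff] using this
  exact absurd (essSup_le_of_ae_le x h3 h2.isCoboundedUnder_le) (not_le.2 hx)

namespace IsTopExponent

variable {μ : Measure ℝ} [IsFiniteMeasure μ] {σ γ : ℝ}

lemma rpow_eq (hσ : |σ| = 1) {r : ℝ} (hr : 0 < r) (α : ℝ) :
    r ^ α = Real.exp (σ * α * (σ * Real.log r)) := by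
  have : σ * σ = 1 := by rw [← sq, ← sq_abs, hσ, one_pow]
  rw [Real.rpow_def_of_pos hr]
  congr 1
  linear_combination (-(α * Real.log r)) * this

lemma phiR_le (hμ : μ (Icc 0 1)ᶜ = 0) (h : IsTopExponent μ σ γ) (hσ : |σ| = 1) {r : ℝ}
    (hr : 0 < r) (hL : 0 ≤ σ * Real.log r) :
    phiR μ r ≤ μ.real univ * Real.exp (γ * (σ * Real.log r)) := by
  have : ∫ _ : ℝ, Real.exp (γ * (σ * Real.log r)) ∂μ =
      μ.real univ * Real.exp (γ * (σ * Real.log r)) := by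
    rw [integral_const, smul_eq_mul]
  rw [← this]
  refine integral_mono_ae (integrable_of_continuous hμ (continuous_rpow_exponent hr))
    (integrable_const _) ?_
  filter_upwards [h.le] with α hα
  rw [rpow_eq hσ hr]
  gcongr

lemma le_phiR (hμ : μ (Icc 0 1)ᶜ = 0) (h : IsTopExponent μ σ γ) (hσ : |σ| = 1) {x : ℝ}
    (hx : x < γ) : ∃ m > 0, ∀ r : ℝ, 0 < r → 0 ≤ σ * Real.log r →
      m * Real.exp (x * (σ * Real.log r)) ≤ phiR μ r := by
  have hm : MeasurableSet {α : ℝ | x < σ * α} := measurableSet_lt (by fun_prop) (by fun_prop)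
  refine ⟨μ.real {α | x < σ * α}, ENNReal.toReal_pos (h.pos x hx).ne' (measure_ne_top _ _),
    fun r hr hL => ?_⟩
  have e : ∫ _ in {α | x < σ * α}, Real.exp (x * (σ * Real.log r)) ∂μ =
      μ.real {α | x < σ * α} * Real.exp (x * (σ * Real.log r)) := by
    rw [setIntegral_const, smul_eq_mul]
  have hi := integrable_of_continuous hμ (continuous_rpow_exponent hr)
  rw [← e]
  refine le_trans (setIntegral_mono_on (integrable_const _).integrableOn hi.integrableOn hm ?_)
    (setIntegral_le_integral hi (Eventually.of_forall fun α => (Real.rpow_pos_of_pos hr α).le))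
  intro α hα
  rw [rpow_eq hσ hr]
  have : x ≤ σ * α := (show x < σ * α from hα).le
  gcongr

/-- The tilted probability measures `r^α dμ(α) / Φ(r)` concentrate at the extreme exponent. -/
lemma tendsto_tilt (hμ : μ (Icc 0 1)ᶜ = 0) (h0 : μ ≠ 0) (h : IsTopExponent μ σ γ)
    (hσ : |σ| = 1) {ι : Type*} {l : Filter ι} {r : ι → ℝ} (hr : ∀ᶠ i in l, 0 < r i)
    (hl : Tendsto (fun i => σ * Real.log (r i)) l atTop) :
    Tendsto (fun i => (∫ α, r i ^ α * (γ - σ * α) ∂μ) / phiR μ (r i)) l (𝓝 0) := by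
  set C : ℝ := |γ| + 1 with hC
  have hbd : ∀ᵐ α ∂μ, γ - σ * α ≤ C := by
    filter_upwards [ae_mem_unit hμ] with α hα
    have h1 : |σ * α| ≤ 1 := by rw [abs_mul, hσ, one_mul, abs_of_nonneg hα.1]; exact hα.2
    have := (abs_le.1 h1).1
    have := le_abs_self γ
    linarith
  rw [Metric.tendsto_nhds]
  intro ε hε
  set η := ε / 2 with hη
  have hη0 : 0 < η := by positivity
  obtain ⟨m, hm, hlow⟩ := h.le_phiR hμ hσ (show γ - η / 2 < γ by linarith)
  have hexp : Tendsto (fun i => C * μ.real univ / m * Real.exp (-(η / 2 * (σ * Real.log (r i)))))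
      l (𝓝 0) := by
    have h1 : Tendsto (fun i => η / 2 * (σ * Real.log (r i))) l atTop :=
      hl.const_mul_atTop (by positivity)
    simpa using (Real.tendsto_exp_neg_atTop_nhds_zero.comp h1).const_mul (C * μ.real univ / m)
  filter_upwards [hr, hl.eventually_ge_atTop 0, hexp.eventually (gt_mem_nhds hη0)]
    with i hri hLi hei
  have hΦ := phiR_pos hμ h0 hri
  have hlow' := hlow _ hri hLi
  have hc := continuous_rpow_exponent hri
  set Λ := σ * Real.log (r i) with hΛ
  have hT0 : 0 ≤ ∫ α, r i ^ α * (γ - σ * α) ∂μ := by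
    refine integral_nonneg_of_ae ?_
    filter_upwards [h.le] with α hα
    exact mul_nonneg (Real.rpow_pos_of_pos hri α).le (sub_nonneg.2 hα)
  have hT : ∫ α, r i ^ α * (γ - σ * α) ∂μ ≤
      η * phiR μ (r i) + C * μ.real univ * Real.exp ((γ - η) * Λ) := by
    have e : η * phiR μ (r i) + C * μ.real univ * Real.exp ((γ - η) * Λ) =
        ∫ α, (η * r i ^ α + C * Real.exp ((γ - η) * Λ)) ∂μ := by
      rw [integral_add ((integrable_of_continuous hμ hc).const_mul _) (integrable_const _),
        integral_const_mul, integral_const, smul_eq_mul, phiR]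
      ring
    rw [e]
    refine integral_mono_ae (integrable_of_continuous hμ (by fun_prop))
      (integrable_of_continuous hμ (by fun_prop)) ?_
    filter_upwards [hbd] with α h1
    have hp := Real.rpow_pos_of_pos hri α
    have hC0 : 0 ≤ C := by positivity
    rcases le_or_gt (γ - σ * α) η with h2 | h2
    · have := mul_le_mul_of_nonneg_left h2 hp.le
      have : 0 ≤ C * Real.exp ((γ - η) * Λ) := by positivity
      linarith
    · have h3 : r i ^ α ≤ Real.exp ((γ - η) * Λ) := by
        rw [rpow_eq hσ hri]
        have : σ * α ≤ γ - η := by linarith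
        gcongr
      have h4 : r i ^ α * (γ - σ * α) ≤ Real.exp ((γ - η) * Λ) * C :=
        mul_le_mul h3 h1 (hη0.le.trans h2.le) (Real.exp_pos _).le
      have : 0 ≤ η * r i ^ α := by positivity
      linarith
  rw [Real.dist_eq, sub_zero, abs_of_nonneg (div_nonneg hT0 hΦ.le), div_lt_iff₀ hΦ]
  have e2 : Real.exp ((γ - η) * Λ) = Real.exp (-(η / 2 * Λ)) * Real.exp ((γ - η / 2) * Λ) := by
    rw [← Real.exp_add]; congr 1; ring
  have h5 : C * μ.real univ * Real.exp ((γ - η) * Λ) < η * phiR μ (r i) := by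
    rw [e2]
    calc C * μ.real univ * (Real.exp (-(η / 2 * Λ)) * Real.exp ((γ - η / 2) * Λ))
        = (C * μ.real univ / m * Real.exp (-(η / 2 * Λ))) *
          (m * Real.exp ((γ - η / 2) * Λ)) := by field_simp
      _ < η * (m * Real.exp ((γ - η / 2) * Λ)) := by gcongr
      _ ≤ _ := by gcongr
  have : ε = η + η := by rw [hη]; ring
  rw [this, add_mul]
  linarith

/-- `Φ(s) / Φ(|s|)` is asymptotic to `exp (i σ γ arg s)`, uniformly in `arg s`. -/
lemma tendsto_symbolPhi_div (hμ : μ (Icc 0 1)ᶜ = 0) (h0 : μ ≠ 0) (h : IsTopExponent μ σ γ)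
    (hσ : |σ| = 1) {l : Filter ℂ} (hs : ∀ᶠ s in l, s ≠ 0)
    (hl : Tendsto (fun s => σ * Real.log ‖s‖) l atTop) :
    Tendsto (fun s => symbolPhi μ s / phiR μ ‖s‖ -
      Complex.exp ((σ * γ * s.arg : ℝ) * Complex.I)) l (𝓝 0) := by
  have hσσ : σ * σ = 1 := by rw [← sq, ← sq_abs, hσ, one_pow]
  have ht := (h.tendsto_tilt hμ h0 hσ (hs.mono fun s h => norm_pos_iff.2 h) hl).const_mul Real.pi
  rw [mul_zero] at ht
  refine squeeze_zero_norm' ?_ ht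
  filter_upwards [hs] with s hs
  have hn := norm_pos_iff.2 hs
  have hΦ := phiR_pos hμ h0 hn
  have hΦ' : (phiR μ ‖s‖ : ℂ) ≠ 0 := by exact_mod_cast hΦ.ne'
  have hc := continuous_rpow_exponent hn
  have e : symbolPhi μ s / phiR μ ‖s‖ - Complex.exp ((σ * γ * s.arg : ℝ) * Complex.I) =
      (∫ α : ℝ, ((‖s‖ ^ α : ℝ) : ℂ) * (Complex.exp ((α * s.arg : ℝ) * Complex.I) -
        Complex.exp ((σ * γ * s.arg : ℝ) * Complex.I)) ∂μ) / phiR μ ‖s‖ := by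
    rw [eq_div_iff hΦ', sub_mul, div_mul_cancel₀ _ hΦ']
    simp_rw [mul_sub]
    rw [integral_sub (integrable_of_continuous hμ (by fun_prop))
      (integrable_of_continuous hμ (by fun_prop)), integral_mul_const]
    congr 1
    · unfold symbolPhi
      congr 1
      funext α
      exact cpow_polar hs α
    · rw [mul_comm, phiR, integral_complex_ofReal]
  rw [e, norm_div, Complex.norm_real, Real.norm_of_nonneg hΦ.le, ← mul_div_assoc,
    ← integral_const_mul]
  gcongr
  refine norm_integral_le_of_norm_le (integrable_of_continuous hμ (by fun_prop)) ?_
  filter_upwards [h.le] with α hα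
  rw [norm_mul, Complex.norm_real, Real.norm_of_nonneg (Real.rpow_pos_of_pos hn α).le,
    mul_left_comm]
  gcongr
  have h1 : Complex.exp ((α * s.arg : ℝ) * Complex.I) -
      Complex.exp ((σ * γ * s.arg : ℝ) * Complex.I) =
      Complex.exp ((σ * γ * s.arg : ℝ) * Complex.I) *
      (Complex.exp (Complex.I * (α * s.arg - σ * γ * s.arg : ℝ)) - 1) := by
    rw [mul_sub, ← Complex.exp_add, mul_one]
    congr 2
    push_cast
    ring
  rw [h1, norm_mul, Complex.norm_exp_ofReal_mul_I, one_mul]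
  refine (Real.norm_exp_I_mul_ofReal_sub_one_le).trans ?_
  rw [← sub_mul, norm_mul, Real.norm_eq_abs, Real.norm_eq_abs, mul_comm]
  have h2 : |α - σ * γ| = γ - σ * α := by
    have : α - σ * γ = -(σ * (γ - σ * α)) := by linear_combination (-α) * hσσ
    rw [this, abs_neg, abs_mul, hσ, one_mul, abs_of_nonneg (sub_nonneg.2 hα)]
  rw [h2]
  exact mul_le_mul_of_nonneg_right (Complex.abs_arg_le_pi s) (sub_nonneg.2 hα)

end IsTopExponent

/-- If the extreme exponent of `μ` is smaller than that of `ν`, then `Φ_μ / Φ_ν → 0`. -/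
lemma tendsto_ratio_zero {μ ν : Measure ℝ} [IsFiniteMeasure μ] [IsFiniteMeasure ν]
    (hμ : μ (Icc 0 1)ᶜ = 0) (hμ0 : μ ≠ 0) (hν : ν (Icc 0 1)ᶜ = 0) {σ γ₁ γ₂ : ℝ}
    (hσ : |σ| = 1) (h1 : IsTopExponent μ σ γ₁) (h2 : IsTopExponent ν σ γ₂) (hlt : γ₁ < γ₂)
    {ι : Type*} {l : Filter ι} {r : ι → ℝ} (hr : ∀ᶠ i in l, 0 < r i)
    (hl : Tendsto (fun i => σ * Real.log (r i)) l atTop) :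
    Tendsto (fun i => phiR μ (r i) / phiR ν (r i)) l (𝓝 0) := by
  obtain ⟨m, hm, hlow⟩ := h2.le_phiR hν hσ (show (γ₁ + γ₂) / 2 < γ₂ by linarith)
  have hexp : Tendsto (fun i => μ.real univ / m *
      Real.exp (-((γ₂ - γ₁) / 2 * (σ * Real.log (r i))))) l (𝓝 0) := by
    have h1 : Tendsto (fun i => (γ₂ - γ₁) / 2 * (σ * Real.log (r i))) l atTop :=
      hl.const_mul_atTop (by linarith)
    simpa using (Real.tendsto_exp_neg_atTop_nhds_zero.comp h1).const_mul (μ.real univ / m)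
  refine squeeze_zero_norm' ?_ hexp
  filter_upwards [hr, hl.eventually_ge_atTop 0] with i hri hLi
  have a1 := h1.phiR_le hμ hσ hri hLi
  have a2 := hlow _ hri hLi
  have hp : 0 < phiR ν (r i) := lt_of_lt_of_le (by positivity) a2
  have hq := phiR_pos hμ hμ0 hri
  rw [Real.norm_of_nonneg (div_pos hq hp).le]
  calc phiR μ (r i) / phiR ν (r i)
      ≤ (μ.real univ * Real.exp (γ₁ * (σ * Real.log (r i)))) /
        (m * Real.exp ((γ₁ + γ₂) / 2 * (σ * Real.log (r i)))) := by gcongr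
    _ = μ.real univ / m * (Real.exp (γ₁ * (σ * Real.log (r i))) /
        Real.exp ((γ₁ + γ₂) / 2 * (σ * Real.log (r i)))) := by field_simp
    _ = _ := by rw [← Real.exp_sub]; congr 2; ring

namespace Admissible

variable {μσ με : Measure ℝ} [IsFiniteMeasure μσ] [IsFiniteMeasure με]

lemma topExponent_eq_of_tendsto (h : Admissible μσ με) {σ γ₁ γ₂ : ℝ}
    (hσ : |σ| = 1) (h1 : IsTopExponent μσ σ γ₁) (h2 : IsTopExponent με σ γ₂)
    {ι : Type*} {l : Filter ι} [l.NeBot] {r : ι → ℝ} (hr : ∀ᶠ i in l, 0 < r i)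
    (hl : Tendsto (fun i => σ * Real.log (r i)) l atTop) {τ : ℝ} (hτ : 0 < τ)
    (hlim : Tendsto (fun i => ratioR μσ με (r i)) l (𝓝 τ)) : γ₁ = γ₂ := by
  rcases lt_trichotomy γ₁ γ₂ with hlt | heq | hgt
  · exact absurd (tendsto_nhds_unique hlim (tendsto_ratio_zero h.hσ h.hσ0 h.hε hσ h1 h2 hlt hr hl))
      hτ.ne'
  · exact heq
  · have a := tendsto_ratio_zero h.hε h.hε0 h.hσ hσ h2 h1 hgt hr hl
    have b := hlim.inv₀ hτ.ne'
    refine absurd (tendsto_nhds_unique b (a.congr fun i => ?_)) (inv_pos.2 hτ).ne'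
    rw [ratioR, inv_div]

/-- The quotient `R(s) / R(|s|)` as a quotient of two functions asymptotic to unit numbers. -/
lemma symbolRatio_div_eq (h : Admissible μσ με) {s : ℂ} (hs : s ≠ 0) :
    symbolRatio μσ με s = ratioR μσ με ‖s‖ *
      ((symbolPhi μσ s / phiR μσ ‖s‖) / (symbolPhi με s / phiR με ‖s‖)) := by
  have hn := norm_pos_iff.2 hs
  have h1 : (phiR μσ ‖s‖ : ℂ) ≠ 0 := by exact_mod_cast (phiR_pos h.hσ h.hσ0 hn).ne'
  have h2 : (phiR με ‖s‖ : ℂ) ≠ 0 := by exact_mod_cast (phiR_pos h.hε h.hε0 hn).ne'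
  rw [symbolRatio, ratioR, Complex.ofReal_div]
  by_cases h3 : symbolPhi με s = 0
  · simp [h3]
  · field_simp

lemma tendsto_norm_ratio (h : Admissible μσ με) {σ : ℝ} (hσ : |σ| = 1) {l : Filter ℂ}
    (hs : ∀ᶠ s in l, s ≠ 0) (hl : Tendsto (fun s : ℂ => σ * Real.log ‖s‖) l atTop) :
    Tendsto (fun s => ‖(symbolPhi μσ s / phiR μσ ‖s‖) / (symbolPhi με s / phiR με ‖s‖)‖) l
      (𝓝 1) := by
  have key : ∀ (μ : Measure ℝ) [IsFiniteMeasure μ], μ (Icc 0 1)ᶜ = 0 → μ ≠ 0 →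
      Tendsto (fun s => ‖symbolPhi μ s / phiR μ ‖s‖‖) l (𝓝 1) := by
    intro μ _ hμ h0
    obtain ⟨γ, hγ⟩ := exists_isTopExponent hμ h0 hσ
    have h1 := (hγ.tendsto_symbolPhi_div hμ h0 hσ hs hl).norm
    rw [norm_zero] at h1
    rw [tendsto_iff_norm_sub_tendsto_zero]
    refine squeeze_zero (fun _ => norm_nonneg _) (fun s => ?_) h1
    have h2 := abs_norm_sub_norm_le (symbolPhi μ s / phiR μ ‖s‖)
      (Complex.exp ((σ * γ * s.arg : ℝ) * Complex.I))
    rwa [Complex.norm_exp_ofReal_mul_I] at h2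
  simp_rw [norm_div _ (symbolPhi με _ / _)]
  have := (key μσ h.hσ h.hσ0).div (key με h.hε h.hε0) one_ne_zero
  rwa [div_one] at this

lemma tendsto_symbolRatio (h : Admissible μσ με) {σ : ℝ} (hσ : |σ| = 1) {l : Filter ℂ} [l.NeBot]
    (hs : ∀ᶠ s in l, s ≠ 0) (hl : Tendsto (fun s : ℂ => σ * Real.log ‖s‖) l atTop) {τ : ℝ}
    (hτ : 0 ≤ τ) (hlim : Tendsto (fun s : ℂ => ratioR μσ με ‖s‖) l (𝓝 τ)) :
    Tendsto (symbolRatio μσ με) l (𝓝 (τ : ℂ)) := by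
  have hn := h.tendsto_norm_ratio hσ hs hl
  have hlim' := (Complex.continuous_ofReal.tendsto _).comp hlim
  rcases hτ.eq_or_lt with h0 | hpos
  · rw [← h0, Complex.ofReal_zero]
    have h1 := hlim.mul hn
    rw [← h0, zero_mul] at h1
    refine squeeze_zero_norm' ?_ h1
    filter_upwards [hs] with s hs
    rw [h.symbolRatio_div_eq hs, norm_mul, Complex.norm_real,
      Real.norm_of_nonneg (h.ratioR_pos (norm_pos_iff.2 hs)).le]
  · obtain ⟨γ₁, h1⟩ := exists_isTopExponent h.hσ h.hσ0 hσ
    obtain ⟨γ₂, h2⟩ := exists_isTopExponent h.hε h.hε0 hσ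
    have heq := h.topExponent_eq_of_tendsto hσ h1 h2
      (hs.mono fun s hs => norm_pos_iff.2 hs) hl hpos hlim
    subst heq
    have a1 := h1.tendsto_symbolPhi_div h.hσ h.hσ0 hσ hs hl
    have a2 := h2.tendsto_symbolPhi_div h.hε h.hε0 hσ hs hl
    -- multiply numerator and denominator by the inverse of the common phase
    have b : ∀ {Q : ℂ → ℂ}, Tendsto (fun s => Q s -
        Complex.exp ((σ * γ₁ * s.arg : ℝ) * Complex.I)) l (𝓝 0) →
        Tendsto (fun s => Q s * Complex.exp ((-(σ * γ₁ * s.arg) : ℝ) * Complex.I)) l (𝓝 1) := by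
      intro Q hQ
      rw [tendsto_iff_norm_sub_tendsto_zero]
      refine (hQ.norm.congr fun s => ?_).trans (by rw [norm_zero])
      have e : Q s * Complex.exp ((-(σ * γ₁ * s.arg) : ℝ) * Complex.I) - 1 =
          (Q s - Complex.exp ((σ * γ₁ * s.arg : ℝ) * Complex.I)) *
          Complex.exp ((-(σ * γ₁ * s.arg) : ℝ) * Complex.I) := by
        rw [sub_mul, ← Complex.exp_add]
        simp
      rw [e, norm_mul, Complex.norm_exp_ofReal_mul_I, mul_one]
    have c := (b a1).div (b a2) one_ne_zero
    have d := hlim'.mul c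
    rw [div_one, mul_one] at d
    refine d.congr' ?_
    filter_upwards [hs] with s hs
    rw [h.symbolRatio_div_eq hs]
    simp only [Function.comp, Pi.div_apply]
    rw [mul_div_mul_right _ _ (Complex.exp_ne_zero _)]

lemma tendsto_symbolRatio_cobounded (h : Admissible μσ με) {σ : ℝ} (hσ : |σ| = 1) {l : Filter ℂ}
    (hs : ∀ᶠ s in l, s ≠ 0) (hl : Tendsto (fun s : ℂ => σ * Real.log ‖s‖) l atTop)
    (hlim : Tendsto (fun s : ℂ => ratioR μσ με ‖s‖) l atTop) :
    Tendsto (symbolRatio μσ με) l (Bornology.cobounded ℂ) := by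
  rw [← tendsto_norm_atTop_iff_cobounded]
  refine (hlim.atTop_mul_pos one_pos (h.tendsto_norm_ratio hσ hs hl)).congr' ?_
  filter_upwards [hs] with s hs
  rw [h.symbolRatio_div_eq hs, norm_mul, Complex.norm_real,
    Real.norm_of_nonneg (h.ratioR_pos (norm_pos_iff.2 hs)).le]

/-- The limit of the ratio at infinity. -/
lemma exists_limit_atTop (h : Admissible μσ με) : ∃ τ : ℝ, 0 ≤ τ ∧
    Tendsto (ratioR μσ με) atTop (𝓝 τ) ∧
    Tendsto (symbolRatio μσ με) (Bornology.cobounded ℂ) (𝓝 (τ : ℂ)) := by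
  have hanti : Antitone fun r : ℝ => ratioR μσ με (max r 1) := fun a b hab =>
    h.ratioR_anti (by positivity) (max_le_max_right 1 hab)
  have hbdd : BddBelow (range fun r : ℝ => ratioR μσ με (max r 1)) :=
    ⟨0, by rintro _ ⟨r, rfl⟩; exact (h.ratioR_pos (by positivity)).le⟩
  have hlim := tendsto_atTop_ciInf hanti hbdd
  set τ := ⨅ r : ℝ, ratioR μσ με (max r 1)
  have hlim' : Tendsto (ratioR μσ με) atTop (𝓝 τ) := by
    refine hlim.congr' ?_
    filter_upwards [eventually_ge_atTop 1] with r hr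
    rw [max_eq_left hr]
  have hτ : 0 ≤ τ := le_ciInf fun r => (h.ratioR_pos (by positivity)).le
  refine ⟨τ, hτ, hlim', ?_⟩
  have hnorm := tendsto_norm_cobounded_atTop (E := ℂ)
  refine h.tendsto_symbolRatio (σ := 1) (by simp) ?_ ?_ hτ (hlim'.comp hnorm)
  · filter_upwards [hnorm.eventually_gt_atTop 0] with s hs using norm_pos_iff.1 hs
  · simp_rw [one_mul]
    exact Real.tendsto_log_atTop.comp hnorm

/-- The limit of the ratio at the origin. -/
lemma exists_limit_zero (h : Admissible μσ με) : ∃ ρ : ℝ≥0∞, 0 < ρ ∧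
    (ρ ≠ ⊤ → Tendsto (ratioR μσ με) (𝓝[>] 0) (𝓝 ρ.toReal)) ∧
    TendstoExtended (symbolRatio μσ με) (𝓝[≠] 0) ρ := by
  have hnorm : Tendsto (fun s : ℂ => ‖s‖) (𝓝[≠] 0) (𝓝[>] 0) := tendsto_norm_nhdsNE_zero
  have hs : ∀ᶠ s : ℂ in 𝓝[≠] 0, s ≠ 0 := eventually_mem_nhdsWithin
  have hl : Tendsto (fun s : ℂ => (-1) * Real.log ‖s‖) (𝓝[≠] 0) atTop := by
    simp_rw [neg_one_mul]
    exact tendsto_neg_atBot_atTop.comp (Real.tendsto_log_nhdsGT_zero.comp hnorm)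
  have hmono : Monotone fun u : ℝ => ratioR μσ με (Real.exp (-u)) := fun a b hab =>
    h.ratioR_anti (Real.exp_pos _) (Real.exp_le_exp.2 (neg_le_neg hab))
  have hexp : Tendsto (fun r : ℝ => -Real.log r) (𝓝[>] 0) atTop :=
    tendsto_neg_atBot_atTop.comp Real.tendsto_log_nhdsGT_zero
  have hcongr : (fun r : ℝ => ratioR μσ με (Real.exp (-(-Real.log r)))) =ᶠ[𝓝[>] 0]
      ratioR μσ με := by
    filter_upwards [self_mem_nhdsWithin] with r hr
    rw [neg_neg, Real.exp_log hr]
  rcases tendsto_atTop_of_monotone hmono with htop | ⟨ρ, hρ⟩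
  · refine ⟨⊤, by simp, fun h => absurd rfl h, fun h => absurd rfl h, fun _ => ?_⟩
    exact h.tendsto_symbolRatio_cobounded (σ := -1) (by simp) hs hl
      (((htop.comp hexp).congr' hcongr).comp hnorm)
  · have hpos : 0 < ρ := lt_of_lt_of_le (h.ratioR_pos (Real.exp_pos (-0)))
      (hmono.ge_of_tendsto hρ 0)
    have hlim := (hρ.comp hexp).congr' hcongr
    refine ⟨ENNReal.ofReal ρ, by simpa using hpos, fun _ => ?_, fun _ => ?_, fun h => ?_⟩
    · rwa [ENNReal.toReal_ofReal hpos.le]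
    · rw [ENNReal.toReal_ofReal hpos.le]
      exact h.tendsto_symbolRatio (σ := -1) (by simp) hs hl hpos.le (hlim.comp hnorm)
    · exact absurd h ENNReal.ofReal_ne_top

end Admissible

/-! ### Mass of the gap measure near the top exponent -/

namespace Admissible

variable {μσ με : Measure ℝ} [IsFiniteMeasure μσ] [IsFiniteMeasure με]

/-- If the gap measure has no mass on `{α > a, β ≥ κ}`, then `μσ` and `με` are proportional on
`[κ, ∞)`. -/
lemma proportional_of_gap_eq_zero (h : Admissible μσ με) {a κ : ℝ} (hκ : κ ≤ a)
    (hgap : thermoGap μσ με {p | a < p.1 ∧ κ ≤ p.2} = 0) {B : Set ℝ} (hB : MeasurableSet B)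
    (hBκ : B ⊆ Ici κ) : με.real (Ioi a) * μσ.real B = μσ.real (Ioi a) * με.real B := by
  set u : ℝ → ℝ := indicator (Ioi a) 1 with hu
  set v : ℝ → ℝ := indicator B 1 with hv
  have hum : Measurable u := measurable_one.indicator measurableSet_Ioi
  have hvm : Measurable v := measurable_one.indicator hB
  have iu : ∀ (μ : Measure ℝ) [IsFiniteMeasure μ], Integrable u μ := fun μ _ =>
    (integrable_const (1 : ℝ)).indicator measurableSet_Ioi
  have iv : ∀ (μ : Measure ℝ) [IsFiniteMeasure μ], Integrable v μ := fun μ _ =>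
    (integrable_const (1 : ℝ)).indicator hB
  have eu : ∀ (μ : Measure ℝ) [IsFiniteMeasure μ], ∫ x, u x ∂μ = μ.real (Ioi a) := fun μ _ => by
    simp [hu, integral_indicator_one measurableSet_Ioi]
  have ev : ∀ (μ : Measure ℝ) [IsFiniteMeasure μ], ∫ x, v x ∂μ = μ.real B := fun μ _ => by
    simp [hv, integral_indicator_one hB]
  have key := integral_antisymm_of_integrable h.hσ h.hε h.hT
    (g := fun p => u p.1 * v p.2 - v p.1 * u p.2)
    (((hum.comp measurable_fst).mul (hvm.comp measurable_snd)).sub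
      ((hvm.comp measurable_fst).mul (hum.comp measurable_snd))).stronglyMeasurable
    (((iu _).mul_prod (iv _)).sub ((iv _).mul_prod (iu _)))
    (((iu _).mul_prod (iv _)).sub ((iv _).mul_prod (iu _)))
    (fun p => by simp only [Prod.fst_swap, Prod.snd_swap]; ring)
  have h0 : ∫ p, (u p.1 * v p.2 - v p.1 * u p.2) ∂(thermoGap μσ με) = 0 := by
    refine integral_eq_zero_of_ae ?_
    have h1 : ∀ᵐ p ∂(thermoGap μσ με), ¬(a < p.1 ∧ κ ≤ p.2) := by
      rw [ae_iff]
      simpa using hgap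
    filter_upwards [h1, thermoGap_ae_mem (μσ := μσ) (με := με)] with p hp hpt
    have hlt := hpt.2.2
    have e1 : u p.1 * v p.2 = 0 := by
      by_cases c1 : p.1 ∈ Ioi a
      · by_cases c2 : p.2 ∈ B
        · exact absurd ⟨c1, hBκ c2⟩ hp
        · simp [hv, c2]
      · simp [hu, indicator_of_notMem c1]
    have e2 : v p.1 * u p.2 = 0 := by
      by_cases c1 : p.2 ∈ Ioi a
      · exact absurd ⟨(show a < p.2 from c1).trans hlt, hκ.trans (show a < p.2 from c1).le⟩ hp
      · simp [hu, indicator_of_notMem c1]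
    simp [e1, e2]
  rw [h0, integral_sub ((iu _).mul_prod (iv _)) ((iv _).mul_prod (iu _)), integral_prod_mul,
    integral_prod_mul, eu, eu, ev, ev] at key
  linarith

lemma real_Ioi_pos {μ : Measure ℝ} [IsFiniteMeasure μ] {γ a : ℝ} (h : IsTopExponent μ 1 γ)
    (ha : a < γ) : 0 < μ.real (Ioi a) := by
  have := h.pos a ha
  simp only [one_mul] at this
  exact ENNReal.toReal_pos this.ne' (measure_ne_top _ _)

lemma restrict_eq_smul_of_real {μ ν : Measure ℝ} [IsFiniteMeasure μ] [IsFiniteMeasure ν] {c : ℝ≥0}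
    {E : Set ℝ} (hE : MeasurableSet E)
    (h : ∀ B, MeasurableSet B → B ⊆ E → μ.real B = c * ν.real B) :
    μ.restrict E = (c • ν).restrict E := by
  ext B hB
  rw [Measure.restrict_apply hB, Measure.restrict_apply hB, Measure.smul_apply,
    ENNReal.smul_def, smul_eq_mul]
  have := h (B ∩ E) (hB.inter hE) inter_subset_right
  rw [← ENNReal.toReal_eq_toReal_iff' (measure_ne_top _ _)
    (ENNReal.mul_ne_top ENNReal.coe_ne_top (measure_ne_top _ _)), ENNReal.toReal_mul]
  exact this

/-- If the measures are not proportional, the gap measure charges every strip `α > a` below the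
top exponent. -/
lemma gap_pos_of_not_proportional (h : Admissible μσ με) (hprop : ¬ ∃ c : ℝ≥0, μσ = c • με)
    {γ a : ℝ} (hγ : IsTopExponent με 1 γ) (ha : a < γ) (ha0 : -1 ≤ a) :
    thermoGap μσ με {p | a < p.1 ∧ 0 ≤ p.2} ≠ 0 := by
  intro hgap
  have hgap' : thermoGap μσ με {p | a < p.1 ∧ -1 ≤ p.2} = 0 := by
    rw [← hgap]
    refine measure_congr ?_
    filter_upwards [thermoGap_ae_mem (μσ := μσ) (με := με)] with p hp
    exact propext ⟨fun hh => ⟨hh.1, hp.2.1.1⟩, fun hh => ⟨hh.1, by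
      have := hp.2.1.1
      show (-1 : ℝ) ≤ p.2
      linarith⟩⟩
  have hI := real_Ioi_pos hγ ha
  refine hprop ⟨Real.toNNReal (μσ.real (Ioi a) / με.real (Ioi a)), ?_⟩
  have key : μσ.restrict (Ici (-1)) = _ := restrict_eq_smul_of_real (μ := μσ) (ν := με)
    (c := Real.toNNReal (μσ.real (Ioi a) / με.real (Ioi a)))
    measurableSet_Ici fun B hB hB1 => by
      have := h.proportional_of_gap_eq_zero ha0 hgap' hB hB1
      rw [Real.coe_toNNReal _ (by positivity)]
      field_simp
      linarith
  rw [Measure.restrict_smul] at key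
  have r : ∀ {μ : Measure ℝ}, μ (Icc 0 1)ᶜ = 0 → μ.restrict (Ici (-1)) = μ := fun hμ =>
    Measure.restrict_eq_self_of_ae_mem (by
      filter_upwards [ae_mem_unit hμ] with α hα
      have := hα.1
      show (-1 : ℝ) ≤ α
      linarith)
  rwa [r h.hσ, r h.hε] at key

/-- If the common top exponent is `1` and the pair is neither proportional nor exceptional, the
gap measure charges some corner strip `{α > 1 - η, β ≥ 3η}`. -/
lemma gap_pos_of_not_exceptional (h : Admissible μσ με) (hprop : ¬ ∃ c : ℝ≥0, μσ = c • με)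
    (hexc : ¬ IsExceptional μσ με) (h1 : IsTopExponent μσ 1 1) (h2 : IsTopExponent με 1 1) :
    ∃ η > 0, thermoGap μσ με {p | 1 - η < p.1 ∧ 3 * η ≤ p.2} ≠ 0 := by
  by_contra! hgap
  have hσI : 0 < μσ.real (Ioi (1 - 1 / 4)) := real_Ioi_pos h1 (by norm_num)
  have hεI : 0 < με.real (Ioi (1 - 1 / 4)) := real_Ioi_pos h2 (by norm_num)
  set c : ℝ≥0 := Real.toNNReal (μσ.real (Ioi (1 - 1 / 4)) / με.real (Ioi (1 - 1 / 4))) with hc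
  have hc0 : 0 < c := by
    rw [hc, Real.toNNReal_pos]
    exact div_pos hσI hεI
  have hη : ∀ η : ℝ, 0 < η → η ≤ 1 / 4 →
      μσ.restrict (Ici (3 * η)) = (c • με).restrict (Ici (3 * η)) := by
    intro η hη hη4
    have hp : 0 < με.real (Ioi (1 - η)) := real_Ioi_pos h2 (by linarith)
    refine restrict_eq_smul_of_real measurableSet_Ici fun B hB hBη => ?_
    have a1 := h.proportional_of_gap_eq_zero (by linarith) (hgap η hη) hB hBη
    have a2 := h.proportional_of_gap_eq_zero (by linarith) (hgap η hη)
      (measurableSet_Ioi (a := (1 - 1 / 4 : ℝ))) (fun x hx => by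
        have : 1 - 1 / 4 < x := hx
        show 3 * η ≤ x
        linarith)
    rw [hc, Real.coe_toNNReal _ (by positivity), div_mul_eq_mul_div, eq_div_iff hεI.ne']
    refine mul_left_cancel₀ hp.ne' ?_
    linear_combination με.real (Ioi (1 - 1 / 4)) * a1 - με.real B * a2
  have hUnion : (⋃ n : ℕ, Ici (3 * (1 / (4 * ((n : ℝ) + 1))))) = Ioi 0 := by
    ext x
    simp only [mem_iUnion, mem_Ici, mem_Ioi]
    constructor
    · rintro ⟨n, hn⟩
      refine lt_of_lt_of_le (by positivity) hn
    · intro hx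
      obtain ⟨n, hn⟩ := exists_nat_one_div_lt hx
      refine ⟨n, le_trans ?_ hn.le⟩
      have : (0 : ℝ) < (n : ℝ) + 1 := by positivity
      rw [← mul_div_assoc, div_le_div_iff₀ (by positivity) this]
      linarith
  have hpos : μσ.restrict (Ioi 0) = c • με.restrict (Ioi 0) := by
    rw [← Measure.restrict_smul, ← hUnion, Measure.restrict_iUnion_congr]
    intro n
    refine hη _ (by positivity) ?_
    rw [div_le_div_iff₀ (by positivity) (by norm_num)]
    have : (0 : ℝ) ≤ n := n.cast_nonneg
    linarith
  have hdec : ∀ (μ : Measure ℝ) [IsFiniteMeasure μ], μ (Icc 0 1)ᶜ = 0 →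
      μ = (μ {0}).toNNReal • Measure.dirac 0 + μ.restrict (Ioi 0) := by
    intro μ _ hμ
    have e : μ.restrict (Ioi 0)ᶜ = μ.restrict {0} := by
      refine Measure.restrict_congr_set ?_
      filter_upwards [ae_mem_unit hμ] with α hα
      refine propext ⟨fun hh => le_antisymm (not_lt.1 hh) hα.1, fun hh hh' => ?_⟩
      have e1 : α = 0 := hh
      have e2 : 0 < α := hh'
      exact e2.ne' e1
    conv_lhs => rw [← Measure.restrict_compl_add_restrict (μ := μ) (s := Ioi 0) measurableSet_Ioi,
      e, Measure.restrict_singleton]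
    congr 1
    rw [← ENNReal.coe_toNNReal (measure_ne_top μ {0})]
    rfl
  -- `μσ = c με` off the origin, so the pair has the exceptional form with `l = με` on `(0, ∞)`
  set a := (μσ {0}).toNNReal with ha
  set b := (με {0}).toNNReal with hb
  set ℓ := με.restrict (Ioi 0) with hℓ
  have hσd : μσ = a • Measure.dirac 0 + c • ℓ := by rw [← hpos]; exact hdec μσ h.hσ
  have hεd : με = b • Measure.dirac 0 + ℓ := hdec με h.hε
  have hcb : c * b ≤ a := by
    have hT := h.hT (Ioc 0 1 ×ˢ {0})
    have hsub : Ioc (0 : ℝ) 1 ×ˢ ({0} : Set ℝ) ⊆ triangleDelta := by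
      rintro ⟨x, y⟩ ⟨hx, hy⟩
      have hy' : y = 0 := hy
      subst hy'
      exact ⟨⟨hx.1.le, hx.2⟩, ⟨le_rfl, zero_le_one⟩, hx.1⟩
    rw [Measure.restrict_eq_self _ hsub, Measure.restrict_eq_self _ hsub, Measure.prod_prod,
      Measure.prod_prod] at hT
    have e1 : μσ (Ioc 0 1) = c * με (Ioc 0 1) := by
      have := congrArg (fun m : Measure ℝ => m (Ioc 0 1)) hpos
      simp only [Measure.smul_apply] at this
      rw [Measure.restrict_eq_self _ Ioc_subset_Ioi_self, hℓ,
        Measure.restrict_eq_self _ Ioc_subset_Ioi_self] at this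
      exact this
    have e2 : με (Ioc 0 1) ≠ 0 := by
      have h3 := h2.pos 0 one_pos
      simp only [one_mul] at h3
      have h4 : με (Ioc 0 1) = με (Ioi 0) := by
        refine measure_congr ?_
        filter_upwards [ae_mem_unit h.hε] with α hα
        exact propext ⟨fun hh => hh.1, fun hh => ⟨hh, hα.2⟩⟩
      rw [h4]
      exact h3.ne'
    rw [e1, mul_comm (c : ℝ≥0∞), mul_assoc, ENNReal.mul_le_mul_iff_right e2
      (measure_ne_top _ _), ← ENNReal.coe_toNNReal (measure_ne_top μσ {0}),
      ← ENNReal.coe_toNNReal (measure_ne_top με {0})] at hT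
    exact_mod_cast hT
  have ha0 : 0 < a := by
    rcases eq_or_ne a 0 with h0 | h0
    · have hb0 : b = 0 := by
        rw [h0] at hcb
        exact (mul_eq_zero.1 (le_antisymm hcb bot_le)).resolve_left hc0.ne'
      refine absurd ⟨c, ?_⟩ hprop
      rw [hσd, h0]
      conv_rhs => rw [hεd, hb0]
      simp
    · exact pos_iff_ne_zero.2 h0
  have hℓfin : IsFiniteMeasure ℓ := by rw [hℓ]; infer_instance
  have hℓ1 : ℓ (Icc 0 1)ᶜ = 0 :=
    nonpos_iff_eq_zero.1 ((Measure.restrict_apply_le _ _).trans h.hε.le)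
  refine hexc ⟨c, a, b, ℓ, hc0, ha0, hcb, hℓfin, hℓ1, ?_, ⟨?_, ?_⟩, hσd, hεd⟩
  · rw [hℓ, Measure.restrict_apply (measurableSet_singleton 0)]
    simp
  · rw [Measure.mem_support_iff_forall]
    intro U hU
    obtain ⟨δ, hδ, hball⟩ := Metric.mem_nhds_iff.1 hU
    have h3 := h2.pos (max (1 - δ) 0) (max_lt (by linarith) one_pos)
    simp only [one_mul] at h3
    refine lt_of_lt_of_le h3 ?_
    rw [hℓ]
    refine le_trans ?_ (Measure.le_restrict_apply _ _)
    have hae : ∀ᵐ α ∂με, α ∈ {α | max (1 - δ) 0 < α} → α ∈ U ∩ Ioi 0 := by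
      filter_upwards [ae_mem_unit h.hε] with α hα hm
      have hm' : max (1 - δ) 0 < α := hm
      have m1 := (le_max_left (1 - δ) 0).trans_lt hm'
      have m2 := (le_max_right (1 - δ) 0).trans_lt hm'
      refine ⟨hball ?_, m2⟩
      rw [Metric.mem_ball, Real.dist_eq, abs_sub_lt_iff]
      constructor <;> linarith [hα.2]
    exact measure_mono_ae hae
  · intro x hx
    exact (Measure.support_subset_of_isClosed isClosed_Icc
      (show Icc 0 1 ∈ ae ℓ from hℓ1) hx).2

/-- With equal top exponents `γ`, the gap measure has mass at exponents `(α, β)` with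
`α + β > 2γ - 1`. This is where the exceptional pairs are excluded. -/
lemma exists_gap_pos (h : Admissible μσ με) (hprop : ¬ ∃ c : ℝ≥0, μσ = c • με)
    (hexc : ¬ IsExceptional μσ με) {γ : ℝ} (h1 : IsTopExponent μσ 1 γ)
    (h2 : IsTopExponent με 1 γ) : ∃ a κ : ℝ, 2 * γ - 1 < a + κ ∧
      thermoGap μσ με {p | a < p.1 ∧ κ ≤ p.2} ≠ 0 := by
  have hγ1 : γ ≤ 1 := by
    by_contra! hc
    have := h2.pos 1 hc
    simp only [one_mul] at this
    refine this.ne' (measure_mono_null (fun x hx => ?_) h.hε)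
    exact fun hh => absurd hh.2 (not_le.2 hx)
  have hγ0 : 0 ≤ γ := by
    by_contra! hc
    have : NeZero με := ⟨h.hε0⟩
    obtain ⟨α, hα, hα'⟩ := ((ae_mem_unit h.hε).and h2.le).exists
    linarith [hα.1]
  rcases hγ1.eq_or_lt with heq | hlt
  · subst heq
    obtain ⟨η, hη, hg⟩ := h.gap_pos_of_not_exceptional hprop hexc h1 h2
    exact ⟨1 - η, 3 * η, by linarith, hg⟩
  · -- for `γ < 1` a strip close to the top exponent is enough, whatever the second exponent
    exact ⟨γ - (1 - γ) / 2, 0, by linarith,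
      h.gap_pos_of_not_proportional hprop h2 (by linarith) (by linarith)⟩

end Admissible

/-! ### Growth of the real part of `s Ψ(s)` -/

namespace Admissible

variable {μσ με : Measure ℝ} [IsFiniteMeasure μσ] [IsFiniteMeasure με]

/-- The quantity `r N(r) / (Φε √(Φσ Φε))`, `N` the gap moment, which bounds `re (s Ψ(s))` from
below near the imaginary axis. -/
noncomputable def gapGrowth (μσ με : Measure ℝ) (r : ℝ) : ℝ :=
  r * gapMoment μσ με r / (phiR με r * √(phiR μσ r * phiR με r))

lemma le_gapMoment (h : Admissible μσ με) {a κ : ℝ}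
    (hg : thermoGap μσ με {p | a < p.1 ∧ κ ≤ p.2} ≠ 0) :
    ∃ c > 0, ∀ r : ℝ, 1 ≤ r → c * r ^ (a + κ) ≤ gapMoment μσ με r := by
  set E : Set (ℝ × ℝ) := {p | a < p.1 ∧ κ ≤ p.2} with hE
  have hEm : MeasurableSet E :=
    (measurableSet_lt measurable_const measurable_fst).inter
      (measurableSet_le measurable_const measurable_snd)
  have hi : Integrable (fun p : ℝ × ℝ => p.1 - p.2) (thermoGap μσ με) :=
    integrable_thermoGap h.hσ h.hε (by fun_prop)
  refine ⟨∫ p in E, (p.1 - p.2) ∂(thermoGap μσ με), ?_, fun r hr => ?_⟩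
  · show 0 < _
    rw [setIntegral_pos_iff_support_of_nonneg_ae _ hi.integrableOn]
    · refine lt_of_lt_of_le (pos_iff_ne_zero.2 hg) (measure_mono_ae ?_)
      filter_upwards [thermoGap_ae_mem (μσ := μσ) (με := με)] with p hp hpE
      exact ⟨(sub_pos.2 hp.2.2).ne', hpE⟩
    · refine ae_restrict_of_ae ?_
      filter_upwards [thermoGap_ae_mem (μσ := μσ) (με := με)] with p hp
      exact (sub_pos.2 hp.2.2).le
  · have hr0 : 0 < r := one_pos.trans_le hr
    have hj : Integrable (fun p : ℝ × ℝ => r ^ p.1 * r ^ p.2 * (p.1 - p.2)) (thermoGap μσ με) := by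
      refine integrable_thermoGap h.hσ h.hε ?_
      have := continuous_rpow_prod hr0 hr0
      fun_prop
    rw [mul_comm, ← integral_const_mul]
    refine le_trans (setIntegral_mono_on_ae (hi.const_mul _).integrableOn hj.integrableOn hEm ?_)
      (setIntegral_le_integral hj ?_)
    · filter_upwards [thermoGap_ae_mem (μσ := μσ) (με := με)] with p hp hpE
      have h1 := (sub_pos.2 hp.2.2).le
      rw [← Real.rpow_add hr0]
      have h2 : a + κ ≤ p.1 + p.2 := add_le_add hpE.1.le hpE.2
      gcongr
    · filter_upwards [thermoGap_ae_mem (μσ := μσ) (με := με)] with p hp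
      have h1 := (sub_pos.2 hp.2.2).le
      simp only [Pi.zero_apply]
      positivity

lemma gapMoment_div_eq (h : Admissible μσ με) {r γ₁ γ₂ : ℝ} (hr : 0 < r) :
    gapMoment μσ με r / (phiR μσ r * phiR με r) = (γ₂ - γ₁) +
      (∫ α, r ^ α * (γ₁ - 1 * α) ∂μσ) / phiR μσ r -
      (∫ α, r ^ α * (γ₂ - 1 * α) ∂με) / phiR με r := by
  have hc := continuous_rpow_exponent hr
  have p1 := (phiR_pos h.hσ h.hσ0 hr).ne'
  have p2 := (phiR_pos h.hε h.hε0 hr).ne'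
  have e : ∀ (μ : Measure ℝ) [IsFiniteMeasure μ], μ (Icc 0 1)ᶜ = 0 → ∀ γ : ℝ,
      ∫ α, r ^ α * (γ - 1 * α) ∂μ = γ * phiR μ r - ∫ α, r ^ α * α ∂μ := by
    intro μ _ hμ γ
    have e1 : ∀ α : ℝ, r ^ α * (γ - 1 * α) = γ * r ^ α - r ^ α * α := fun α => by ring
    simp_rw [e1]
    rw [integral_sub (integrable_of_continuous hμ (by fun_prop))
      (integrable_of_continuous hμ (by fun_prop)), integral_const_mul, phiR]
  rw [gapMoment_eq h.hσ h.hε h.hT hr, e μσ h.hσ, e με h.hε]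
  field_simp
  ring

/-- If the top exponents differ, `√r` is a lower bound up to a constant; if they
agree, the mass of the gap measure near the top decides. -/
lemma exists_le_gapGrowth (h : Admissible μσ με) (hprop : ¬ ∃ c : ℝ≥0, μσ = c • με)
    (hexc : ¬ IsExceptional μσ με) : ∃ c > 0, ∃ p : ℝ, 0 < p ∧ ∀ᶠ r in (atTop : Filter ℝ),
      c * r ^ p ≤ gapGrowth μσ με r := by
  obtain ⟨γ₁, h1⟩ := exists_isTopExponent h.hσ h.hσ0 (σ := 1) (by simp)
  obtain ⟨γ₂, h2⟩ := exists_isTopExponent h.hε h.hε0 (σ := 1) (by simp)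
  have hr : ∀ᶠ r : ℝ in atTop, 0 < r := eventually_gt_atTop 0
  have hl : Tendsto (fun r : ℝ => 1 * Real.log r) atTop atTop := by
    simp_rw [one_mul]; exact Real.tendsto_log_atTop
  rcases lt_trichotomy γ₁ γ₂ with hlt | heq | hgt
  · have t1 := h1.tendsto_tilt h.hσ h.hσ0 (by simp) hr hl
    have t2 := h2.tendsto_tilt h.hε h.hε0 (by simp) hr hl
    have t3 := (t1.const_add (γ₂ - γ₁)).sub t2
    rw [add_zero, sub_zero] at t3
    have hR := h.ratioR_pos one_pos
    refine ⟨(γ₂ - γ₁) / 2 * √(ratioR μσ με 1), mul_pos (by linarith) (Real.sqrt_pos.2 hR),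
      1 / 2, by norm_num, ?_⟩
    filter_upwards [eventually_ge_atTop 1,
      t3.eventually (lt_mem_nhds (show (γ₂ - γ₁) / 2 < γ₂ - γ₁ by linarith))] with r hr1 hq
    have hr0 : 0 < r := one_pos.trans_le hr1
    have p1 := phiR_pos h.hσ h.hσ0 hr0
    have p2 := phiR_pos h.hε h.hε0 hr0
    rw [← h.gapMoment_div_eq hr0] at hq
    have hs : √(phiR μσ r * phiR με r) ^ 2 = phiR μσ r * phiR με r :=
      Real.sq_sqrt (by positivity)
    have hs0 : 0 < √(phiR μσ r * phiR με r) := Real.sqrt_pos.2 (by positivity)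
    have hR' : √(ratioR μσ με r) = phiR μσ r / √(phiR μσ r * phiR με r) := by
      rw [Real.sqrt_eq_iff_eq_sq (h.ratioR_pos hr0).le (by positivity), div_pow, hs, ratioR]
      field_simp
    have e : gapGrowth μσ με r =
        gapMoment μσ με r / (phiR μσ r * phiR με r) * (r * √(ratioR μσ με r)) := by
      rw [hR', gapGrowth]
      field_simp
    have m := h.mul_ratioR_mono one_pos hr1
    rw [one_mul] at m
    have e2 : r * √(ratioR μσ με r) = √r * √(r * ratioR μσ με r) := by
      rw [Real.sqrt_mul hr0.le, ← mul_assoc, Real.mul_self_sqrt hr0.le]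
    rw [e, e2, ← Real.sqrt_eq_rpow, mul_assoc, mul_comm (√(ratioR μσ με 1))]
    have : 0 ≤ (γ₂ - γ₁) / 2 := by linarith
    gcongr
    exact this.trans hq.le
  · subst heq
    obtain ⟨a, κ, hak, hg⟩ := h.exists_gap_pos hprop hexc h1 h2
    obtain ⟨c, hc, hN⟩ := h.le_gapMoment hg
    have : NeZero μσ := ⟨h.hσ0⟩
    have : NeZero με := ⟨h.hε0⟩
    have m1 : 0 < μσ.real univ := by simp [Measure.real, ENNReal.toReal_pos_iff, NeZero.pos]
    have m2 : 0 < με.real univ := by simp [Measure.real, ENNReal.toReal_pos_iff, NeZero.pos]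
    set C := με.real univ * √(μσ.real univ * με.real univ) with hC
    have hC0 : 0 < C := by positivity
    refine ⟨c / C, by positivity, 1 + (a + κ) - 2 * γ₁, by linarith, ?_⟩
    filter_upwards [eventually_ge_atTop 1] with r hr1
    have hr0 : 0 < r := one_pos.trans_le hr1
    have p1 := phiR_pos h.hσ h.hσ0 hr0
    have p2 := phiR_pos h.hε h.hε0 hr0
    have hlog : 0 ≤ 1 * Real.log r := by rw [one_mul]; exact Real.log_nonneg hr1
    have u1 := h1.phiR_le h.hσ (by simp) hr0 hlog
    have u2 := h2.phiR_le h.hε (by simp) hr0 hlog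
    have eg : Real.exp (γ₁ * (1 * Real.log r)) = r ^ γ₁ := by
      rw [Real.rpow_def_of_pos hr0]; ring_nf
    rw [eg] at u1 u2
    have q := Real.rpow_pos_of_pos hr0 γ₁
    have hD : phiR με r * √(phiR μσ r * phiR με r) ≤ C * r ^ (2 * γ₁) := by
      calc phiR με r * √(phiR μσ r * phiR με r)
          ≤ (με.real univ * r ^ γ₁) *
            √((μσ.real univ * r ^ γ₁) * (με.real univ * r ^ γ₁)) := by gcongr
        _ = C * r ^ (2 * γ₁) := by
          rw [show (μσ.real univ * r ^ γ₁) * (με.real univ * r ^ γ₁) =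
            (μσ.real univ * με.real univ) * (r ^ γ₁ * r ^ γ₁) by ring,
            Real.sqrt_mul (by positivity), Real.sqrt_mul_self q.le, two_mul, Real.rpow_add hr0]
          ring
    have hD0 : 0 < phiR με r * √(phiR μσ r * phiR με r) := by positivity
    rw [gapGrowth, le_div_iff₀ hD0]
    calc c / C * r ^ (1 + (a + κ) - 2 * γ₁) * (phiR με r * √(phiR μσ r * phiR με r))
        ≤ c / C * r ^ (1 + (a + κ) - 2 * γ₁) * (C * r ^ (2 * γ₁)) := by gcongr
      _ = c * (r ^ (1 + (a + κ) - 2 * γ₁) * r ^ (2 * γ₁)) := by field_simp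
      _ = r * (c * r ^ (a + κ)) := by
        rw [← Real.rpow_add hr0, show 1 + (a + κ) - 2 * γ₁ + 2 * γ₁ = 1 + (a + κ) by ring,
          Real.rpow_add hr0, Real.rpow_one]
        ring
      _ ≤ r * gapMoment μσ με r := by gcongr; exact hN r hr1
  · exfalso
    have t := tendsto_ratio_zero h.hε h.hε0 h.hσ (by simp) h2 h1 hgt hr hl
    have hR := h.ratioR_pos one_pos
    obtain ⟨r, hr1, hlt⟩ := ((eventually_ge_atTop 1).and
      (t.eventually (gt_mem_nhds (inv_pos.2 hR)))).exists
    have m := h.ratioR_anti one_pos hr1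
    have hr0 : 0 < r := one_pos.trans_le hr1
    have := inv_anti₀ (h.ratioR_pos hr0) m
    rw [show (ratioR μσ με r)⁻¹ = phiR με r / phiR μσ r by rw [ratioR, inv_div]] at this
    exact absurd hlt (not_lt.2 this)

/-- In the sector `re s ≤ |im s|` the real part of `s Ψ(s)` is controlled by
`|im s| |im Ψ(s)|`, hence by `im R(s)` and the gap measure. -/
lemma gapGrowth_le_re (h : Admissible μσ με) {s : ℂ} (hs : 0 < s.re) (him : s.re ≤ |s.im|) :
    gapGrowth μσ με ‖s‖ / 16 ≤ (s * symbolPsi μσ με s).re := by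
  have hsl : s ∈ Complex.slitPlane := Complex.mem_slitPlane_iff.2 (Or.inl hs)
  have hs0 := Complex.slitPlane_ne_zero hsl
  have hn := norm_pos_iff.2 hs0
  have p1 := phiR_pos h.hσ h.hσ0 hn
  have p2 := phiR_pos h.hε h.hε0 hn
  have f2 := norm_pos_iff.2 (symbolPhi_ne_zero h.hε h.hε0 hsl)
  have f1 := norm_pos_iff.2 (symbolPhi_ne_zero h.hσ h.hσ0 hsl)
  have hψ := h.symbolPsi_re_pos hsl
  have hψn : 0 < ‖symbolPsi μσ με s‖ := hψ.trans_le (Complex.re_le_norm _)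
  have him2 : ‖s‖ / 2 ≤ |s.im| := by
    have := Complex.norm_le_abs_re_add_abs_im s
    rw [abs_of_pos hs] at this
    linarith
  have harg : 1 / 2 ≤ |s.arg| := by
    have h1 : |Real.sin s.arg| ≤ |s.arg| := Real.abs_sin_le_abs
    rw [Complex.sin_arg, abs_div, abs_of_pos hn] at h1
    refine le_trans ?_ h1
    rw [le_div_iff₀ hn]
    linarith
  have harg2 : |s.arg| ≤ Real.pi / 2 := Complex.abs_arg_le_pi_div_two_iff.2 hs.le
  set J := ∫ p, ‖s‖ ^ p.1 * ‖s‖ ^ p.2 * Real.sin ((p.1 - p.2) * s.arg) ∂(thermoGap μσ με) with hJ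
  set N := gapMoment μσ με ‖s‖ with hN
  have hN0 : 0 ≤ N := gapMoment_nonneg hn
  have hJN : N / 4 ≤ |J| := by
    -- both `arg s` and the integrand may be negative; work with `|arg s|`
    have e : |J| = |∫ p, ‖s‖ ^ p.1 * ‖s‖ ^ p.2 * Real.sin ((p.1 - p.2) * |s.arg|)
        ∂(thermoGap μσ με)| := by
      rcases abs_choice s.arg with hh | hh
      · rw [hh]
      · rw [hh, ← abs_neg, hJ, ← integral_neg]
        congr 2
        funext p
        rw [mul_neg, Real.sin_neg]
        ring
    rw [e]
    refine le_trans ?_ (le_abs_self _)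
    have hc := continuous_rpow_prod hn hn
    rw [hN, gapMoment, div_eq_mul_inv, mul_comm, ← integral_const_mul]
    refine integral_mono_ae ((integrable_thermoGap h.hσ h.hε (by fun_prop)))
      (integrable_thermoGap h.hσ h.hε (by fun_prop)) ?_
    filter_upwards [thermoGap_ae_mem (μσ := μσ) (με := με)] with p hp
    have d0 : 0 ≤ p.1 - p.2 := sub_nonneg.2 hp.2.2.le
    have d1 : p.1 - p.2 ≤ 1 := by linarith [hp.1.2, hp.2.1.1]
    have h1 := Real.mul_le_sin (x := (p.1 - p.2) * |s.arg|) (by positivity) (by nlinarith)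
    have h2 : 1 / 2 ≤ 2 / Real.pi := by
      rw [div_le_div_iff₀ two_pos Real.pi_pos]
      linarith [Real.pi_le_four]
    have h3 : (p.1 - p.2) / 2 ≤ (p.1 - p.2) * |s.arg| := by nlinarith
    have h4 : (p.1 - p.2) / 4 ≤ Real.sin ((p.1 - p.2) * |s.arg|) := by
      refine le_trans ?_ h1
      calc (p.1 - p.2) / 4 = 1 / 2 * ((p.1 - p.2) / 2) := by ring
        _ ≤ _ := by gcongr
    have h5 : 0 ≤ ‖s‖ ^ p.1 * ‖s‖ ^ p.2 := by positivity
    nlinarith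
  have hRim : |(symbolRatio μσ με s).im| = |J| * ‖symbolPhi με s‖⁻¹ ^ 2 := by
    rw [h.symbolRatio_im hs0, abs_mul, abs_neg, abs_of_nonneg (sq_nonneg (‖symbolPhi με s‖⁻¹))]
  have hRψ : |(symbolRatio μσ με s).im| ≤ 2 * ‖symbolPsi μσ με s‖ * |(symbolPsi μσ με s).im| := by
    rw [← symbolPsi_sq, sq, Complex.mul_im]
    have e : (symbolPsi μσ με s).re * (symbolPsi μσ με s).im +
      (symbolPsi μσ με s).im * (symbolPsi μσ με s).re =
      2 * (symbolPsi μσ με s).re * (symbolPsi μσ με s).im := by ring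
    rw [e, abs_mul, abs_mul, abs_two, abs_of_pos hψ]
    gcongr
    exact Complex.re_le_norm _
  -- `‖Φε‖² ‖Ψ‖ ≤ Φε √(Φσ Φε)` at `|s|`
  have hden : ‖symbolPhi με s‖ ^ 2 * ‖symbolPsi μσ με s‖ ≤
      phiR με ‖s‖ * √(phiR μσ ‖s‖ * phiR με ‖s‖) := by
    have e : ‖symbolPsi μσ με s‖ = √(‖symbolPhi μσ s‖ / ‖symbolPhi με s‖) := by
      rw [← norm_div, ← symbolRatio, ← norm_symbolPsi_sq, Real.sqrt_sq (norm_nonneg _)]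
    have e2 : ‖symbolPhi με s‖ ^ 2 * ‖symbolPsi μσ με s‖ =
        ‖symbolPhi με s‖ * √(‖symbolPhi μσ s‖ * ‖symbolPhi με s‖) := by
      rw [e, sq, mul_assoc]
      congr 1
      rw [eq_comm, Real.sqrt_eq_iff_eq_sq (by positivity) (by positivity), mul_pow,
        Real.sq_sqrt (by positivity)]
      field_simp
    rw [e2]
    have a1 := norm_symbolPhi_le (μ := μσ) s
    have a2 := norm_symbolPhi_le (μ := με) s
    gcongr
  have hden0 : 0 < ‖symbolPhi με s‖ ^ 2 * ‖symbolPsi μσ με s‖ := by positivity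
  have hψim : N / (8 * (phiR με ‖s‖ * √(phiR μσ ‖s‖ * phiR με ‖s‖))) ≤
      |(symbolPsi μσ με s).im| := by
    calc _ ≤ N / (8 * (‖symbolPhi με s‖ ^ 2 * ‖symbolPsi μσ με s‖)) := by gcongr
      _ ≤ _ := by
        rw [div_le_iff₀ (by positivity)]
        rw [hRim] at hRψ
        have h1 : |J| ≤ 2 * ‖symbolPsi μσ με s‖ * |(symbolPsi μσ με s).im| *
            ‖symbolPhi με s‖ ^ 2 := by
          rw [inv_pow, ← div_eq_mul_inv, div_le_iff₀ (by positivity)] at hRψ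
          exact hRψ
        nlinarith
  have hsgn := h.im_mul_symbolPsi_im_nonpos hsl
  have hre : (s * symbolPsi μσ με s).re =
      s.re * (symbolPsi μσ με s).re + |s.im| * |(symbolPsi μσ με s).im| := by
    rw [Complex.mul_re, ← abs_mul, abs_of_nonpos hsgn]
    ring
  rw [hre]
  have h1 : gapGrowth μσ με ‖s‖ / 16 =
      ‖s‖ / 2 * (N / (8 * (phiR με ‖s‖ * √(phiR μσ ‖s‖ * phiR με ‖s‖)))) := by
    rw [gapGrowth, ← hN]
    field_simp
    ring
  rw [h1]
  have h2 : ‖s‖ / 2 * (N / (8 * (phiR με ‖s‖ * √(phiR μσ ‖s‖ * phiR με ‖s‖)))) ≤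
      |s.im| * |(symbolPsi μσ με s).im| := by gcongr
  have h3 : 0 ≤ s.re * (symbolPsi μσ με s).re := by positivity
  linarith

lemma re_mul_symbolPsi_nonneg (h : Admissible μσ με) {s : ℂ} (hs : 0 < s.re) :
    0 ≤ (s * symbolPsi μσ με s).re := by
  have hsl : s ∈ Complex.slitPlane := Complex.mem_slitPlane_iff.2 (Or.inl hs)
  have h1 := h.im_mul_symbolPsi_im_nonpos hsl
  have h2 := mul_pos hs (h.symbolPsi_re_pos hsl)
  rw [Complex.mul_re]
  linarith

lemma half_le_cos_half_arg {s : ℂ} (hs : 0 < s.re) : 1 / 2 ≤ Real.cos (s.arg / 2) := by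
  have h1 : |s.arg| ≤ Real.pi / 2 := Complex.abs_arg_le_pi_div_two_iff.2 hs.le
  rw [← Real.cos_abs, ← Real.cos_pi_div_three]
  refine Real.cos_le_cos_of_nonneg_of_le_pi (abs_nonneg _) (by linarith [Real.pi_pos]) ?_
  rw [abs_div, abs_two]
  linarith [Real.pi_pos]

/-- Away from the exceptional pairs, `re (s Ψ(s))` grows at least like a power of `|s|` on the
right half-plane. -/
lemma exists_le_re_mul_symbolPsi (h : Admissible μσ με) (hprop : ¬ ∃ c : ℝ≥0, μσ = c • με)
    (hexc : ¬ IsExceptional μσ με) : ∃ c > 0, ∃ p : ℝ, 0 < p ∧ ∃ r₀ ≥ 1,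
    ∀ s : ℂ, 0 < s.re → r₀ ≤ ‖s‖ → c * ‖s‖ ^ p ≤ (s * symbolPsi μσ με s).re := by
  obtain ⟨c, hc, p, hp, hev⟩ := h.exists_le_gapGrowth hprop hexc
  obtain ⟨r₁, hr₁⟩ := eventually_atTop.1 hev
  have hR := h.ratioR_pos one_pos
  have hc2 : 0 < √(ratioR μσ με 1) / 8 := by positivity
  refine ⟨min (c / 16) (√(ratioR μσ με 1) / 8), lt_min (by positivity) hc2, min p (1 / 2),
    lt_min hp (by norm_num), max r₁ 1, le_max_right _ _, fun s hs hsr => ?_⟩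
  have hr1 : 1 ≤ ‖s‖ := (le_max_right _ _).trans hsr
  have hr0 : 0 < ‖s‖ := one_pos.trans_le hr1
  have hsl : s ∈ Complex.slitPlane := Complex.mem_slitPlane_iff.2 (Or.inl hs)
  rcases le_or_gt s.re |s.im| with him | him
  · calc _ ≤ c / 16 * ‖s‖ ^ p := by
          gcongr
          · exact min_le_left _ _
          · exact min_le_left _ _
      _ = c * ‖s‖ ^ p / 16 := by ring
      _ ≤ gapGrowth μσ με ‖s‖ / 16 := by
          have := hr₁ _ ((le_max_left _ _).trans hsr)
          gcongr
      _ ≤ _ := h.gapGrowth_le_re hs him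
  · have hre2 : ‖s‖ / 2 ≤ s.re := by
      have := Complex.norm_le_abs_re_add_abs_im s
      rw [abs_of_pos hs] at this
      linarith
    have hψ := h.symbolPsi_re_pos hsl
    have a1 := h.norm_sq_le_two_mul_re_sq (norm_pos_iff.1 hr0) hs.le
    have a2 := h.le_norm_symbolPsi_sq hsl
    have a3 := half_le_cos_half_arg hs
    have hRs := h.ratioR_pos hr0
    have a4 : √(ratioR μσ με ‖s‖) / 2 ≤ (symbolPsi μσ με s).re := by
      refine abs_le_of_sq_le_sq' ?_ hψ.le |>.2
      rw [div_pow, Real.sq_sqrt hRs.le]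
      nlinarith
    have m := h.mul_ratioR_mono one_pos hr1
    rw [one_mul] at m
    have e2 : ‖s‖ * √(ratioR μσ με ‖s‖) = √‖s‖ * √(‖s‖ * ratioR μσ με ‖s‖) := by
      rw [Real.sqrt_mul hr0.le, ← mul_assoc, Real.mul_self_sqrt hr0.le]
    have hsgn := h.im_mul_symbolPsi_im_nonpos hsl
    calc _ ≤ √(ratioR μσ με 1) / 8 * ‖s‖ ^ (1 / 2 : ℝ) := by
          exact mul_le_mul (min_le_right _ _)
            (Real.rpow_le_rpow_of_exponent_le hr1 (min_le_right _ _)) (by positivity) hc2.le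
      _ = √‖s‖ * √(ratioR μσ με 1) / 8 := by rw [← Real.sqrt_eq_rpow]; ring
      _ ≤ √‖s‖ * √(‖s‖ * ratioR μσ με ‖s‖) / 4 := by
          have := Real.sqrt_le_sqrt m
          have h3 : 0 ≤ √‖s‖ := Real.sqrt_nonneg _
          have h4 : 0 ≤ √(ratioR μσ με 1) := Real.sqrt_nonneg _
          nlinarith
      _ = ‖s‖ / 2 * (√(ratioR μσ με ‖s‖) / 2) := by rw [← e2]; ring
      _ ≤ s.re * (symbolPsi μσ με s).re := by gcongr
      _ ≤ _ := by rw [Complex.mul_re]; linarith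

end Admissible

/-! ### Complete monotonicity of `Ψ` and of the derivative of `s Ψ(s)` -/

lemma sq_mem_slitPlane {w : ℂ} (hw : 0 < w.re) : w ^ 2 ∈ Complex.slitPlane := by
  rw [Complex.mem_slitPlane_iff, sq, Complex.mul_re, Complex.mul_im]
  by_cases h : w.im = 0
  · left; rw [h]; nlinarith
  · right
    have := mul_ne_zero hw.ne' h
    intro h0
    apply this
    linarith

lemma cos_half_arg_sq {w : ℂ} (hw : 0 < w.re) : Real.cos ((w ^ 2).arg / 2) = w.re / ‖w‖ := by
  have h0 : w ≠ 0 := fun h => by simp [h] at hw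
  have hn := norm_pos_iff.2 h0
  rw [Real.cos_half (Complex.neg_pi_lt_arg _).le (Complex.arg_le_pi _),
    Complex.cos_arg (pow_ne_zero 2 h0), Real.sqrt_eq_iff_eq_sq _ (by positivity)]
  · have h1 : ‖w‖ ^ 2 = w.re * w.re + w.im * w.im := by
      rw [Complex.sq_norm, Complex.normSq_apply]
    rw [div_pow, norm_pow, sq w, Complex.mul_re]
    field_simp
    rw [h1]
    ring
  · have := (abs_le.1 ((Complex.abs_re_le_norm (w ^ 2)))).1
    have h2 : 0 < ‖w ^ 2‖ := norm_pos_iff.2 (pow_ne_zero 2 h0)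
    have h3 : -1 ≤ (w ^ 2).re / ‖w ^ 2‖ := by rw [le_div_iff₀ h2]; linarith
    linarith

lemma line_ne_zero {a : ℝ} (ha : 0 < a) (y : ℝ) : (a : ℂ) + y * Complex.I ≠ 0 := fun h => by
  have := congrArg Complex.re h
  simp at this
  exact ha.ne' this

/-- On the parabola `w²`, `re w = ε`, the point `x > ε²` is at distance at least `x - ε² + y²`. -/
lemma le_norm_sub_sq (x ε y : ℝ) :
    x - ε ^ 2 + y ^ 2 ≤ ‖(x : ℂ) - ((ε : ℂ) + y * Complex.I) ^ 2‖ := by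
  refine le_trans (le_of_eq ?_) (Complex.re_le_norm _)
  simp [sq]
  ring

namespace Admissible

variable {μσ με : Measure ℝ} [IsFiniteMeasure μσ] [IsFiniteMeasure με]

lemma ratioR_le (h : Admissible μσ με) {r : ℝ} (hr : 0 < r) :
    ratioR μσ με r ≤ ratioR μσ με 1 * (1 + r⁻¹) := by
  have hR := h.ratioR_pos one_pos
  have hri := inv_pos.2 hr
  rcases le_total r 1 with h1 | h1
  · have := h.mul_ratioR_mono hr h1
    rw [one_mul, mul_comm, ← le_div_iff₀ hr, div_eq_mul_inv] at this
    nlinarith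
  · have := h.ratioR_anti one_pos h1
    nlinarith

lemma norm_symbolPsi_sq_sq_le {μσ με : Measure ℝ} [IsFiniteMeasure με] (h : Admissible μσ με)
    {w : ℂ} (hw : 0 < w.re) :
    ‖symbolPsi μσ με (w ^ 2)‖ ^ 2 ≤ ratioR μσ με (‖w‖ ^ 2) * (‖w‖ / w.re) := by
  have h0 : w ≠ 0 := fun h => by simp [h] at hw
  have hn := norm_pos_iff.2 h0
  have h1 := h.norm_symbolPsi_sq_le (sq_mem_slitPlane hw)
  rw [cos_half_arg_sq hw, norm_pow, ← le_div_iff₀ (by positivity)] at h1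
  rwa [div_eq_mul_inv, inv_div] at h1

/-- In the variable `w = √s` the slit plane is a half-plane, on which Cauchy's formula is
available; the factor `w⁻³` provides the decay it needs. -/
lemma hDecay_symbolPsi_sq_div (h : Admissible μσ με) :
    HDecay fun w => symbolPsi μσ με (w ^ 2) / w ^ 3 := by
  constructor
  · intro w hw
    have hw' : 0 < w.re := hw
    have h0 : w ≠ 0 := fun h => by simp [h] at hw'
    have h1 : DifferentiableAt ℂ (fun w : ℂ => symbolPsi μσ με (w ^ 2)) w :=
      DifferentiableAt.comp (g := symbolPsi μσ με) w
        (h.differentiableAt_symbolPsi (sq_mem_slitPlane hw')) (differentiableAt_id.fun_pow 2)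
    exact (h1.fun_div (differentiableAt_id.fun_pow 3) (pow_ne_zero 3 h0)).differentiableWithinAt
  · intro a ha
    set C := √(ratioR μσ με (a ^ 2) / a) / √a with hC
    refine ⟨C, fun w hw => ?_⟩
    have hw0 : 0 < w.re := ha.trans_le hw
    have hwn : a ≤ ‖w‖ := hw.trans (Complex.re_le_norm _)
    have hn : 0 < ‖w‖ := ha.trans_le hwn
    have hR : 0 < ratioR μσ με (a ^ 2) := h.ratioR_pos (by positivity)
    have h1 : ‖symbolPsi μσ με (w ^ 2)‖ ≤ √(ratioR μσ με (a ^ 2) / a) * √‖w‖ := by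
      rw [← Real.sqrt_mul (by positivity)]
      refine Real.le_sqrt_of_sq_le ((h.norm_symbolPsi_sq_sq_le hw0).trans ?_)
      have h2 : ratioR μσ με (‖w‖ ^ 2) ≤ ratioR μσ με (a ^ 2) :=
        h.ratioR_anti (by positivity) (by gcongr)
      calc ratioR μσ με (‖w‖ ^ 2) * (‖w‖ / w.re) ≤ ratioR μσ με (a ^ 2) * (‖w‖ / a) := by gcongr
        _ = _ := by ring
    rw [norm_div, norm_pow, div_le_div_iff₀ (by positivity) (by positivity)]
    have h3 : √a * √‖w‖ ≤ ‖w‖ := by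
      calc √a * √‖w‖ ≤ √‖w‖ * √‖w‖ := by gcongr
        _ = ‖w‖ := Real.mul_self_sqrt hn.le
    have h4 : √‖w‖ ≤ ‖w‖ / √a := by
      rw [le_div_iff₀ (Real.sqrt_pos.2 ha)]
      linarith
    calc ‖symbolPsi μσ με (w ^ 2)‖ * ‖w‖ ^ 2
        ≤ √(ratioR μσ με (a ^ 2) / a) * √‖w‖ * ‖w‖ ^ 2 := by gcongr
      _ ≤ √(ratioR μσ με (a ^ 2) / a) * (‖w‖ / √a) * ‖w‖ ^ 2 := by gcongr
      _ = _ := by rw [hC]; ring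

/-- The function `2 Ψ(w²) / w³` on the line `re w = ε`. -/
noncomputable def psiLine (μσ με : Measure ℝ) (ε y : ℝ) : ℂ :=
  2 * (symbolPsi μσ με (((ε : ℂ) + y * Complex.I) ^ 2) / ((ε : ℂ) + y * Complex.I) ^ 3)

/-- The Cauchy-type integral equal to `(-1)ⁿ Ψ⁽ⁿ⁾(x) / n!` for `n ≥ 1`, along the parabola
`s = (ε + iy)²` around the cut. -/
noncomputable def psiInt (μσ με : Measure ℝ) (ε : ℝ) (n : ℕ) (x : ℝ) : ℂ :=
  (2 * (Real.pi : ℂ))⁻¹ * ∫ y : ℝ, psiLine μσ με ε y * (((ε : ℂ) + y * Complex.I) ^ 2) ^ 2 /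
    ((x : ℂ) - ((ε : ℂ) + y * Complex.I) ^ 2) ^ (n + 1)

lemma continuous_psiLine (h : Admissible μσ με) {ε : ℝ} (hε : 0 < ε) :
    Continuous (psiLine μσ με ε) :=
  (h.hDecay_symbolPsi_sq_div.continuous_line hε).const_smul (2 : ℂ)

lemma integrable_psiLine (h : Admissible μσ με) {ε : ℝ} (hε : 0 < ε) :
    Integrable (psiLine μσ με ε) :=
  (h.hDecay_symbolPsi_sq_div.integrable_line hε).const_mul 2

lemma integral_psiLine (h : Admissible μσ με) {ε : ℝ} (hε : 0 < ε) :
    ∫ y, psiLine μσ με ε y = 0 := by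
  have h1 := h.hDecay_symbolPsi_sq_div.invL_eq hε 0
  rw [h.hDecay_symbolPsi_sq_div.invL_eq_zero le_rfl] at h1
  simp only [Complex.ofReal_zero, mul_zero, Complex.exp_zero, mul_one] at h1
  have hpi : (2 * (Real.pi : ℂ))⁻¹ ≠ 0 := by simp [Real.pi_ne_zero]
  have h2 := (mul_eq_zero.1 h1.symm).resolve_left hpi
  unfold psiLine
  rw [integral_const_mul, h2, mul_zero]

/-- Cauchy's formula for `Ψ` along the parabola `s = (ε + iy)²`. -/
lemma symbolPsi_eq_integral (h : Admissible μσ με) {ε x : ℝ} (hε : 0 < ε) (hx : ε ^ 2 < x) :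
    symbolPsi μσ με x = (x : ℂ) ^ 2 * ((2 * (Real.pi : ℂ))⁻¹ *
      ∫ y : ℝ, psiLine μσ με ε y / ((x : ℂ) - ((ε : ℂ) + y * Complex.I) ^ 2)) := by
  have hF := h.hDecay_symbolPsi_sq_div
  have hx0 : 0 < x := (by positivity : 0 < ε ^ 2).trans hx
  set z := √x with hz
  have hz0 : 0 < z := Real.sqrt_pos.2 hx0
  have hzε : ε < z := Real.lt_sqrt_of_sq_lt hx
  have hzx : (z : ℂ) ^ 2 = x := by
    rw [← Complex.ofReal_pow, Real.sq_sqrt hx0.le]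
  have c1 := hF.cauchy_halfplane hε (z := z) (by simpa using hzε)
  have c2 := hF.cauchy_halfplane_reflected hε (z := z) (by simp; linarith)
  have i1 : ∀ {g : ℝ → ℂ}, Continuous g → (∀ y, z - ε ≤ ‖g y‖) → Integrable fun y : ℝ =>
      symbolPsi μσ με (((ε : ℂ) + y * Complex.I) ^ 2) / ((ε : ℂ) + y * Complex.I) ^ 3 / g y := by
    intro g hg hb
    have hd : 0 < z - ε := by linarith
    simp_rw [div_eq_mul_inv _ (g _)]
    refine (hF.integrable_line hε).mul_bdd (c := (z - ε)⁻¹) ?_ (Eventually.of_forall fun y => ?_)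
    · exact (hg.inv₀ fun y hy => by
        have := hb y
        rw [hy, norm_zero] at this
        linarith).aestronglyMeasurable
    · rw [norm_inv]
      exact inv_anti₀ hd (hb y)
  have e := integral_add (i1 (g := fun y : ℝ => (z : ℂ) - ((ε : ℂ) + y * Complex.I))
      (by fun_prop) fun y => le_trans (by simp) (Complex.re_le_norm _))
    (i1 (g := fun y : ℝ => (z : ℂ) + ((ε : ℂ) + y * Complex.I))
      (by fun_prop) fun y => le_trans (by simp; linarith) (Complex.re_le_norm _))
  have e2 : ∀ y : ℝ, symbolPsi μσ με (((ε : ℂ) + y * Complex.I) ^ 2) /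
      ((ε : ℂ) + y * Complex.I) ^ 3 / ((z : ℂ) - ((ε : ℂ) + y * Complex.I)) +
      symbolPsi μσ με (((ε : ℂ) + y * Complex.I) ^ 2) /
      ((ε : ℂ) + y * Complex.I) ^ 3 / ((z : ℂ) + ((ε : ℂ) + y * Complex.I)) =
      z * (psiLine μσ με ε y / ((x : ℂ) - ((ε : ℂ) + y * Complex.I) ^ 2)) := by
    intro y
    have n1 : (z : ℂ) - ((ε : ℂ) + y * Complex.I) ≠ 0 := fun hh => by
      have := congrArg Complex.re hh
      simp at this
      linarith
    have n2 : (z : ℂ) + ((ε : ℂ) + y * Complex.I) ≠ 0 := fun hh => by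
      have := congrArg Complex.re hh
      simp at this
      linarith
    have n3 : (x : ℂ) - ((ε : ℂ) + y * Complex.I) ^ 2 =
      ((z : ℂ) - ((ε : ℂ) + y * Complex.I)) * ((z : ℂ) + ((ε : ℂ) + y * Complex.I)) := by
      rw [← hzx]; ring
    rw [n3, psiLine]
    have n4 := line_ne_zero hε y
    field_simp
    ring
  simp_rw [e2] at e
  rw [integral_const_mul] at e
  have c3 := congrArg₂ (· + ·) c1 c2
  simp only [add_zero] at c3
  rw [← mul_add, ← e, hzx] at c3
  have hz3 : (z : ℂ) ^ 3 ≠ 0 := pow_ne_zero 3 (by exact_mod_cast hz0.ne')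
  rw [eq_div_iff hz3] at c3
  rw [← c3, ← hzx]
  ring

lemma integrable_psiLine_div (h : Admissible μσ με) {ε x : ℝ} (hε : 0 < ε) (hx : ε ^ 2 < x)
    (n : ℕ) : Integrable fun y : ℝ =>
      psiLine μσ με ε y / ((x : ℂ) - ((ε : ℂ) + y * Complex.I) ^ 2) ^ n := by
  have hd : 0 < x - ε ^ 2 := by linarith
  have hb : ∀ y : ℝ, x - ε ^ 2 ≤ ‖(x : ℂ) - ((ε : ℂ) + y * Complex.I) ^ 2‖ := fun y =>
    le_trans (by nlinarith [sq_nonneg y]) (le_norm_sub_sq x ε y)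
  simp_rw [div_eq_mul_inv]
  refine (h.integrable_psiLine hε).mul_bdd (c := ((x - ε ^ 2) ^ n)⁻¹) ?_
    (Eventually.of_forall fun y => ?_)
  · have hc : Continuous fun y : ℝ => ((x : ℂ) - ((ε : ℂ) + y * Complex.I) ^ 2) ^ n := by fun_prop
    exact (hc.inv₀ fun y => pow_ne_zero _ fun hy => by
      have := hb y
      rw [hy, norm_zero] at this
      linarith).aestronglyMeasurable
  · rw [norm_inv, norm_pow]
    have := hb y
    gcongr

lemma parabola_ratio_le {ε x d y : ℝ} (hd : 0 < d) (hx : d ≤ x - ε ^ 2) :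
    ‖(((ε : ℂ) + y * Complex.I) ^ 2)‖ ≤
      (1 + ε ^ 2 / d) * ‖(x : ℂ) - ((ε : ℂ) + y * Complex.I) ^ 2‖ := by
  have h1 := le_norm_sub_sq x ε y
  rw [norm_pow, norm_sq_line]
  have h2 : d + y ^ 2 ≤ ‖(x : ℂ) - ((ε : ℂ) + y * Complex.I) ^ 2‖ := by linarith
  refine le_trans ?_ (mul_le_mul_of_nonneg_left h2 (by positivity))
  have : ε ^ 2 / d * d = ε ^ 2 := by field_simp
  have h3 : 0 ≤ ε ^ 2 / d * y ^ 2 := by positivity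
  nlinarith

lemma hasDerivAt_psiInt (h : Admissible μσ με) {ε x : ℝ} (hε : 0 < ε) (hx : ε ^ 2 < x)
    (n : ℕ) : HasDerivAt (psiInt μσ με ε (n + 1))
      (-((n + 2 : ℝ) * psiInt μσ με ε (n + 2) x)) x := by
  set d := (x - ε ^ 2) / 2 with hd
  have hd0 : 0 < d := by rw [hd]; linarith
  have hx' : ∀ x' : ℝ, |x' - x| < d → d ≤ x' - ε ^ 2 := fun x' hx' => by
    have := (abs_lt.1 hx').1
    linarith
  have hdn : ∀ x' : ℝ, |x' - x| < d → ∀ y : ℝ,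
      d ≤ ‖(x' : ℂ) - ((ε : ℂ) + y * Complex.I) ^ 2‖ := fun x' hxx y => by
    have := le_norm_sub_sq x' ε y
    nlinarith [hx' x' hxx, sq_nonneg y]
  have key := (hasDerivAt_cauchy_integral
    (φ := fun y : ℝ => psiLine μσ με ε y * (((ε : ℂ) + y * Complex.I) ^ 2) ^ 2)
    (s := fun y : ℝ => ((ε : ℂ) + y * Complex.I) ^ 2)
    (B := fun y : ℝ => ‖psiLine μσ με ε y‖ * ((1 + ε ^ 2 / d) ^ 2 * (d ^ n)⁻¹))
    (x₀ := x) (n + 1) hd0 hd0 ((h.continuous_psiLine hε).mul (by fun_prop)) (by fun_prop)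
    ((h.integrable_psiLine hε).norm.mul_const _) hdn ?_).const_mul (2 * (Real.pi : ℂ))⁻¹
  · refine key.congr_deriv ?_
    unfold psiInt
    push_cast
    ring
  · intro x' hxx y
    have h1 := hdn x' hxx y
    have h2 := parabola_ratio_le (y := y) hd0 (hx' x' hxx)
    have h3 : 0 < ‖(x' : ℂ) - ((ε : ℂ) + y * Complex.I) ^ 2‖ := hd0.trans_le h1
    rw [norm_mul, norm_pow _ 2, div_le_iff₀ (by positivity)]
    set N := ‖(x' : ℂ) - ((ε : ℂ) + y * Complex.I) ^ 2‖
    have h4 : 1 ≤ (d ^ n)⁻¹ * N ^ n := by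
      rw [← div_eq_inv_mul, ← div_pow]
      exact one_le_pow₀ ((one_le_div hd0).2 h1)
    calc ‖psiLine μσ με ε y‖ * ‖((ε : ℂ) + y * Complex.I) ^ 2‖ ^ 2
        ≤ ‖psiLine μσ με ε y‖ * ((1 + ε ^ 2 / d) * N) ^ 2 := by gcongr
      _ = ‖psiLine μσ με ε y‖ * ((1 + ε ^ 2 / d) * N) ^ 2 * 1 := by ring
      _ ≤ ‖psiLine μσ με ε y‖ * ((1 + ε ^ 2 / d) * N) ^ 2 * ((d ^ n)⁻¹ * N ^ n) := by gcongr
      _ = _ := by ring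

/-- The derivative of `Ψ` on the half-axis. The weight `x² / w⁴` in Cauchy's formula disappears
because `Ψ(w²) / w³` has integral zero. -/
lemma hasDerivAt_symbolPsi (h : Admissible μσ με) {ε x : ℝ} (hε : 0 < ε) (hx : ε ^ 2 < x) :
    HasDerivAt (fun x : ℝ => symbolPsi μσ με x) (-psiInt μσ με ε 1 x) x := by
  set d := (x - ε ^ 2) / 2 with hd
  have hd0 : 0 < d := by rw [hd]; linarith
  have hdn : ∀ x' : ℝ, |x' - x| < d → ∀ y : ℝ,
      d ≤ ‖(x' : ℂ) - ((ε : ℂ) + y * Complex.I) ^ 2‖ := fun x' hxx y => by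
    have := le_norm_sub_sq x' ε y
    nlinarith [(abs_lt.1 hxx).1, sq_nonneg y]
  have key := (hasDerivAt_cauchy_integral (φ := psiLine μσ με ε)
    (s := fun y : ℝ => ((ε : ℂ) + y * Complex.I) ^ 2)
    (B := fun y : ℝ => ‖psiLine μσ με ε y‖ / d)
    (x₀ := x) 0 hd0 hd0 (h.continuous_psiLine hε) (by fun_prop)
    ((h.integrable_psiLine hε).norm.div_const _) hdn (fun x' hxx y => by
      have := hdn x' hxx y
      rw [zero_add, pow_one]
      gcongr)).const_mul (2 * (Real.pi : ℂ))⁻¹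
  have hsq : HasDerivAt (fun x : ℝ => (x : ℂ) ^ 2) (2 * (x : ℂ)) x := by
    refine ((Complex.ofRealCLM.hasDerivAt (x := x)).fun_pow 2).congr_deriv (by simp)
  have h2 := hsq.mul key
  simp only [zero_add, pow_one] at h2
  refine (h2.congr_of_eventuallyEq ?_).congr_deriv ?_
  · filter_upwards [Ioi_mem_nhds hx] with x' hx'
    exact h.symbolPsi_eq_integral hε hx'
  · have i0 := h.integrable_psiLine hε
    have i1 := h.integrable_psiLine_div hε hx 1
    have i2 := h.integrable_psiLine_div hε hx 2
    simp only [pow_one] at i1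
    have e : ∀ y : ℝ, psiLine μσ με ε y * (((ε : ℂ) + y * Complex.I) ^ 2) ^ 2 /
        ((x : ℂ) - ((ε : ℂ) + y * Complex.I) ^ 2) ^ 2 =
        psiLine μσ με ε y - 2 * x * (psiLine μσ με ε y /
          ((x : ℂ) - ((ε : ℂ) + y * Complex.I) ^ 2)) + (x : ℂ) ^ 2 * (psiLine μσ με ε y /
          ((x : ℂ) - ((ε : ℂ) + y * Complex.I) ^ 2) ^ 2) := by
      intro y
      have : (x : ℂ) - ((ε : ℂ) + y * Complex.I) ^ 2 ≠ 0 := fun hy => by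
        have := hdn x (by simpa using hd0) y
        rw [hy, norm_zero] at this
        linarith
      field_simp
      ring
    unfold psiInt
    rw [show 1 + 1 = 2 from rfl]
    simp_rw [e]
    have i3 : Integrable fun y : ℝ => psiLine μσ με ε y - 2 * x * (psiLine μσ με ε y /
        ((x : ℂ) - ((ε : ℂ) + y * Complex.I) ^ 2)) := i0.sub (i1.const_mul _)
    rw [integral_add i3 (i2.const_mul _), integral_sub i0 (i1.const_mul _),
      integral_const_mul, integral_const_mul, h.integral_psiLine hε]
    push_cast
    ring

/-- The integrals do not depend on the parabola, being derivatives of the same function. -/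
lemma psiInt_eq (h : Admissible μσ με) {ε ε' : ℝ} (hε : 0 < ε) (hε1 : ε ≤ 1) (hε' : 0 < ε')
    (hε1' : ε' ≤ 1) : ∀ (n : ℕ) (x : ℝ), 1 < x →
      psiInt μσ με ε (n + 1) x = psiInt μσ με ε' (n + 1) x
  | 0, x, hx => by
    have h1 := h.hasDerivAt_symbolPsi hε (x := x) (by nlinarith)
    have h2 := h.hasDerivAt_symbolPsi hε' (x := x) (by nlinarith)
    exact neg_injective (h1.unique h2)
  | n + 1, x, hx => by
    have h1 := h.hasDerivAt_psiInt hε (x := x) (by nlinarith) n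
    have h2 := h.hasDerivAt_psiInt hε' (x := x) (by nlinarith) n
    have h3 := (h2.congr_of_eventuallyEq (by
      filter_upwards [Ioi_mem_nhds hx] with y hy using psiInt_eq h hε hε1 hε' hε1' n y hy)).unique h1
    have h4 : (((n : ℝ) + 2 : ℝ) : ℂ) ≠ 0 := by
      have : (0 : ℝ) < (n : ℝ) + 2 := by positivity
      exact_mod_cast this.ne'
    exact (mul_left_cancel₀ h4 (neg_injective h3)).symm

end Admissible

/-! ### Signs of the Cauchy integrals along the cut -/

/-- An integrable weight, independent of `ε`, that dominates `|Ψ| / (1 + y²)` on the parabolas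
`(ε + iy)²` up to a multiple of `ε⁻¹ᐟ²`. -/
lemma exists_parabola_weight : ∃ E : ℝ → ℝ, Integrable E ∧ ∀ y : ℝ, y ≠ 0 →
    √((1 + y ^ 2) / |y|) / (1 + y ^ 2) ≤ E y := by
  set f : ℝ → ℝ := fun y => √((1 + y ^ 2) / y) / (1 + y ^ 2) with hf
  have hmeas : Measurable f := by fun_prop
  have hf0 : ∀ y, 0 ≤ f y := fun y => by simp only [hf]; positivity
  have h1 : IntegrableOn f (Ioc 0 1) := by
    have hi := (intervalIntegral.intervalIntegrable_rpow' (a := 0) (b := 1)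
      (r := -(1 / 2)) (by norm_num)).const_mul (√2)
    rw [intervalIntegrable_iff_integrableOn_Ioc_of_le zero_le_one] at hi
    refine hi.mono' hmeas.aestronglyMeasurable ?_
    filter_upwards [ae_restrict_mem measurableSet_Ioc] with y hy
    obtain ⟨hy0, hy1⟩ := hy
    rw [Real.norm_of_nonneg (hf0 y), Real.rpow_neg hy0.le, ← Real.sqrt_eq_rpow,
      ← Real.sqrt_inv, ← Real.sqrt_mul (by norm_num)]
    refine (div_le_self (Real.sqrt_nonneg _) (by nlinarith)).trans (Real.sqrt_le_sqrt ?_)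
    rw [div_eq_mul_inv]
    gcongr
    nlinarith
  have h2 : IntegrableOn f (Ioi 1) := by
    have hi := (integrableOn_Ioi_rpow_of_lt (a := -(3 / 2)) (by norm_num) one_pos).const_mul (√2)
    refine hi.mono' hmeas.aestronglyMeasurable ?_
    filter_upwards [ae_restrict_mem measurableSet_Ioi] with y hy
    have hy1 : 1 < y := hy
    have hy0 : 0 < y := one_pos.trans hy1
    rw [Real.norm_of_nonneg (hf0 y)]
    have h3 : y ^ (-(3 / 2) : ℝ) = √y / y ^ 2 := by
      rw [Real.sqrt_eq_rpow, ← Real.rpow_natCast y 2, ← Real.rpow_sub hy0]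
      norm_num
    rw [h3, ← mul_div_assoc, ← Real.sqrt_mul (by norm_num)]
    have h4 : (1 + y ^ 2) / y ≤ 2 * y := by
      rw [div_le_iff₀ hy0]; nlinarith
    simp only [hf]
    gcongr
    linarith
  have h3 : Integrable ((Ioi (0 : ℝ)).indicator f) := by
    rw [integrable_indicator_iff measurableSet_Ioi, ← Ioc_union_Ioi_eq_Ioi zero_le_one]
    exact h1.union h2
  refine ⟨fun y => (Ioi (0 : ℝ)).indicator f y + (Ioi (0 : ℝ)).indicator f (-y),
    h3.add h3.comp_neg, fun y hy => ?_⟩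
  beta_reduce
  rcases lt_or_gt_of_ne hy with hy | hy
  · have e1 : y ∉ Ioi (0 : ℝ) := not_lt.2 hy.le
    have e2 : -y ∈ Ioi (0 : ℝ) := neg_pos.2 hy
    rw [indicator_of_notMem e1, indicator_of_mem e2, abs_of_neg hy]
    simp [hf]
  · have e1 : y ∈ Ioi (0 : ℝ) := hy
    have e2 : -y ∉ Ioi (0 : ℝ) := not_lt.2 (neg_nonpos.2 hy.le)
    rw [indicator_of_notMem e2, indicator_of_mem e1, abs_of_pos hy]
    simp [hf]

/-- On the parabola `w²`, `re w = ε ≤ 1/2`, the kernel `w / (x - w²)^N` differs from its value on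
the two sides of the cut, `iy / (x + y²)^N`, by `O(ε / (1 + y²))`. -/
lemma exists_norm_kernel_sub_le {x : ℝ} (hx : 1 < x) (N : ℕ) : ∃ C : ℝ, 0 ≤ C ∧
    ∀ ε : ℝ, 0 < ε → ε ≤ 1 / 2 → ∀ y : ℝ,
      ‖((ε : ℂ) + y * Complex.I) / ((x : ℂ) - ((ε : ℂ) + y * Complex.I) ^ 2) ^ (N + 1) -
        y * ((1 / (x + y ^ 2) ^ (N + 1) : ℝ) : ℂ) * Complex.I‖ ≤ C * (ε / (1 + y ^ 2)) := by
  refine ⟨2 ^ (N + 1) + (N + 1 : ℕ) * 2 ^ N * 6, by positivity, fun ε hε hε1 y => ?_⟩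
  set w : ℂ := (ε : ℂ) + y * Complex.I with hw
  set u : ℂ := (x : ℂ) - w ^ 2 with hu
  set v : ℂ := ((x + y ^ 2 : ℝ) : ℂ) with hv
  set q := 1 + y ^ 2 with hq
  have hq1 : 1 ≤ q := by rw [hq]; nlinarith [sq_nonneg y]
  have hq0 : 0 < q := by linarith
  have hun : q / 2 ≤ ‖u‖ := by
    have := le_norm_sub_sq x ε y
    rw [hq]
    nlinarith [sq_nonneg y]
  have hvn : q ≤ ‖v‖ := by
    rw [hv, Complex.norm_real, Real.norm_of_nonneg (by positivity)]
    linarith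
  have hu0 : u ≠ 0 := norm_pos_iff.1 (by linarith)
  have hv0 : v ≠ 0 := norm_pos_iff.1 (by linarith)
  have hui : ‖u⁻¹‖ ≤ 2 / q := by
    rw [norm_inv, inv_le_comm₀ (norm_pos_iff.2 hu0) (by positivity), inv_div]
    exact hun
  have hvi : ‖v⁻¹‖ ≤ 1 / q := by
    rw [norm_inv, inv_le_comm₀ (norm_pos_iff.2 hv0) (by positivity), inv_div, div_one]
    exact hvn
  have h2q : 2 / q ≤ 2 := div_le_self (by norm_num) hq1
  have huv : ‖u⁻¹ - v⁻¹‖ ≤ ε * (1 + 2 * |y|) * (2 / q) * (1 / q) := by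
    have e1 : u⁻¹ - v⁻¹ = (ε * ((ε : ℂ) + 2 * y * Complex.I)) * u⁻¹ * v⁻¹ := by
      field_simp
      rw [hv, hu, hw]
      push_cast
      ring_nf
      rw [Complex.I_sq]
      ring
    rw [e1, norm_mul, norm_mul, norm_mul, Complex.norm_real, Real.norm_of_nonneg hε.le]
    have : ‖(ε : ℂ) + 2 * y * Complex.I‖ ≤ 1 + 2 * |y| := by
      refine (norm_add_le _ _).trans ?_
      simp only [norm_mul, Complex.norm_real, Complex.norm_I, Real.norm_eq_abs, abs_of_pos hε]
      norm_num
      linarith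
    gcongr
  have hy2 : |y| * (1 + 2 * |y|) ≤ 3 * q := by
    rw [hq]
    nlinarith [sq_abs y, sq_nonneg (|y| - 1), abs_nonneg y]
  have hdiff : ∀ n : ℕ, ‖u⁻¹ ^ (n + 1) - v⁻¹ ^ (n + 1)‖ ≤ (n + 1 : ℕ) * 2 ^ n * ‖u⁻¹ - v⁻¹‖ := by
    intro n
    induction n with
    | zero => simp
    | succ n ih =>
      have e2 : u⁻¹ ^ (n + 1 + 1) - v⁻¹ ^ (n + 1 + 1) =
        u⁻¹ * (u⁻¹ ^ (n + 1) - v⁻¹ ^ (n + 1)) + v⁻¹ ^ (n + 1) * (u⁻¹ - v⁻¹) := by ring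
      have hv2 : ‖v⁻¹ ^ (n + 1)‖ ≤ 2 ^ (n + 1) := by
        rw [norm_pow]
        gcongr
        exact hvi.trans ((div_le_self (by norm_num) hq1).trans (by norm_num))
      rw [e2]
      refine (norm_add_le _ _).trans ?_
      rw [norm_mul, norm_mul]
      calc ‖u⁻¹‖ * ‖u⁻¹ ^ (n + 1) - v⁻¹ ^ (n + 1)‖ + ‖v⁻¹ ^ (n + 1)‖ * ‖u⁻¹ - v⁻¹‖
          ≤ 2 * ((n + 1 : ℕ) * 2 ^ n * ‖u⁻¹ - v⁻¹‖) + 2 ^ (n + 1) * ‖u⁻¹ - v⁻¹‖ := by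
            gcongr
            exact hui.trans h2q
        _ = _ := by push_cast; ring
  have e3 : w / u ^ (N + 1) - y * ((1 / (x + y ^ 2) ^ (N + 1) : ℝ) : ℂ) * Complex.I =
      ε * u⁻¹ ^ (N + 1) + y * Complex.I * (u⁻¹ ^ (N + 1) - v⁻¹ ^ (N + 1)) := by
    rw [hv, hw]
    push_cast
    simp only [div_eq_mul_inv, inv_pow]
    ring
  rw [e3]
  refine (norm_add_le _ _).trans ?_
  rw [add_mul]
  refine add_le_add ?_ ?_
  · rw [norm_mul, Complex.norm_real, Real.norm_of_nonneg hε.le, norm_pow, pow_succ, pow_succ]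
    calc ε * (‖u⁻¹‖ ^ N * ‖u⁻¹‖) ≤ ε * (2 ^ N * (2 / q)) := by
          gcongr
          exact hui.trans h2q
      _ = _ := by ring
  · rw [norm_mul, norm_mul, Complex.norm_real, Complex.norm_I, mul_one, Real.norm_eq_abs]
    calc |y| * ‖u⁻¹ ^ (N + 1) - v⁻¹ ^ (N + 1)‖
        ≤ |y| * ((N + 1 : ℕ) * 2 ^ N * (ε * (1 + 2 * |y|) * (2 / q) * (1 / q))) := by
          gcongr
          exact (hdiff N).trans (by gcongr)
      _ = (N + 1 : ℕ) * 2 ^ N * (|y| * (1 + 2 * |y|)) * ε * (2 / q) * (1 / q) := by ring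
      _ ≤ (N + 1 : ℕ) * 2 ^ N * (3 * q) * ε * (2 / q) * (1 / q) := by gcongr
      _ = _ := by field_simp; ring

namespace Admissible

variable {μσ με : Measure ℝ} [IsFiniteMeasure μσ] [IsFiniteMeasure με]

lemma norm_symbolPsi_line_le (h : Admissible μσ με) {ε y : ℝ} (hε : 0 < ε) (hε1 : ε ≤ 1)
    (hy : y ≠ 0) : ‖symbolPsi μσ με (((ε : ℂ) + y * Complex.I) ^ 2)‖ ≤
      √(2 * ratioR μσ με 1 / ε) * √((1 + y ^ 2) / |y|) := by
  have hR := h.ratioR_pos one_pos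
  have hre := line_re_pos hε y
  have hn2 := norm_sq_line ε y
  set w : ℂ := (ε : ℂ) + y * Complex.I
  have hwr : w.re = ε := by simp [w]
  have hy0 : 0 < |y| := abs_pos.2 hy
  have hwy : |y| ≤ ‖w‖ := by
    refine le_trans (le_of_eq ?_) (Complex.abs_im_le_norm w)
    simp [w]
  have hw0 : 0 < ‖w‖ := hy0.trans_le hwy
  rw [← Real.sqrt_mul (by positivity)]
  refine Real.le_sqrt_of_sq_le ((h.norm_symbolPsi_sq_sq_le hre).trans ?_)
  rw [hwr]
  calc ratioR μσ με (‖w‖ ^ 2) * (‖w‖ / ε)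
      ≤ (ratioR μσ με 1 * (1 + (‖w‖ ^ 2)⁻¹)) * (‖w‖ / ε) := by
        gcongr
        exact h.ratioR_le (by positivity)
    _ = ratioR μσ με 1 / ε * ((‖w‖ ^ 2 + 1) / ‖w‖) := by field_simp
    _ ≤ ratioR μσ με 1 / ε * ((2 * (1 + y ^ 2)) / |y|) := by
        gcongr
        rw [hn2]
        nlinarith [sq_nonneg y]
    _ = _ := by ring

/-- Sign of an integral along the parabola: up to `O(ε)` the kernel is `i y k(y)` with `0 ≤ k`,
and `Ψ` maps the upper half-plane to the lower one. -/
lemma integral_re_nonneg (h : Admissible μσ με) {V : ℝ → ℝ → ℂ} {k : ℝ → ℝ} {C : ℝ} {J : ℂ}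
    (hk : ∀ y, 0 ≤ k y) (hC : 0 ≤ C)
    (hV : ∀ ε : ℝ, 0 < ε → ε ≤ 1 / 2 → ∀ y : ℝ, ‖V ε y - y * (k y : ℂ) * Complex.I‖ ≤
      C * (ε / (1 + y ^ 2)))
    (hi : ∀ ε : ℝ, 0 < ε → ε ≤ 1 / 2 →
      Integrable fun y : ℝ => symbolPsi μσ με (((ε : ℂ) + y * Complex.I) ^ 2) * V ε y)
    (hJ : ∀ ε : ℝ, 0 < ε → ε ≤ 1 / 2 →
      ∫ y : ℝ, symbolPsi μσ με (((ε : ℂ) + y * Complex.I) ^ 2) * V ε y = J) : 0 ≤ J.re := by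
  obtain ⟨E, hE, hEb⟩ := exists_parabola_weight
  set M := C * √(2 * ratioR μσ με 1) * ∫ y, E y with hM
  have key : ∀ ε : ℝ, 0 < ε → ε ≤ 1 / 2 → -(M * √ε) ≤ J.re := by
    intro ε hε hε1
    have hre := Complex.reCLM.integral_comp_comm (hi ε hε hε1)
    rw [hJ ε hε hε1] at hre
    simp only [Complex.reCLM_apply] at hre
    rw [← hre, hM, mul_right_comm, ← integral_const_mul, ← integral_neg]
    refine integral_mono_ae (hE.const_mul _).neg (Complex.reCLM.integrable_comp (hi ε hε hε1)) ?_
    have hae : ∀ᵐ y : ℝ, y ≠ 0 := by simp [ae_iff]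
    filter_upwards [hae] with y hy
    have hq0 : 0 < 1 + y ^ 2 := by positivity
    have hpsi := h.norm_symbolPsi_line_le hε (by linarith) hy
    have hsgn := h.im_mul_symbolPsi_im_nonpos (sq_mem_slitPlane (line_re_pos hε y))
    have him : (((ε : ℂ) + y * Complex.I) ^ 2).im = 2 * ε * y := by simp [sq]; ring
    rw [him] at hsgn
    have hv := hV ε hε hε1 y
    set P := symbolPsi μσ με (((ε : ℂ) + y * Complex.I) ^ 2)
    have e1 : (P * V ε y).re = (P * (V ε y - y * (k y : ℂ) * Complex.I)).re - y * P.im * k y := by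
      simp [Complex.mul_re]
      ring
    have h1 : y * P.im * k y ≤ 0 := by
      have : y * P.im ≤ 0 := by
        by_contra hc
        push Not at hc
        have := mul_pos hε hc
        linarith
      exact mul_nonpos_of_nonpos_of_nonneg this (hk y)
    have h2 : ‖P * (V ε y - y * (k y : ℂ) * Complex.I)‖ ≤
        C * √(2 * ratioR μσ με 1) * √ε * E y := by
      rw [norm_mul]
      have hsε : √(2 * ratioR μσ με 1 / ε) * ε = √(2 * ratioR μσ με 1) * √ε := by
        rw [Real.sqrt_div' _ hε.le, div_mul_eq_mul_div, mul_div_assoc, Real.div_sqrt]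
      calc ‖P‖ * ‖V ε y - y * (k y : ℂ) * Complex.I‖
          ≤ √(2 * ratioR μσ με 1 / ε) * √((1 + y ^ 2) / |y|) * (C * (ε / (1 + y ^ 2))) := by
            gcongr
        _ = C * (√(2 * ratioR μσ με 1 / ε) * ε) * (√((1 + y ^ 2) / |y|) / (1 + y ^ 2)) := by ring
        _ ≤ C * (√(2 * ratioR μσ με 1 / ε) * ε) * E y := by
            gcongr
            exact hEb y hy
        _ = _ := by rw [hsε]; ring
    have h3 := (abs_le.1 ((Complex.abs_re_le_norm _).trans h2)).1
    show -(C * √(2 * ratioR μσ με 1) * √ε * E y) ≤ (P * V ε y).re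
    rw [e1]
    linarith
  have hlim : Tendsto (fun ε : ℝ => -(M * √ε)) (𝓝[>] 0) (𝓝 0) := by
    have : Tendsto (fun ε : ℝ => -(M * √ε)) (𝓝 0) (𝓝 (-(M * √0))) :=
      (Continuous.tendsto (by fun_prop) 0)
    simp only [Real.sqrt_zero, mul_zero, neg_zero] at this
    exact this.mono_left nhdsWithin_le_nhds
  refine le_of_tendsto hlim ?_
  filter_upwards [Ioc_mem_nhdsGT (show (0 : ℝ) < 1 / 2 by norm_num)] with ε hε
  exact key ε hε.1 hε.2

end Admissible

namespace Admissible

/-- `(-1)ᵏ Ψ⁽ᵏ⁾(x) / k!` on the half-axis `x > 1`. -/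
noncomputable def psiTaylor (μσ με : Measure ℝ) : ℕ → ℝ → ℝ
  | 0, x => √(ratioR μσ με x)
  | k + 1, x => (psiInt μσ με (1 / 2) (k + 1) x).re


variable {μσ με : Measure ℝ} [IsFiniteMeasure μσ] [IsFiniteMeasure με]

lemma integrable_psi_kernel (h : Admissible μσ με) {ε x : ℝ} (hε : 0 < ε) (hx : ε ^ 2 < x)
    (n : ℕ) : Integrable fun y : ℝ => symbolPsi μσ με (((ε : ℂ) + y * Complex.I) ^ 2) *
      (((ε : ℂ) + y * Complex.I) / ((x : ℂ) - ((ε : ℂ) + y * Complex.I) ^ 2) ^ (n + 2)) := by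
  set d := x - ε ^ 2 with hd
  have hd0 : 0 < d := by rw [hd]; linarith
  have hdn : ∀ y : ℝ, d ≤ ‖(x : ℂ) - ((ε : ℂ) + y * Complex.I) ^ 2‖ := fun y => by
    have := le_norm_sub_sq x ε y
    nlinarith [sq_nonneg y]
  have hi : Integrable fun y : ℝ => psiLine μσ με ε y * (2⁻¹ * ((((ε : ℂ) + y * Complex.I) ^ 2) ^ 2
      / ((x : ℂ) - ((ε : ℂ) + y * Complex.I) ^ 2) ^ (n + 2))) := by
    refine (h.integrable_psiLine hε).mul_bdd (c := 2⁻¹ * ((1 + ε ^ 2 / d) ^ 2 * (d ^ n)⁻¹)) ?_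
      (Eventually.of_forall fun y => ?_)
    · refine (continuous_const.mul (Continuous.div (by fun_prop) (by fun_prop)
        fun y => pow_ne_zero _ fun hy => ?_)).aestronglyMeasurable
      have := hdn y
      rw [hy, norm_zero] at this
      linarith
    · have h1 := hdn y
      have h2 := parabola_ratio_le (y := y) hd0 hd.le
      have h3 : 0 < ‖(x : ℂ) - ((ε : ℂ) + y * Complex.I) ^ 2‖ := hd0.trans_le h1
      rw [norm_mul, norm_div, norm_pow _ 2, norm_pow _ (n + 2), norm_inv, Complex.norm_ofNat]
      set N := ‖(x : ℂ) - ((ε : ℂ) + y * Complex.I) ^ 2‖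
      refine mul_le_mul_of_nonneg_left ?_ (by norm_num)
      rw [div_le_iff₀ (by positivity)]
      have h4 : 1 ≤ (d ^ n)⁻¹ * N ^ n := by
        rw [← div_eq_inv_mul, ← div_pow]
        exact one_le_pow₀ ((one_le_div hd0).2 h1)
      calc ‖((ε : ℂ) + y * Complex.I) ^ 2‖ ^ 2
          ≤ ((1 + ε ^ 2 / d) * N) ^ 2 := by gcongr
        _ = ((1 + ε ^ 2 / d) * N) ^ 2 * 1 := by ring
        _ ≤ ((1 + ε ^ 2 / d) * N) ^ 2 * ((d ^ n)⁻¹ * N ^ n) := by gcongr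
        _ = _ := by ring
  refine hi.congr (Eventually.of_forall fun y => ?_)
  have hw := line_ne_zero hε y
  have hu : (x : ℂ) - ((ε : ℂ) + y * Complex.I) ^ 2 ≠ 0 := norm_pos_iff.1 (hd0.trans_le (hdn y))
  simp only [psiLine]
  field_simp

lemma integral_psi_kernel (h : Admissible μσ με) {ε x : ℝ} (hε : 0 < ε) (hε1 : ε ≤ 1 / 2)
    (hx : 1 < x) (n : ℕ) :
    ∫ y : ℝ, symbolPsi μσ με (((ε : ℂ) + y * Complex.I) ^ 2) *
      (((ε : ℂ) + y * Complex.I) / ((x : ℂ) - ((ε : ℂ) + y * Complex.I) ^ 2) ^ (n + 2)) =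
    Real.pi * psiInt μσ με (1 / 2) (n + 1) x := by
  rw [h.psiInt_eq (ε := 1 / 2) (ε' := ε) (by norm_num) (by norm_num) hε (by linarith) n x hx,
    psiInt]
  have e : ∀ y : ℝ, psiLine μσ με ε y * (((ε : ℂ) + y * Complex.I) ^ 2) ^ 2 /
      ((x : ℂ) - ((ε : ℂ) + y * Complex.I) ^ 2) ^ (n + 1 + 1) =
      2 * (symbolPsi μσ με (((ε : ℂ) + y * Complex.I) ^ 2) *
      (((ε : ℂ) + y * Complex.I) / ((x : ℂ) - ((ε : ℂ) + y * Complex.I) ^ 2) ^ (n + 2))) := by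
    intro y
    have hw := line_ne_zero hε y
    have hu : (x : ℂ) - ((ε : ℂ) + y * Complex.I) ^ 2 ≠ 0 := by
      have := le_norm_sub_sq x ε y
      refine norm_pos_iff.1 (lt_of_lt_of_le ?_ this)
      nlinarith [sq_nonneg y]
    simp only [psiLine]
    field_simp
  simp_rw [e]
  rw [integral_const_mul]
  have : (Real.pi : ℂ) ≠ 0 := by exact_mod_cast Real.pi_ne_zero
  generalize (∫ y : ℝ, symbolPsi μσ με (((ε : ℂ) + y * Complex.I) ^ 2) *
      (((ε : ℂ) + y * Complex.I) / ((x : ℂ) - ((ε : ℂ) + y * Complex.I) ^ 2) ^ (n + 2))) = J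
  field_simp

lemma psiInt_re_nonneg (h : Admissible μσ με) {x : ℝ} (hx : 1 < x) (n : ℕ) :
    0 ≤ (psiInt μσ με (1 / 2) (n + 1) x).re := by
  obtain ⟨C, hC, hb⟩ := exists_norm_kernel_sub_le hx (n + 1)
  have := h.integral_re_nonneg (k := fun y => 1 / (x + y ^ 2) ^ (n + 1 + 1))
    (J := Real.pi * psiInt μσ με (1 / 2) (n + 1) x)
    (fun y => by positivity) hC hb
    (fun ε hε hε1 => h.integrable_psi_kernel hε (by nlinarith) n)
    (fun ε hε hε1 => h.integral_psi_kernel hε hε1 hx n)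
  rw [Complex.re_ofReal_mul] at this
  exact nonneg_of_mul_nonneg_right this Real.pi_pos

/-- The kernel `w / (x - w²)ᴺ - x w / (x - w²)ᴺ⁺¹` is `-w³ / (x - w²)ᴺ⁺¹`, with boundary value
`i y³ / (x + y²)ᴺ⁺¹`. -/
lemma psiInt_sub_re_nonneg (h : Admissible μσ με) {x : ℝ} (hx : 1 < x) (n : ℕ) :
    0 ≤ (psiInt μσ με (1 / 2) (n + 1) x).re - x * (psiInt μσ με (1 / 2) (n + 2) x).re := by
  obtain ⟨C, hC, hb⟩ := exists_norm_kernel_sub_le hx (n + 1)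
  obtain ⟨C', hC', hb'⟩ := exists_norm_kernel_sub_le hx (n + 2)
  have hx0 : 0 < x := one_pos.trans hx
  have e : ∀ ε y : ℝ, symbolPsi μσ με (((ε : ℂ) + y * Complex.I) ^ 2) *
      (((ε : ℂ) + y * Complex.I) / ((x : ℂ) - ((ε : ℂ) + y * Complex.I) ^ 2) ^ (n + 1 + 1) -
      x * (((ε : ℂ) + y * Complex.I) / ((x : ℂ) - ((ε : ℂ) + y * Complex.I) ^ 2) ^ (n + 2 + 1))) =
      symbolPsi μσ με (((ε : ℂ) + y * Complex.I) ^ 2) *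
      (((ε : ℂ) + y * Complex.I) / ((x : ℂ) - ((ε : ℂ) + y * Complex.I) ^ 2) ^ (n + 2)) -
      x * (symbolPsi μσ με (((ε : ℂ) + y * Complex.I) ^ 2) *
      (((ε : ℂ) + y * Complex.I) / ((x : ℂ) - ((ε : ℂ) + y * Complex.I) ^ 2) ^ (n + 1 + 2))) :=
    fun ε y => by ring
  have := h.integral_re_nonneg
    (V := fun ε y => ((ε : ℂ) + y * Complex.I) /
        ((x : ℂ) - ((ε : ℂ) + y * Complex.I) ^ 2) ^ (n + 1 + 1) -
      x * (((ε : ℂ) + y * Complex.I) / ((x : ℂ) - ((ε : ℂ) + y * Complex.I) ^ 2) ^ (n + 2 + 1)))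
    (k := fun y => 1 / (x + y ^ 2) ^ (n + 1 + 1) - x * (1 / (x + y ^ 2) ^ (n + 2 + 1)))
    (C := C + x * C')
    (J := Real.pi * psiInt μσ με (1 / 2) (n + 1) x -
      x * (Real.pi * psiInt μσ με (1 / 2) (n + 1 + 1) x))
    (fun y => ?_) (by positivity) (fun ε hε hε1 y => ?_)
    (fun ε hε hε1 => ?_) (fun ε hε hε1 => ?_)
  · rw [Complex.sub_re, Complex.re_ofReal_mul, Complex.re_ofReal_mul, Complex.re_ofReal_mul] at this
    refine nonneg_of_mul_nonneg_right (a := Real.pi) (le_of_le_of_eq this ?_) Real.pi_pos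
    ring
  · have : 1 / (x + y ^ 2) ^ (n + 1 + 1) - x * (1 / (x + y ^ 2) ^ (n + 2 + 1)) =
        y ^ 2 / (x + y ^ 2) ^ (n + 2 + 1) := by
      have : x + y ^ 2 ≠ 0 := by positivity
      field_simp
      ring
    rw [this]
    positivity
  · have e2 : ∀ a b k k' : ℂ, a - x * b - y * (k - x * k') * Complex.I =
      (a - y * k * Complex.I) - x * (b - y * k' * Complex.I) := fun a b k k' => by ring
    rw [Complex.ofReal_sub, Complex.ofReal_mul, e2, add_mul, mul_assoc x]
    refine (norm_sub_le _ _).trans (add_le_add (hb ε hε hε1 y) ?_)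
    rw [norm_mul, Complex.norm_real, Real.norm_of_nonneg hx0.le]
    exact mul_le_mul_of_nonneg_left (hb' ε hε hε1 y) hx0.le
  · simp_rw [e]
    exact (h.integrable_psi_kernel hε (by nlinarith) n).sub
      ((h.integrable_psi_kernel hε (by nlinarith) (n + 1)).const_mul _)
  · simp_rw [e]
    rw [integral_sub (h.integrable_psi_kernel hε (by nlinarith) n)
      ((h.integrable_psi_kernel hε (by nlinarith) (n + 1)).const_mul _), integral_const_mul,
      h.integral_psi_kernel hε hε1 hx, h.integral_psi_kernel hε hε1 hx]

lemma hasDerivAt_psiTaylor (h : Admissible μσ με) (k : ℕ) {x : ℝ} (hx : 1 < x) :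
    HasDerivAt (psiTaylor μσ με k) (-((k + 1 : ℝ) * psiTaylor μσ με (k + 1) x)) x := by
  cases k with
  | zero =>
    have h1 := Complex.reCLM.hasFDerivAt.comp_hasDerivAt x
      (h.hasDerivAt_symbolPsi (ε := 1 / 2) (x := x) (by norm_num) (by nlinarith))
    refine (h1.congr_of_eventuallyEq ?_).congr_deriv (by simp [psiTaylor])
    filter_upwards [Ioi_mem_nhds hx] with y hy
    simp [psiTaylor, h.symbolPsi_ofReal (one_pos.trans hy)]
  | succ k =>
    have h1 := Complex.reCLM.hasFDerivAt.comp_hasDerivAt x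
      (h.hasDerivAt_psiInt (ε := 1 / 2) (x := x) (by norm_num) (by nlinarith) k)
    refine h1.congr_deriv ?_
    have : ((k : ℂ) + 2) = (((k : ℝ) + 2 : ℝ) : ℂ) := by push_cast; rfl
    simp only [Complex.reCLM_apply, Complex.neg_re, psiTaylor]
    push_cast
    rw [this, Complex.re_ofReal_mul]
    ring

lemma psiTaylor_nonneg (h : Admissible μσ με) (k : ℕ) {x : ℝ} (hx : 1 < x) :
    0 ≤ psiTaylor μσ με k x := by
  cases k with
  | zero => exact Real.sqrt_nonneg _
  | succ k => exact h.psiInt_re_nonneg hx k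

lemma mul_sqrt_ratioR_mono (h : Admissible μσ με) {r₁ r₂ : ℝ} (h1 : 0 < r₁) (h2 : r₁ ≤ r₂) :
    r₁ * √(ratioR μσ με r₁) ≤ r₂ * √(ratioR μσ με r₂) := by
  have e : ∀ r : ℝ, 0 < r → r * √(ratioR μσ με r) = √r * √(r * ratioR μσ με r) := fun r hr => by
    rw [Real.sqrt_mul hr.le, ← mul_assoc, Real.mul_self_sqrt hr.le]
  rw [e _ h1, e _ (h1.trans_le h2)]
  exact mul_le_mul (Real.sqrt_le_sqrt h2) (Real.sqrt_le_sqrt (h.mul_ratioR_mono h1 h2))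
    (Real.sqrt_nonneg _) (Real.sqrt_nonneg _)

lemma hasDerivAt_mul_sqrt_ratioR (h : Admissible μσ με) {x : ℝ} (hx : 1 < x) :
    HasDerivAt (fun x => x * √(ratioR μσ με x))
      (psiTaylor μσ με 0 x - x * psiTaylor μσ με 1 x) x := by
  refine ((hasDerivAt_id x).fun_mul (h.hasDerivAt_psiTaylor 0 hx)).congr_deriv ?_
  simp
  ring

/-- The Taylor coefficients, with alternating signs, of the derivative of `x Ψ(x)`. -/
lemma psiTaylor_sub_nonneg (h : Admissible μσ με) (k : ℕ) {x : ℝ} (hx : 1 < x) :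
    0 ≤ psiTaylor μσ με k x - x * psiTaylor μσ με (k + 1) x := by
  cases k with
  | zero =>
    have hd := h.hasDerivAt_mul_sqrt_ratioR hx
    refine ge_of_tendsto (hd.tendsto_slope.mono_left (nhdsGT_le_nhdsNE x)) ?_
    filter_upwards [self_mem_nhdsWithin] with y hy
    rw [slope_def_field]
    have hy' : x < y := hy
    exact div_nonneg (sub_nonneg.2 (h.mul_sqrt_ratioR_mono (one_pos.trans hx) hy'.le))
      (sub_nonneg.2 hy'.le)
  | succ k => exact h.psiInt_sub_re_nonneg hx k

lemma cMon_sqrt_ratioR (h : Admissible μσ με) (n : ℕ) : CMon n fun x => √(ratioR μσ με x) :=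
  CMon.of_seq (G := psiTaylor μσ με) (c := fun k => (k : ℝ) + 1) (fun k => by positivity)
    (fun k _ hx => h.psiTaylor_nonneg k hx) (fun k _ hx => h.hasDerivAt_psiTaylor k hx) n 0

lemma cMon_deriv (h : Admissible μσ με) (n : ℕ) :
    CMon n fun x => psiTaylor μσ με 0 x - x * psiTaylor μσ με 1 x :=
  CMon.of_seq (G := fun k x => psiTaylor μσ με k x - x * psiTaylor μσ με (k + 1) x)
    (c := fun k => (k : ℝ) + 2) (fun k => by positivity)
    (fun k _ hx => h.psiTaylor_sub_nonneg k hx) (fun k x hx => by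
      refine ((h.hasDerivAt_psiTaylor k hx).fun_sub
        ((hasDerivAt_id x).fun_mul (h.hasDerivAt_psiTaylor (k + 1) hx))).congr_deriv ?_
      simp
      ring) n 0

lemma cMon_exp (h : Admissible μσ με) {c : ℝ} (hc : 0 ≤ c) (n : ℕ) :
    CMon n fun x => Real.exp (-(c * (x * √(ratioR μσ με x)))) :=
  CMon.exp_neg (f := fun x => c * (x * √(ratioR μσ με x)))
    (fun _ hx => (h.hasDerivAt_mul_sqrt_ratioR hx).const_mul c)
    (fun n => (CMon.const hc n).mul (h.cMon_deriv n)) n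

end Admissible

/-! ### The transforms `M(s) exp (-x s Ψ(s))` -/

/-- The transform `M(s) exp (-x s Ψ(s))`. -/
noncomputable def waveKernel (μσ με : Measure ℝ) (M : ℂ → ℂ) (x : ℝ) (s : ℂ) : ℂ :=
  M s * Complex.exp (-(x : ℂ) * s * symbolPsi μσ με s)

/-- An admissible pair for which `exp (-x s Ψ(s))` decays quadratically on the right half-plane,
for every `x > 0`. -/
structure Dissipative (μσ με : Measure ℝ) : Prop extends Admissible μσ με where
  decay : ∀ x : ℝ, 0 < x → ∃ C : ℝ, 0 ≤ C ∧ ∀ s : ℂ, 0 < s.re →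
    ‖Complex.exp (-(x : ℂ) * s * symbolPsi μσ με s)‖ ≤ C / ‖s‖ ^ 2

lemma exp_neg_rpow_le {b p r : ℝ} (hb : 0 < b) {m : ℕ} (hm : 2 ≤ p * m) (hr : 1 ≤ r) :
    Real.exp (-(b * r ^ p)) ≤ (Nat.factorial m / b ^ m) / r ^ 2 := by
  have hr0 : 0 < r := one_pos.trans_le hr
  have h1 := Real.pow_div_factorial_le_exp (x := b * r ^ p) (by positivity) m
  rw [div_le_iff₀ (by positivity), mul_pow, ← Real.rpow_natCast (r ^ p),
    ← Real.rpow_mul hr0.le] at h1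
  have h2 : r ^ 2 ≤ r ^ (p * m) := by
    rw [← Real.rpow_natCast]
    exact Real.rpow_le_rpow_of_exponent_le hr (by exact_mod_cast hm)
  rw [Real.exp_neg, div_div, inv_le_comm₀ (Real.exp_pos _) (by positivity), inv_div,
    div_le_iff₀ (by positivity)]
  exact (mul_le_mul_of_nonneg_left h2 (by positivity)).trans h1

lemma norm_exp_neg_mul (μσ με : Measure ℝ) (x : ℝ) (s : ℂ) :
    ‖Complex.exp (-(x : ℂ) * s * symbolPsi μσ με s)‖ =
      Real.exp (-(x * (s * symbolPsi μσ με s).re)) := by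
  rw [Complex.norm_exp, mul_assoc, ← Complex.ofReal_neg, Complex.re_ofReal_mul, neg_mul]

lemma Admissible.dissipative {μσ με : Measure ℝ} [IsFiniteMeasure μσ] [IsFiniteMeasure με]
    (h : Admissible μσ με) (hprop : ¬ ∃ c : ℝ≥0, μσ = c • με) (hexc : ¬ IsExceptional μσ με) :
    Dissipative μσ με := by
  refine ⟨h, fun x hx => ?_⟩
  obtain ⟨c, hc, p, hp, r₀, hr₀, hb⟩ := h.exists_le_re_mul_symbolPsi hprop hexc
  obtain ⟨m, hm⟩ := exists_nat_ge (2 / p)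
  have hm' : 2 ≤ p * m := by rwa [div_le_iff₀' hp] at hm
  refine ⟨r₀ ^ 2 + Nat.factorial m / (x * c) ^ m, by positivity, fun s hs => ?_⟩
  have hs0 : 0 < ‖s‖ := hs.trans_le (Complex.re_le_norm s)
  rw [norm_exp_neg_mul, add_div]
  rcases le_total r₀ ‖s‖ with hr | hr
  · have h1 := exp_neg_rpow_le (mul_pos hx hc) hm' (hr₀.trans hr)
    have h2 : Real.exp (-(x * (s * symbolPsi μσ με s).re)) ≤ Real.exp (-(x * c * ‖s‖ ^ p)) := by
      rw [mul_assoc]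
      gcongr
      exact hb s hs hr
    have h3 : 0 ≤ r₀ ^ 2 / ‖s‖ ^ 2 := by positivity
    linarith
  · have h1 : 1 ≤ r₀ ^ 2 / ‖s‖ ^ 2 := by
      rw [one_le_div (by positivity)]
      gcongr
    have h2 : Real.exp (-(x * (s * symbolPsi μσ με s).re)) ≤ 1 :=
      Real.exp_le_one_iff.2 (neg_nonpos.2 (mul_nonneg hx.le (h.re_mul_symbolPsi_nonneg hs)))
    have h3 : 0 ≤ (Nat.factorial m / (x * c) ^ m) / ‖s‖ ^ 2 := by positivity
    linarith

/-- A multiplier bounded and holomorphic on every half-plane `a ≤ re s`, `a > 0`. -/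
structure HBounded (M : ℂ → ℂ) : Prop where
  diff : DifferentiableOn ℂ M {s | 0 < s.re}
  bound : ∀ a : ℝ, 0 < a → ∃ C : ℝ, ∀ s : ℂ, a ≤ s.re → ‖M s‖ ≤ C

namespace HBounded

lemma const (c : ℂ) : HBounded fun _ => c :=
  ⟨differentiableOn_const c, fun _ _ => ⟨‖c‖, fun _ _ => le_rfl⟩⟩

lemma inv : HBounded fun s => s⁻¹ := by
  refine ⟨fun s hs => (differentiableAt_inv fun h => ?_).differentiableWithinAt,
    fun a ha => ⟨a⁻¹, fun s hs => ?_⟩⟩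
  · have hs' : 0 < s.re := hs
    simp [h] at hs'
  · rw [norm_inv]
    exact inv_anti₀ ha (hs.trans (Complex.re_le_norm s))

lemma mul {M N : ℂ → ℂ} (hM : HBounded M) (hN : HBounded N) : HBounded fun s => M s * N s := by
  refine ⟨hM.diff.mul hN.diff, fun a ha => ?_⟩
  obtain ⟨C, hC⟩ := hM.bound a ha
  obtain ⟨D, hD⟩ := hN.bound a ha
  refine ⟨C * D, fun s hs => ?_⟩
  rw [norm_mul]
  exact mul_le_mul (hC s hs) (hD s hs) (norm_nonneg _) ((norm_nonneg _).trans (hC s hs))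

end HBounded

lemma re_pos_mem_slitPlane {s : ℂ} (hs : 0 < s.re) : s ∈ Complex.slitPlane :=
  Complex.mem_slitPlane_iff.2 (Or.inl hs)

lemma Admissible.hBounded_symbolPsi {μσ με : Measure ℝ} [IsFiniteMeasure μσ] [IsFiniteMeasure με]
    (h : Admissible μσ με) : HBounded (symbolPsi μσ με) := by
  refine ⟨fun s hs => (h.differentiableAt_symbolPsi
    (re_pos_mem_slitPlane hs)).differentiableWithinAt,
    fun a ha => ⟨√(2 * ratioR μσ με a), fun s hs => Real.le_sqrt_of_sq_le ?_⟩⟩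
  have hs0 : 0 < s.re := ha.trans_le hs
  have h1 := h.norm_symbolPsi_sq_le (re_pos_mem_slitPlane hs0)
  have h2 := h.ratioR_anti ha (hs.trans (Complex.re_le_norm s))
  have h3 := half_le_cos_half_arg hs0
  nlinarith [sq_nonneg ‖symbolPsi μσ με s‖]

namespace Dissipative

variable {μσ με : Measure ℝ} [IsFiniteMeasure μσ] [IsFiniteMeasure με]

lemma hDecay (h : Dissipative μσ με) {M : ℂ → ℂ} (hM : HBounded M) {x : ℝ} (hx : 0 < x) :
    HDecay (waveKernel μσ με M x) := by
  obtain ⟨C, hC0, hC⟩ := h.decay x hx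
  constructor
  · exact hM.diff.mul (((differentiableOn_const _).mul differentiableOn_id).mul
      h.toAdmissible.hBounded_symbolPsi.diff).cexp
  · intro a ha
    obtain ⟨D, hD⟩ := hM.bound a ha
    refine ⟨D * C, fun s hs => ?_⟩
    rw [waveKernel, norm_mul, mul_div_assoc]
    exact mul_le_mul (hD s hs) (hC s (ha.trans_le hs)) (norm_nonneg _)
      ((norm_nonneg _).trans (hD s hs))

lemma invL_nonneg (h : Dissipative μσ με) {M : ℂ → ℂ} (hM : HBounded M) {m : ℝ → ℝ}
    (hm : ∀ n, CMon n m) (hMm : ∀ r : ℝ, 1 < r → M r = m r) {x : ℝ} (hx : 0 < x) (t : ℝ) :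
    ∃ r : ℝ, 0 ≤ r ∧ invL (waveKernel μσ με M x) t = r := by
  refine (h.hDecay hM hx).invL_nonneg
    (fun n => (hm n).mul (h.toAdmissible.cMon_exp hx.le n)) (fun r hr => ?_) t
  rw [waveKernel, hMm r hr, h.toAdmissible.symbolPsi_ofReal (one_pos.trans hr)]
  push_cast
  ring_nf

end Dissipative

lemma CMon.inv (n : ℕ) : CMon n fun x => x⁻¹ := by
  have := CMon.of_seq (G := fun k x => (x ^ (k + 1))⁻¹) (c := fun k => (k : ℝ) + 1)
    (fun k => by positivity) (fun k x hx => by positivity) (fun k x hx => by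
      have hx0 : x ≠ 0 := (one_pos.trans hx).ne'
      refine ((hasDerivAt_pow (k + 1) x).fun_inv (pow_ne_zero _ hx0)).congr_deriv ?_
      push_cast
      field_simp
      simp
      ring) n 0
  simpa using this

/-- The probability density in `t` with Laplace transform `exp (-x s Ψ(s))`. -/
noncomputable def waveDensity (μσ με : Measure ℝ) (x t : ℝ) : ℝ :=
  (invL (waveKernel μσ με (fun _ => 1) x) t).re

/-- The distribution function of `waveDensity`, with Laplace transform `exp (-x s Ψ(s)) / s`. -/
noncomputable def waveDist (μσ με : Measure ℝ) (x t : ℝ) : ℝ :=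
  (invL (waveKernel μσ με (fun s => s⁻¹) x) t).re

/-- The time derivative of the fundamental solution for `x > 0`, with Laplace transform
`Ψ(s) / 2 * exp (-x s Ψ(s))`. -/
noncomputable def waveFlux (μσ με : Measure ℝ) (x t : ℝ) : ℝ :=
  (invL (waveKernel μσ με (fun s => symbolPsi μσ με s * 2⁻¹) x) t).re

namespace Dissipative

variable {μσ με : Measure ℝ} [IsFiniteMeasure μσ] [IsFiniteMeasure με]

lemma hBounded_half_symbolPsi (h : Dissipative μσ με) :
    HBounded fun s => symbolPsi μσ με s * 2⁻¹ :=
  h.toAdmissible.hBounded_symbolPsi.mul (HBounded.const 2⁻¹)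

lemma waveDensity_spec (h : Dissipative μσ με) {x : ℝ} (hx : 0 < x) (t : ℝ) :
    0 ≤ waveDensity μσ με x t ∧
      invL (waveKernel μσ με (fun _ => 1) x) t = waveDensity μσ με x t := by
  obtain ⟨r, hr, e⟩ := h.invL_nonneg (HBounded.const 1) (m := fun _ => 1)
    (CMon.const zero_le_one) (fun _ _ => by simp) hx t
  rw [waveDensity, e, Complex.ofReal_re]
  exact ⟨hr, rfl⟩

lemma waveFlux_spec (h : Dissipative μσ με) {x : ℝ} (hx : 0 < x) (t : ℝ) :
    0 ≤ waveFlux μσ με x t ∧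
      invL (waveKernel μσ με (fun s => symbolPsi μσ με s * 2⁻¹) x) t = waveFlux μσ με x t := by
  obtain ⟨r, hr, e⟩ := h.invL_nonneg h.hBounded_half_symbolPsi
    (m := fun x => √(ratioR μσ με x) * 2⁻¹)
    (fun n => (h.toAdmissible.cMon_sqrt_ratioR n).mul (CMon.const (by norm_num) n))
    (fun r hr => by rw [h.toAdmissible.symbolPsi_ofReal (one_pos.trans hr)]; push_cast; rfl) hx t
  rw [waveFlux, e, Complex.ofReal_re]
  exact ⟨hr, rfl⟩

lemma waveDist_nonneg (h : Dissipative μσ με) {x : ℝ} (hx : 0 < x) (t : ℝ) :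
    0 ≤ waveDist μσ με x t := by
  obtain ⟨r, hr, e⟩ := h.invL_nonneg HBounded.inv (m := fun x => x⁻¹) CMon.inv
    (fun _ _ => by simp) hx t
  rwa [waveDist, e, Complex.ofReal_re]

lemma hasDerivAt_waveDist_time (h : Dissipative μσ με) {x : ℝ} (hx : 0 < x) (t : ℝ) :
    HasDerivAt (waveDist μσ με x) (waveDensity μσ με x t) t := by
  refine Complex.reCLM.hasFDerivAt.comp_hasDerivAt t (HDecay.hasDerivAt_invL
    (h.hDecay HBounded.inv hx) (h.hDecay (HBounded.const 1) hx) (fun s hs => ?_) t)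
  have hs0 : s ≠ 0 := fun e => by simp [e] at hs
  rw [waveKernel, waveKernel, ← mul_assoc, mul_inv_cancel₀ hs0]

/-- In `x` the distribution function is a primitive of the flux. -/
lemma hasDerivAt_waveDist_space (h : Dissipative μσ με) {x : ℝ} (hx : 0 < x) (t : ℝ) :
    HasDerivAt (fun x => waveDist μσ με x t) (-(2 * waveFlux μσ με x t)) x := by
  have hi : ∀ {M : ℂ → ℂ}, HBounded M → ∀ {x : ℝ}, 0 < x → Integrable fun y : ℝ =>
      waveKernel μσ με M x (1 + y * Complex.I) * Complex.exp ((1 + y * Complex.I) * t) :=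
    fun hM x hx => by simpa using (h.hDecay hM hx).integrable_line_exp one_pos t
  have hψ := h.hBounded_half_symbolPsi
  have hx2 : 0 < x / 2 := by positivity
  have key := (hasDerivAt_integral_of_dominated_loc_of_deriv_le (μ := volume)
    (F := fun (x : ℝ) (y : ℝ) => waveKernel μσ με (fun s => s⁻¹) x (1 + y * Complex.I) *
      Complex.exp ((1 + y * Complex.I) * t))
    (F' := fun (x : ℝ) (y : ℝ) =>
      -2 * (waveKernel μσ με (fun s => symbolPsi μσ με s * 2⁻¹) x (1 + y * Complex.I) *
      Complex.exp ((1 + y * Complex.I) * t)))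
    (bound := fun y : ℝ => 2 * ‖waveKernel μσ με (fun s => symbolPsi μσ με s * 2⁻¹) (x / 2)
      (1 + y * Complex.I) * Complex.exp ((1 + y * Complex.I) * t)‖)
    (Ioi_mem_nhds (show x / 2 < x by linarith)) ?_ ?_ ?_ ?_ ?_ ?_).2
  · have k2 := Complex.reCLM.hasFDerivAt.comp_hasDerivAt x (key.const_mul (2 * (Real.pi : ℂ))⁻¹)
    refine k2.congr_deriv ?_
    rw [integral_const_mul, waveFlux, invL, ← mul_assoc, mul_comm _ (-2 : ℂ), mul_assoc]
    simp
  · filter_upwards [Ioi_mem_nhds hx] with x' hx'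
    exact (hi HBounded.inv hx').aestronglyMeasurable
  · exact hi HBounded.inv hx
  · exact ((hi hψ hx).const_mul _).aestronglyMeasurable
  · refine Eventually.of_forall fun y x' hx' => ?_
    have hx'' : x / 2 < x' := hx'
    simp only [waveKernel, norm_mul, norm_exp_neg_mul, norm_neg, Complex.norm_ofNat]
    have := h.toAdmissible.re_mul_symbolPsi_nonneg (s := 1 + y * Complex.I) (by simp)
    gcongr
  · exact (hi hψ hx2).norm.const_mul _
  · refine Eventually.of_forall fun y x' _ => ?_
    have hs0 : (1 + y * Complex.I : ℂ) ≠ 0 := by simpa using line_ne_zero one_pos y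
    have h1 : HasDerivAt (fun x : ℝ => -(x : ℂ) * (1 + y * Complex.I) *
        symbolPsi μσ με (1 + y * Complex.I))
        (-1 * (1 + y * Complex.I) * symbolPsi μσ με (1 + y * Complex.I)) x' := by
      simpa using ((Complex.ofRealCLM.hasDerivAt (x := x')).neg.mul_const
        (1 + y * Complex.I : ℂ)).mul_const (symbolPsi μσ με (1 + y * Complex.I))
    refine ((h1.cexp.const_mul _).mul_const _).congr_deriv ?_
    simp only [waveKernel]
    field_simp

lemma waveDist_zero (h : Dissipative μσ με) {x : ℝ} (hx : 0 < x) : waveDist μσ με x 0 = 0 := by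
  rw [waveDist, (h.hDecay HBounded.inv hx).invL_eq_zero le_rfl, Complex.zero_re]

lemma continuous_waveDensity (h : Dissipative μσ με) {x : ℝ} (hx : 0 < x) :
    Continuous (waveDensity μσ με x) :=
  Complex.continuous_re.comp (h.hDecay (HBounded.const 1) hx).continuous_invL

/-- Transform of the density at a real point. -/
lemma integral_exp_mul_waveDensity (h : Dissipative μσ με) {x r : ℝ} (hx : 0 < x) (hr : 0 < r) :
    IntegrableOn (fun u => Real.exp (-(r * u)) * waveDensity μσ με x u) (Ioi 0) ∧
    ∫ u in Ioi (0 : ℝ), Real.exp (-(r * u)) * waveDensity μσ με x u =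
      Real.exp (-(x * (r * √(ratioR μσ με r)))) := by
  have hF := h.hDecay (HBounded.const 1) hx
  have e : ∀ u : ℝ, Complex.exp (-((r * u : ℝ) : ℂ)) *
      invL (waveKernel μσ με (fun _ => 1) x) u =
      ((Real.exp (-(r * u)) * waveDensity μσ με x u : ℝ) : ℂ) := fun u => by
    rw [(h.waveDensity_spec hx u).2]
    push_cast
    rfl
  have h1 := hF.integrable_exp_mul_invL hr
  simp_rw [e] at h1
  refine ⟨(Complex.reCLM.integrable_comp h1).integrableOn, ?_⟩
  have h2 := hF.laplace_invL (z := r) (by simpa using hr)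
  have e' : ∀ u : ℝ, -(r : ℂ) * u = -((r * u : ℝ) : ℂ) := fun u => by push_cast; ring
  simp_rw [e', e] at h2
  rw [integral_complex_ofReal, waveKernel, h.toAdmissible.symbolPsi_ofReal hr] at h2
  have h3 : (1 : ℂ) * Complex.exp (-(x : ℂ) * r * ((√(ratioR μσ με r) : ℝ) : ℂ)) =
      ((Real.exp (-(x * (r * √(ratioR μσ με r)))) : ℝ) : ℂ) := by
    push_cast
    ring_nf
  rw [h3] at h2
  exact_mod_cast h2

lemma waveDist_eq_integral (h : Dissipative μσ με) {x t : ℝ} (hx : 0 < x) (ht : 0 ≤ t) :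
    waveDist μσ με x t = ∫ u in Ioc 0 t, waveDensity μσ με x u := by
  rw [← intervalIntegral.integral_of_le ht, intervalIntegral.integral_eq_sub_of_hasDerivAt
    (fun u _ => h.hasDerivAt_waveDist_time hx u)
    ((h.continuous_waveDensity hx).intervalIntegrable _ _), h.waveDist_zero hx, sub_zero]

end Dissipative

/-! ### Concentration of the density -/

/-- The cubic `1 - (1 - y)² (1 + M y)` has no constant term, equals `1` at `y = 1` and is at most
`1` for `y ≥ 0`. -/
lemma cubic_le_one {M y : ℝ} (hM : 0 ≤ M) (hy : 0 ≤ y) :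
    (2 - M) * y + (2 * M - 1) * y ^ 2 - M * y ^ 3 ≤ 1 := by
  have : 0 ≤ (1 - y) ^ 2 * (1 + M * y) := by positivity
  linarith [this, show (1 - y) ^ 2 * (1 + M * y) =
    1 - ((2 - M) * y + (2 * M - 1) * y ^ 2 - M * y ^ 3) by ring]

/-- For `M = 2 / (1 - b)²` the cubic `1 - (1 - y)² (1 + M y)` is non-positive on `[0, b]`. -/
lemma cubic_nonpos {b y : ℝ} (hb : b < 1) (hy : 0 ≤ y) (hyb : y ≤ b) :
    (2 - 2 / (1 - b) ^ 2) * y + (2 * (2 / (1 - b) ^ 2) - 1) * y ^ 2 -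
      2 / (1 - b) ^ 2 * y ^ 3 ≤ 0 := by
  have h1 : 0 < 1 - b := by linarith
  have h2 : 2 / (1 - b) ^ 2 * (1 - b) ^ 2 = 2 := by field_simp
  have h3 : 2 ≤ 2 / (1 - b) ^ 2 * (1 - y) ^ 2 := by
    refine h2.symm.le.trans ?_
    have : 1 - b ≤ 1 - y := by linarith
    gcongr
  set M := 2 / (1 - b) ^ 2
  have : 0 ≤ y * (M * (1 - y) ^ 2 - 2 + y) := mul_nonneg hy (by linarith)
  linarith [this, show y * (M * (1 - y) ^ 2 - 2 + y) =
    -((2 - M) * y + (2 * M - 1) * y ^ 2 - M * y ^ 3) by ring]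

namespace Dissipative

variable {μσ με : Measure ℝ} [IsFiniteMeasure μσ] [IsFiniteMeasure με]

/-- Chernoff's bound. -/
lemma waveDist_le_exp (h : Dissipative μσ με) {x t r : ℝ} (hx : 0 < x) (ht : 0 ≤ t) (hr : 0 < r) :
    waveDist μσ με x t ≤ Real.exp (r * t - x * (r * √(ratioR μσ με r))) := by
  obtain ⟨h1, h2⟩ := h.integral_exp_mul_waveDensity hx hr
  rw [sub_eq_add_neg, Real.exp_add, ← h2, ← integral_const_mul, h.waveDist_eq_integral hx ht]
  have hi := (h.continuous_waveDensity hx).integrableOn_Ioc (a := 0) (b := t) (μ := volume)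
  calc ∫ u in Ioc 0 t, waveDensity μσ με x u
      ≤ ∫ u in Ioc 0 t, Real.exp (r * t) * (Real.exp (-(r * u)) * waveDensity μσ με x u) := by
        refine setIntegral_mono_on hi
          (IntegrableOn.mono_set (h1.const_mul _) Ioc_subset_Ioi_self) measurableSet_Ioc ?_
        intro u hu
        rw [← mul_assoc, ← Real.exp_add]
        refine le_mul_of_one_le_left (h.waveDensity_spec hx u).1 (Real.one_le_exp ?_)
        nlinarith [hu.2]
    _ ≤ _ := by
        refine setIntegral_mono_set (h1.const_mul _) (Eventually.of_forall fun u => ?_)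
          Ioc_subset_Ioi_self.eventuallyLE
        have := (h.waveDensity_spec hx u).1
        show 0 ≤ _
        positivity

lemma waveDist_le_one (h : Dissipative μσ με) {x t : ℝ} (hx : 0 < x) (ht : 0 ≤ t) :
    waveDist μσ με x t ≤ 1 := by
  have hlim : Tendsto (fun r : ℝ => Real.exp (r * t)) (𝓝[>] 0) (𝓝 1) := by
    have : Tendsto (fun r : ℝ => Real.exp (r * t)) (𝓝 0) (𝓝 (Real.exp (0 * t))) :=
      Continuous.tendsto (by fun_prop) 0
    rw [zero_mul, Real.exp_zero] at this
    exact this.mono_left nhdsWithin_le_nhds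
  refine ge_of_tendsto hlim ?_
  filter_upwards [self_mem_nhdsWithin] with r hr
  have hr' : 0 < r := hr
  refine (h.waveDist_le_exp hx ht hr').trans (Real.exp_le_exp.2 ?_)
  have : 0 ≤ x * (r * √(ratioR μσ με r)) := by positivity
  linarith

/-- Chebyshev-type lower bound: test the density against a cubic in `exp (-u / t) / q` that lies
below the indicator function of `u ≤ t`. Without a constant term, only values of the Laplace
transform at positive points occur. -/
lemma le_waveDist (h : Dissipative μσ με) {x t q : ℝ} (hx : 0 < x) (ht : 0 < t)
    (hq : Real.exp (-1) < q) : ∃ M : ℝ, M = 2 / (1 - Real.exp (-1) / q) ^ 2 ∧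
    (2 - M) * (Real.exp (-(x * (1 / t * √(ratioR μσ με (1 / t))))) / q) +
    (2 * M - 1) * (Real.exp (-(x * (2 / t * √(ratioR μσ με (2 / t))))) / q ^ 2) -
    M * (Real.exp (-(x * (3 / t * √(ratioR μσ με (3 / t))))) / q ^ 3) ≤ waveDist μσ με x t := by
  have hq0 : 0 < q := (Real.exp_pos _).trans hq
  refine ⟨_, rfl, ?_⟩
  have hb : Real.exp (-1) / q < 1 := (div_lt_one hq0).2 hq
  have hMb : ∀ y : ℝ, 0 ≤ y → y ≤ Real.exp (-1) / q → _ := fun y => cubic_nonpos hb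
  have hM0 : 0 ≤ 2 / (1 - Real.exp (-1) / q) ^ 2 := by positivity
  set M := 2 / (1 - Real.exp (-1) / q) ^ 2
  obtain ⟨i1, e1⟩ := h.integral_exp_mul_waveDensity hx (show 0 < 1 / t by positivity)
  obtain ⟨i2, e2⟩ := h.integral_exp_mul_waveDensity hx (show 0 < 2 / t by positivity)
  obtain ⟨i3, e3⟩ := h.integral_exp_mul_waveDensity hx (show 0 < 3 / t by positivity)
  set f : ℝ → ℝ := fun u => (2 - M) / q * (Real.exp (-(1 / t * u)) * waveDensity μσ με x u) +
    (2 * M - 1) / q ^ 2 * (Real.exp (-(2 / t * u)) * waveDensity μσ με x u) -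
    M / q ^ 3 * (Real.exp (-(3 / t * u)) * waveDensity μσ με x u) with hf
  have i12 : IntegrableOn (fun u =>
      (2 - M) / q * (Real.exp (-(1 / t * u)) * waveDensity μσ με x u) +
      (2 * M - 1) / q ^ 2 * (Real.exp (-(2 / t * u)) * waveDensity μσ με x u)) (Ioi 0) :=
    (i1.const_mul ((2 - M) / q)).add (i2.const_mul ((2 * M - 1) / q ^ 2))
  have i4 : IntegrableOn f (Ioi 0) := i12.sub (i3.const_mul (M / q ^ 3))
  have hfy : ∀ u : ℝ, f u = ((2 - M) * (Real.exp (-(1 / t * u)) / q) +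
      (2 * M - 1) * (Real.exp (-(1 / t * u)) / q) ^ 2 - M * (Real.exp (-(1 / t * u)) / q) ^ 3) *
      waveDensity μσ με x u := by
    intro u
    have p2 : Real.exp (-(2 / t * u)) = Real.exp (-(1 / t * u)) ^ 2 := by
      rw [← Real.exp_nat_mul]; congr 1; push_cast; ring
    have p3 : Real.exp (-(3 / t * u)) = Real.exp (-(1 / t * u)) ^ 3 := by
      rw [← Real.exp_nat_mul]; congr 1; push_cast; ring
    simp only [hf]
    rw [p2, p3]
    ring
  have hint : ∫ u in Ioi (0 : ℝ), f u =
      (2 - M) * (Real.exp (-(x * (1 / t * √(ratioR μσ με (1 / t))))) / q) +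
      (2 * M - 1) * (Real.exp (-(x * (2 / t * √(ratioR μσ με (2 / t))))) / q ^ 2) -
      M * (Real.exp (-(x * (3 / t * √(ratioR μσ με (3 / t))))) / q ^ 3) := by
    rw [← e1, ← e2, ← e3]
    simp only [hf]
    rw [integral_sub i12 (i3.const_mul (M / q ^ 3)),
      integral_add (i1.const_mul ((2 - M) / q)) (i2.const_mul ((2 * M - 1) / q ^ 2)),
      integral_const_mul, integral_const_mul, integral_const_mul]
    ring
  rw [← hint, ← Ioc_union_Ioi_eq_Ioi ht.le, setIntegral_union (Ioc_disjoint_Ioi le_rfl)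
    measurableSet_Ioi (i4.mono_set Ioc_subset_Ioi_self) (i4.mono_set (Ioi_subset_Ioi ht.le)),
    h.waveDist_eq_integral hx ht.le]
  have g1 : ∫ u in Ioi t, f u ≤ 0 := by
    refine setIntegral_nonpos measurableSet_Ioi fun u hu => ?_
    have hu' : t < u := hu
    rw [hfy]
    refine mul_nonpos_of_nonpos_of_nonneg (hMb _ (by positivity) ?_) (h.waveDensity_spec hx u).1
    gcongr
    rw [one_div_mul_eq_div, one_le_div ht]
    exact hu'.le
  have g2 : ∫ u in Ioc 0 t, f u ≤ ∫ u in Ioc 0 t, waveDensity μσ με x u := by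
    refine setIntegral_mono_on (i4.mono_set Ioc_subset_Ioi_self)
      (h.continuous_waveDensity hx).integrableOn_Ioc measurableSet_Ioc fun u _ => ?_
    rw [hfy]
    exact mul_le_of_le_one_left (h.waveDensity_spec hx u).1 (cubic_le_one hM0 (by positivity))
  linarith

/-- If the transform at `j / t`, `j = 1, 2, 3`, tends to `qʲ` with `q > 1 / e`, then the
distribution function at `t` tends to `1`. -/
lemma tendsto_waveDist_one (h : Dissipative μσ με) {ι : Type*} {l : Filter ι} {x t : ι → ℝ} {q : ℝ}
    (hx : ∀ᶠ i in l, 0 < x i) (ht : ∀ᶠ i in l, 0 < t i) (hq : Real.exp (-1) < q)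
    (hlim : ∀ j : ℕ, 0 < j → Tendsto (fun i => Real.exp (-(x i * (j / t i *
      √(ratioR μσ με (j / t i)))))) l (𝓝 (q ^ j))) :
    Tendsto (fun i => waveDist μσ με (x i) (t i)) l (𝓝 1) := by
  have hq0 : 0 < q := (Real.exp_pos _).trans hq
  set M := 2 / (1 - Real.exp (-1) / q) ^ 2
  have l1 := hlim 1 (by norm_num)
  have l2 := hlim 2 (by norm_num)
  have l3 := hlim 3 (by norm_num)
  push_cast at l1 l2 l3
  have hlow := ((((l1.div_const q).const_mul (2 - M)).add
    ((l2.div_const (q ^ 2)).const_mul (2 * M - 1))).sub ((l3.div_const (q ^ 3)).const_mul M))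
  have hval : (2 - M) * (q ^ 1 / q) + (2 * M - 1) * (q ^ 2 / q ^ 2) - M * (q ^ 3 / q ^ 3) = 1 := by
    field_simp
    ring
  rw [hval] at hlow
  refine tendsto_of_tendsto_of_tendsto_of_le_of_le' hlow tendsto_const_nhds ?_ ?_
  · filter_upwards [hx, ht] with i hxi hti
    obtain ⟨_, rfl, hle⟩ := h.le_waveDist hxi hti hq
    exact hle
  · filter_upwards [hx, ht] with i hxi hti
    exact h.waveDist_le_one hxi hti.le

/-- The profile in `r = x / t` below the speed `1 / √m`. -/
lemma tendsto_waveDist_ray_one (h : Dissipative μσ με) {l : Filter ℝ} {m r : ℝ}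
    (hl : ∀ᶠ t in l, 0 < t)
    (hR : ∀ j : ℕ, 0 < j → Tendsto (fun t : ℝ => ratioR μσ με (j / t)) l (𝓝 m)) (hr : 0 < r)
    (hrm : r * √m < 1) : Tendsto (fun t => waveDist μσ με (r * t) t) l (𝓝 1) := by
  refine h.tendsto_waveDist_one (q := Real.exp (-(r * √m)))
    (by filter_upwards [hl] with t ht using mul_pos hr ht) hl
    (Real.exp_lt_exp.2 (by linarith)) fun j hj => ?_
  have h1 := (((hR j hj).sqrt.const_mul (r * j)).neg).rexp
  rw [← Real.exp_nat_mul, show (j : ℝ) * -(r * √m) = -(r * j * √m) by ring]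
  refine h1.congr' ?_
  filter_upwards [hl] with t ht
  congr 2
  field_simp

/-- The profile in `r = x / t` above the speed `1 / √m`. -/
lemma tendsto_waveDist_ray_zero (h : Dissipative μσ με) {l : Filter ℝ} {m r : ℝ}
    (hl : ∀ᶠ t in l, 0 < t)
    (hR : ∀ j : ℕ, 0 < j → Tendsto (fun t : ℝ => ratioR μσ με (j / t)) l (𝓝 m)) (hr : 0 < r)
    (hrm : 1 < r * √m) : Tendsto (fun t => waveDist μσ με (r * t) t) l (𝓝 0) := by
  have hb : ∀ j : ℕ, 0 < j → ∀ t : ℝ, 0 < t →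
      waveDist μσ με (r * t) t ≤ Real.exp (j - r * j * √(ratioR μσ με (j / t))) := by
    intro j hj t ht
    have hj' : (0 : ℝ) < j := by exact_mod_cast hj
    refine (h.waveDist_le_exp (mul_pos hr ht) ht.le (div_pos hj' ht)).trans_eq ?_
    congr 1
    field_simp
  rw [Metric.tendsto_nhds]
  intro ε hε
  have hd : 0 < r * √m - 1 := by linarith
  have hlim : Tendsto (fun j : ℕ => Real.exp (-((r * √m - 1) * j))) atTop (𝓝 0) :=
    Real.tendsto_exp_neg_atTop_nhds_zero.comp (tendsto_natCast_atTop_atTop.const_mul_atTop hd)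
  obtain ⟨j, hjε, hj⟩ := ((hlim.eventually_lt_const hε).and (eventually_gt_atTop 0)).exists
  have h1 := (((hR j hj).sqrt.const_mul (r * j)).const_sub (j : ℝ)).rexp
  have h2 := h1.eventually_lt_const (u := ε) (by
    rwa [show (j : ℝ) - r * j * √m = -((r * √m - 1) * j) by ring])
  filter_upwards [hl, h2] with t ht h2t
  rw [Real.dist_eq, sub_zero, abs_of_nonneg (h.waveDist_nonneg (mul_pos hr ht) t)]
  exact (hb j hj t ht).trans_lt h2t

lemma tendsto_waveDist_space_zero (h : Dissipative μσ με) {t : ℝ} (ht : 0 < t) :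
    Tendsto (fun r => waveDist μσ με (r * t) t) (𝓝[>] 0) (𝓝 1) := by
  refine h.tendsto_waveDist_one (x := fun r => r * t) (t := fun _ => t) (q := 1)
    (by filter_upwards [self_mem_nhdsWithin] with r hr using mul_pos hr ht)
    (Eventually.of_forall fun _ => ht) (by rw [Real.exp_lt_one_iff]; norm_num) fun j _ => ?_
  have : Tendsto (fun r : ℝ => Real.exp (-(r * t * (j / t * √(ratioR μσ με (j / t)))))) (𝓝 0)
    (𝓝 (Real.exp (-(0 * t * (j / t * √(ratioR μσ με (j / t))))))) :=
    Continuous.tendsto (by fun_prop) 0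
  rw [zero_mul, zero_mul, neg_zero, Real.exp_zero] at this
  rw [one_pow]
  exact this.mono_left nhdsWithin_le_nhds

lemma tendsto_waveDist_space_atTop (h : Dissipative μσ με) {t : ℝ} (ht : 0 < t) :
    Tendsto (fun r => waveDist μσ με (r * t) t) atTop (𝓝 0) := by
  have hR := Real.sqrt_pos.2 (h.toAdmissible.ratioR_pos one_pos)
  have hlim : Tendsto (fun r : ℝ => Real.exp (t - r * t * √(ratioR μσ με 1))) atTop (𝓝 0) := by
    refine Real.tendsto_exp_atBot.comp ?_
    have : Tendsto (fun r : ℝ => r * (t * √(ratioR μσ με 1))) atTop atTop :=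
      tendsto_id.atTop_mul_const (mul_pos ht hR)
    refine (tendsto_atBot_add_const_left _ t (tendsto_neg_atTop_atBot.comp this)).congr fun r => ?_
    simp
    ring
  refine tendsto_of_tendsto_of_tendsto_of_le_of_le' tendsto_const_nhds hlim ?_ ?_
  · filter_upwards [eventually_gt_atTop 0] with r hr using h.waveDist_nonneg (mul_pos hr ht) t
  · filter_upwards [eventually_gt_atTop 0] with r hr
    have := h.waveDist_le_exp (mul_pos hr ht) ht.le one_pos
    simpa using this

end Dissipative

/-! ### Weak velocities -/

/-- The fundamental solution. -/
noncomputable def waveS (μσ με : Measure ℝ) (x t : ℝ) : ℂ := invL (laplaceS μσ με x) t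

/-- The time derivative of the fundamental solution. -/
noncomputable def waveK (μσ με : Measure ℝ) (x t : ℝ) : ℂ :=
  invL (waveKernel μσ με (fun s => symbolPsi μσ με s * 2⁻¹) |x|) t

namespace Dissipative

variable {μσ με : Measure ℝ} [IsFiniteMeasure μσ] [IsFiniteMeasure με]

lemma hasDerivAt_waveDist_ray (h : Dissipative μσ με) {r t : ℝ} (hr : 0 < r) (ht : 0 < t) :
    HasDerivAt (fun r => waveDist μσ με (r * t) t) (-2 * (t * waveFlux μσ με (r * t) t)) r := by
  have h1 : HasDerivAt (fun r : ℝ => r * t) t r := by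
    simpa using (hasDerivAt_id r).mul_const t
  refine ((h.hasDerivAt_waveDist_space (mul_pos hr ht) t).comp r h1).congr_deriv ?_
  ring

/-- The flux is minus half the derivative of a bounded monotone function. -/
lemma integrableOn_waveFlux (h : Dissipative μσ με) {t : ℝ} (ht : 0 < t) :
    IntegrableOn (fun r => t * waveFlux μσ με (r * t) t) (Ioi 0) := by
  -- continuous extension of the distribution function to `r = 0`
  set G : ℝ → ℝ := fun r => if 0 < r then waveDist μσ με (r * t) t else 1 with hG
  have hGpos : ∀ r, 0 < r → G r = waveDist μσ με (r * t) t := fun r hr => if_pos hr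
  have h1 : IntegrableOn (fun r => -2 * (t * waveFlux μσ με (r * t) t)) (Ioi 0) := by
    refine integrableOn_Ioi_deriv_of_nonpos (g := G) (l := 0) ?_ (fun r hr => ?_)
      (fun r hr => ?_) ?_
    · rw [← continuousWithinAt_Ioi_iff_Ici, ContinuousWithinAt]
      have h0 : G 0 = 1 := if_neg (lt_irrefl 0)
      rw [h0]
      refine (h.tendsto_waveDist_space_zero ht).congr' ?_
      filter_upwards [self_mem_nhdsWithin] with r hr using (hGpos r hr).symm
    · refine (h.hasDerivAt_waveDist_ray hr ht).congr_of_eventuallyEq ?_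
      filter_upwards [Ioi_mem_nhds hr] with y hy using hGpos y hy
    · have := mul_nonneg ht.le (h.waveFlux_spec (mul_pos hr ht) t).1
      linarith
    · refine (h.tendsto_waveDist_space_atTop ht).congr' ?_
      filter_upwards [eventually_gt_atTop 0] with r hr using (hGpos r hr).symm
  refine (h1.const_mul (-(1 / 2))).congr (Eventually.of_forall fun r => ?_)
  simp only
  ring

/-- Integration by parts in `r = x / t`; the distribution function tends to `1` as `r → 0`. -/
lemma integral_waveFlux_mul (h : Dissipative μσ με) {t : ℝ} (ht : 0 < t) {φ : ℝ → ℂ}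
    (hφ : ContDiff ℝ ∞ φ) (hc : HasCompactSupport φ) :
    ∫ r in Ioi (0 : ℝ), φ r * ((t * waveFlux μσ με (r * t) t : ℝ) : ℂ) =
      1 / 2 * (φ 0 + ∫ r in Ioi (0 : ℝ), deriv φ r * (waveDist μσ με (r * t) t : ℂ)) := by
  have hd : ∀ r, HasDerivAt φ (deriv φ r) r := fun r =>
    (hφ.differentiable (by simp) r).hasDerivAt
  have hdc : Continuous (deriv φ) := hφ.continuous_deriv (by simp)
  have hdi : Integrable (deriv φ) := hdc.integrable_of_hasCompactSupport hc.deriv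
  have hv : ∀ r ∈ Ioi (0 : ℝ), HasDerivAt (fun r => (waveDist μσ με (r * t) t : ℂ))
      ((-2 * (t * waveFlux μσ με (r * t) t) : ℝ) : ℂ) r := fun r hr =>
    (h.hasDerivAt_waveDist_ray hr ht).ofReal_comp
  obtain ⟨C, hC⟩ := hφ.continuous.bounded_above_of_compact_support hc
  have hflux : IntegrableOn (fun r => ((-2 * (t * waveFlux μσ με (r * t) t) : ℝ) : ℂ)) (Ioi 0) :=
    ((h.integrableOn_waveFlux ht).const_mul (-2)).ofReal
  have hvc : ContinuousOn (fun r => (waveDist μσ με (r * t) t : ℂ)) (Ioi 0) := fun r hr =>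
    (hv r hr).continuousAt.continuousWithinAt
  have z1 : Tendsto (fun r => φ r * (waveDist μσ με (r * t) t : ℂ)) (𝓝[>] 0) (𝓝 (φ 0)) := by
    have e1 := (hφ.continuous.tendsto 0).mono_left (nhdsWithin_le_nhds (s := Ioi 0))
    have e2 := (Complex.continuous_ofReal.tendsto 1).comp (h.tendsto_waveDist_space_zero ht)
    simpa using e1.mul e2
  have z2 : Tendsto (fun r => φ r * (waveDist μσ με (r * t) t : ℂ)) atTop (𝓝 0) := by
    have e2 := (Complex.continuous_ofReal.tendsto 0).comp (h.tendsto_waveDist_space_atTop ht)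
    rw [Complex.ofReal_zero] at e2
    simpa [mul_comm] using e2.zero_mul_isBoundedUnder_le (g := φ) (isBoundedUnder_of ⟨C, hC⟩)
  have key := integral_Ioi_mul_deriv_eq_deriv_mul (a := 0) (fun r _ => hd r) hv
    (hflux.bdd_mul (c := C) hφ.continuous.aestronglyMeasurable (Eventually.of_forall hC))
    (hdi.integrableOn.mul_bdd (c := 1) (hvc.aestronglyMeasurable measurableSet_Ioi) ?_) z1 z2
  · have e : ∀ r : ℝ, φ r * ((-2 * (t * waveFlux μσ με (r * t) t) : ℝ) : ℂ) =
        -2 * (φ r * ((t * waveFlux μσ με (r * t) t : ℝ) : ℂ)) := fun r => by push_cast; ring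
    simp_rw [e] at key
    rw [integral_const_mul] at key
    linear_combination (-1 / 2 : ℂ) * key
  · filter_upwards [ae_restrict_mem measurableSet_Ioi] with r hr
    have hr' := mul_pos hr ht
    rw [Complex.norm_real, Real.norm_of_nonneg (h.waveDist_nonneg hr' t)]
    exact h.waveDist_le_one hr' ht.le

/-- The flux, tested in the variable `r = x / t`, concentrates at the speed `1 / √m`. -/
lemma tendsto_integral_waveFlux (h : Dissipative μσ με) {l : Filter ℝ} [l.IsCountablyGenerated]
    {m : ℝ} (hm : 0 < m) (hl : ∀ᶠ t in l, 0 < t)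
    (hR : ∀ j : ℕ, 0 < j → Tendsto (fun t : ℝ => ratioR μσ με (j / t)) l (𝓝 m)) {φ : ℝ → ℂ}
    (hφ : ContDiff ℝ ∞ φ) (hc : HasCompactSupport φ) :
    Tendsto (fun t => ∫ r in Ioi (0 : ℝ), φ r * ((t * waveFlux μσ με (r * t) t : ℝ) : ℂ)) l
      (𝓝 (1 / 2 * φ (1 / √m))) := by
  have hdc : Continuous (deriv φ) := hφ.continuous_deriv (by simp)
  have hdi : Integrable (deriv φ) := hdc.integrable_of_hasCompactSupport hc.deriv
  have hsm : 0 < √m := Real.sqrt_pos.2 hm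
  set v := 1 / √m with hv
  have hv0 : 0 < v := by positivity
  have hval : ∫ r in Ioi (0 : ℝ), (Ioc 0 v).indicator (deriv φ) r = φ v - φ 0 := by
    rw [setIntegral_indicator measurableSet_Ioc, inter_eq_right.2 Ioc_subset_Ioi_self,
      ← intervalIntegral.integral_of_le hv0.le]
    exact intervalIntegral.integral_deriv_eq_sub (fun r _ => hφ.differentiable (by simp) r)
      (hdc.intervalIntegrable _ _)
  have hlim : Tendsto (fun t => ∫ r in Ioi (0 : ℝ), deriv φ r * (waveDist μσ με (r * t) t : ℂ)) l
      (𝓝 (∫ r in Ioi (0 : ℝ), (Ioc 0 v).indicator (deriv φ) r)) := by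
    refine tendsto_integral_filter_of_dominated_convergence (fun r => ‖deriv φ r‖) ?_ ?_
      hdi.norm.integrableOn ?_
    · filter_upwards [hl] with t ht
      refine hdc.aestronglyMeasurable.mul (ContinuousOn.aestronglyMeasurable (fun r hr => ?_)
        measurableSet_Ioi)
      exact (h.hasDerivAt_waveDist_ray hr ht).ofReal_comp.continuousAt.continuousWithinAt
    · filter_upwards [hl] with t ht
      filter_upwards [ae_restrict_mem measurableSet_Ioi] with r hr
      have hr' := mul_pos hr ht
      rw [norm_mul, Complex.norm_real, Real.norm_of_nonneg (h.waveDist_nonneg hr' t)]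
      exact mul_le_of_le_one_right (norm_nonneg _) (h.waveDist_le_one hr' ht.le)
    · have hne : ∀ᵐ r ∂volume.restrict (Ioi (0 : ℝ)), r ≠ v :=
        ae_restrict_of_ae (by simp [ae_iff])
      filter_upwards [ae_restrict_mem measurableSet_Ioi, hne] with r hr hrv
      have hr' : 0 < r := hr
      rcases lt_or_gt_of_ne hrv with hlt | hgt
      · have h1 : r * √m < 1 := by rwa [hv, lt_div_iff₀ hsm] at hlt
        rw [indicator_of_mem (show r ∈ Ioc 0 v from ⟨hr', hlt.le⟩)]
        have e2 := (Complex.continuous_ofReal.tendsto 1).comp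
          (h.tendsto_waveDist_ray_one hl hR hr' h1)
        simpa using e2.const_mul (deriv φ r)
      · have h1 : 1 < r * √m := by rwa [hv, div_lt_iff₀ hsm] at hgt
        rw [indicator_of_notMem (fun hmem : r ∈ Ioc 0 v => not_lt.2 hmem.2 hgt)]
        have e2 := (Complex.continuous_ofReal.tendsto 0).comp
          (h.tendsto_waveDist_ray_zero hl hR hr' h1)
        simpa using e2.const_mul (deriv φ r)
  rw [hval] at hlim
  have h2 := (hlim.const_add (φ 0)).const_mul (1 / 2 : ℂ)
  rw [add_sub_cancel] at h2
  refine h2.congr' ?_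
  filter_upwards [hl] with t ht
  exact (h.integral_waveFlux_mul ht hφ hc).symm

lemma hDecay_laplaceS (h : Dissipative μσ με) {x : ℝ} (hx : x ≠ 0) :
    HDecay (laplaceS μσ με x) := by
  have h1 := h.hDecay (h.hBounded_half_symbolPsi.mul HBounded.inv) (abs_pos.2 hx)
  convert h1 using 1
  funext s
  simp only [laplaceS, waveKernel]
  congr 1
  rw [div_eq_mul_inv, mul_inv, mul_assoc]

lemma isFundamentalSolution (h : Dissipative μσ με) :
    IsFundamentalSolution μσ με (waveS μσ με) := fun _ hx => (h.hDecay_laplaceS hx).isInverseLaplace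

lemma isTimeDerivative (h : Dissipative μσ με) :
    IsTimeDerivative (waveS μσ με) (waveK μσ με) := fun x hx t _ =>
  HDecay.hasDerivAt_invL (h.hDecay_laplaceS hx)
    (h.hDecay h.hBounded_half_symbolPsi (abs_pos.2 hx)) (fun s hs => by
      have hs0 : s ≠ 0 := fun e => by simp [e] at hs
      simp only [laplaceS, waveKernel]
      field_simp) t

lemma heavisideMul_waveK (h : Dissipative μσ με) {t : ℝ} (ht : 0 < t) (r : ℝ) :
    (t : ℂ) * heavisideMul (waveK μσ με) (r * t) t =
      (Ioi (0 : ℝ)).indicator (fun r => ((t * waveFlux μσ με (r * t) t : ℝ) : ℂ)) r := by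
  by_cases hr : 0 < r
  · have hrt := mul_pos hr ht
    rw [indicator_of_mem (show r ∈ Ioi (0 : ℝ) from hr), heavisideMul, if_pos hrt, waveK,
      abs_of_pos hrt, (h.waveFlux_spec hrt t).2, Complex.ofReal_mul]
  · rw [indicator_of_notMem (show r ∉ Ioi (0 : ℝ) from hr), heavisideMul, if_neg, mul_zero]
    exact not_lt.2 (mul_nonpos_of_nonpos_of_nonneg (not_lt.1 hr) ht.le)

lemma hasWeakVelocityAlong (h : Dissipative μσ με) {l : Filter ℝ} [l.IsCountablyGenerated]
    {m : ℝ} (hm : 0 < m) (hl : ∀ᶠ t in l, 0 < t)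
    (hR : ∀ j : ℕ, 0 < j → Tendsto (fun t : ℝ => ratioR μσ με (j / t)) l (𝓝 m)) :
    HasWeakVelocityAlong l (heavisideMul (waveK μσ με)) (1 / √m) := by
  refine ⟨fun t ht => ?_, 1 / 2, by norm_num, fun φ hφ hc => ?_⟩
  · simp_rw [h.heavisideMul_waveK ht]
    have hi : IntegrableOn (fun r => ((t * waveFlux μσ με (r * t) t : ℝ) : ℂ)) (Ioi 0) :=
      (h.integrableOn_waveFlux ht).ofReal
    exact ((integrable_indicator_iff measurableSet_Ioi).2 hi).locallyIntegrable
  · refine (h.tendsto_integral_waveFlux hm hl hR hφ hc).congr' ?_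
    filter_upwards [hl] with t ht
    simp_rw [h.heavisideMul_waveK ht]
    rw [← integral_indicator measurableSet_Ioi]
    congr 1
    funext r
    by_cases hr : r ∈ Ioi (0 : ℝ)
    · rw [indicator_of_mem hr, indicator_of_mem hr, mul_comm]
    · rw [indicator_of_notMem hr, indicator_of_notMem hr, zero_mul]

end Dissipative

theorem mainTheorem8 (μσ με : Measure ℝ) [IsFiniteMeasure μσ] [IsFiniteMeasure με]
    (hσ : μσ (Icc 0 1)ᶜ = 0) (hε : με (Icc 0 1)ᶜ = 0)
    (hσ0 : μσ ≠ 0) (hε0 : με ≠ 0)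
    (hT : ThermoRestriction μσ με)
    (hproper : IsProperFractional μσ με)
    (hexc : ¬ IsExceptional μσ με)
    (hprop : ¬ ∃ c : ℝ≥0, μσ = c • με) :
    ∃ (τ : ℝ) (ρ : ℝ≥0∞), 0 ≤ τ ∧ 0 < ρ ∧
      Tendsto (symbolRatio μσ με) (Bornology.cobounded ℂ) (𝓝 (τ : ℂ)) ∧
      TendstoExtended (symbolRatio μσ με) (𝓝[≠] 0) ρ ∧
      ∃ S K : ℝ → ℝ → ℂ,
        IsFundamentalSolution μσ με S ∧ IsTimeDerivative S K ∧
        (0 < τ → HasWeakInitialVelocity (heavisideMul K) (1 / √τ)) ∧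
        (ρ < ⊤ → HasWeakEquilibriumVelocity (heavisideMul K) (1 / √ρ.toReal)) := by
  have h : Admissible μσ με := ⟨hσ, hε, hσ0, hε0, hT⟩
  have hd := h.dissipative hprop hexc
  obtain ⟨τ, hτ0, hτR, hτ⟩ := h.exists_limit_atTop
  obtain ⟨ρ, hρ0, hρR, hρ⟩ := h.exists_limit_zero
  refine ⟨τ, ρ, hτ0, hρ0, hτ, hρ, waveS μσ με, waveK μσ με, hd.isFundamentalSolution,
    hd.isTimeDerivative, fun hτpos => ⟨by positivity, ?_⟩, fun hρtop => ?_⟩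
  · refine hd.hasWeakVelocityAlong hτpos self_mem_nhdsWithin fun j hj => hτR.comp ?_
    exact tendsto_const_nhds.pos_mul_atTop (by exact_mod_cast hj) tendsto_inv_nhdsGT_zero
  · refine hd.hasWeakVelocityAlong (ENNReal.toReal_pos hρ0.ne' hρtop.ne)
      (eventually_gt_atTop 0) fun j hj => (hρR hρtop.ne).comp ?_
    refine tendsto_nhdsWithin_iff.2 ⟨tendsto_const_nhds.div_atTop tendsto_id, ?_⟩
    filter_upwards [eventually_gt_atTop 0] with t ht
    exact div_pos (by exact_mod_cast hj) ht
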